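/- **Proposition 8.1.** Notation: $\Gamma\left[\begin{smallmatrix}a,b,\dots\\ c,d,\dots\end{smallmatrix}\right]=\frac{\Gamma(a)\Gamma(b)\cdots}{\Gamma(c)\Gamma(d)\cdots}$ and $(a)_k=a(a+1)\cdots(a+k-1)$. The value ${}_3F_2\left[\begin{smallmatrix}a,b,c\\ e,f\end{smallmatrix}\big|1\right]$ is the sum of the hypergeometric series at $1$ if $\operatorname{Re}(e+f-a-b-c)>0$, and is otherwise understood by analytic continuation: $\frac{1}{\Gamma(e)\Gamma(f)\Gamma(e+f-a-b-c)}\,{}_3F_2\left[\begin{smallmatrix}a,b,c\\ e,f\end{smallmatrix}\big|1\right]$ continues to an entire function of $(a,b,c,e,f)\in\mathbb C^5$. Let $N\ge1$ be an integer, $\mathfrak X=\mathbb Z+\frac{N-1}2$, $\mathfrak X_{\rm in}=\{-\frac{N-1}2,-\frac{N-3}2,\dots,\frac{N-1}2\}$ and $\mathfrak X_{\rm out}=\mathfrak X\setminus\mathfrak X_{\rm in}$. Let $z,z',w,w'\in\mathbb C$, let $\Sigma=z+z'+w+w'$, and assume that $\operatorname{Re}\Sigma>0$ and that none of $z+w$,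 $z+w'$, $z'+w$, $z'+w'$ is in $\{-1,-2,\dots\}$. Put $$\psi_{\rm out}(x)=\frac{\left(\left(x-\frac{N-1}2\right)_N\right)^2}{\Gamma(-x+z+\frac{N+1}2)\Gamma(-x+z'+\frac{N+1}2)\Gamma(x+w+\frac{N+1}2)\Gamma(x+w'+\frac{N+1}2)},$$ $$h_{N-1}=\Gamma\left[\begin{matrix}N,\ \Sigma+1,\ \Sigma+2\\ \Sigma+N+1,\ z+w+1,\ z+w'+1,\ z'+w+1,\ z'+w'+1\end{matrix}\right],$$ $$p_N(x)=\frac{\Gamma(x+w'+\frac{N+1}2)}{\Gamma(x+w'-\frac{N-1}2)}\;{}_3F_2\left[\begin{matrix}-N,\ z+w',\ z'+w'\\ \Sigma,\ x+w'-\frac{N-1}2\end{matrix}\Big|1\right],$$ $$p_{N-1}(x)=\frac{\Gamma(x+w'+\frac{N+1}2)}{\Gamma(x+w'-\frac{N-3}2)}\;{}_3F_2\left[\begin{matrix}-N+1,\ z+w'+1,\ z'+w'+1\\ \Sigma+2,\ x+w'-\frac{N-3}2\end{matrix}\Big|1\right]$$ (here the hypergeometric series are finite sums, and $p_N$ and $p_{N-1}$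 are polynomials in $x$), and $$R_{\rm out}(x)=\frac{p_N(x)}{(x-\frac{N-1}2)\cdots(x+\frac{N-1}2)},\qquad S_{\rm out}(x)=\frac{p_{N-1}(x)}{h_{N-1}\,(x-\frac{N-1}2)\cdots(x+\frac{N-1}2)}.$$ For $x\in\mathbb C\setminus\mathfrak X_{\rm out}$ set $$S_{\rm in}^{(N)}(x)=-\sum_{y\in\mathfrak X_{\rm out}}\frac{\psi_{\rm out}(y)R_{\rm out}(y)}{y-x},\qquad R_{\rm in}^{(N)}(x)=1-\sum_{y\in\mathfrak X_{\rm out}}\frac{\psi_{\rm out}(y)S_{\rm out}(y)}{y-x}.$$ Then, for every $x\in\mathbb C\setminus\mathfrak X_{\rm out}$, both series converge absolutely, and $$R_{\rm in}^{(N)}(x)=-A(z,z')-A(z',z),\qquad S_{\rm in}^{(N)}(x)=-B(z,z')-B(z',z),$$ where $$\begin{aligned}A(z,z')={}&\frac{\sin\pi z}{\pi}\,\Gamma\left[\begin{matrix}z'-z,\ z+w+1,\ z+w'+1\\ \Sigma+1\end{matrix}\right]\Gamma\left[\begin{matrix}x+\frac{N+1}2,\ -x+\frac{N+1}2,\ N+1+\Sigma\\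 -x+z'+\frac{N+1}2,\ x+w+\frac{N+1}2,\ N+1+z+w'\end{matrix}\right]\\&\times{}_3F_2\left[\begin{matrix}z+w'+1,\ -z'-w,\ -x+z+\frac{N+1}2\\ z-z'+1,\ N+1+z+w'\end{matrix}\Big|1\right],\end{aligned}$$ $$\begin{aligned}B(z,z')={}&\frac{\sin\pi z}{\pi}\,\Gamma\left[\begin{matrix}z'-z,\ \Sigma\\ z'+w,\ z'+w'\end{matrix}\right]\Gamma\left[\begin{matrix}x+\frac{N+1}2,\ -x+\frac{N+1}2,\ N+1\\ -x+z'+\frac{N+1}2,\ x+w+\frac{N+1}2,\ N+1+z+w'\end{matrix}\right]\\&\times{}_3F_2\left[\begin{matrix}-z'-w+1,\ z+w',\ -x+z+\frac{N+1}2\\ z-z'+1,\ N+1+z+w'\end{matrix}\Big|1\right].\end{aligned}$$ The identities hold literally if $z-z'\notin\mathbb Z$ and $x+w+\frac{N+1}2\notin\{0,-1,-2,\dots\}$. At the remaining $(z,z',w,w',x)$ the right-hand sides have removable singularities, and the identities hold in the limit: the right-hand sides converge to $R_{\rm in}^{(N)}(x)$ and $S_{\rm in}^{(N)}(x)$ as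 the point is approached, jointly in all five variables, through points where the identities hold literally. -/

import Mathlib

open Filter Topology

namespace ZW

/-! ### The hypergeometric function of type (3,2) at the unit argument -/

/-- The rising factorial `(a)_k = a (a + 1) ⋯ (a + k - 1)`. -/
noncomputable def poch (a : ℂ) (k : ℕ) : ℂ := (ascPochhammer ℂ k).eval a

/-- The hypergeometric series of type (3,2) at `1`:
`∑ k, (a)_k (b)_k (c)_k / (k! (e)_k (f)_k)`.
For `e, f ∉ {0, -1, -2, …}` it converges absolutely when `Re (e + f - a - b - c) > 0`. -/
noncomputable def series3F2 (a b c e f : ℂ) : ℂ :=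
  ∑' k : ℕ, poch a k * poch b k * poch c k / ((k.factorial : ℂ) * poch e k * poch f k)

/-- `F` is an entire function of five complex variables which agrees with
`₃F₂(a, b, c; e, f; 1) / (Γ(e) Γ(f) Γ(e + f - a - b - c))` wherever the series makes sense and
converges. There is at most one such `F`, since the points where agreement is required contain a
non-empty open subset of `ℂ⁵`. -/
def IsReg3F2 (F : ℂ × ℂ × ℂ × ℂ × ℂ → ℂ) : Prop :=
  Differentiable ℂ F ∧
    ∀ a b c e f : ℂ, (∀ k : ℕ, e ≠ -(k : ℂ)) → (∀ k : ℕ, f ≠ -(k : ℂ)) →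
      0 < (e + f - a - b - c).re →
      F (a, b, c, e, f) =
        series3F2 a b c e f /
          (Complex.Gamma e * Complex.Gamma f * Complex.Gamma (e + f - a - b - c))

/-- The (unique) entire continuation of
`₃F₂(a, b, c; e, f; 1) / (Γ(e) Γ(f) Γ(e + f - a - b - c))`. -/
noncomputable def reg3F2 : ℂ × ℂ × ℂ × ℂ × ℂ → ℂ := Classical.epsilon IsReg3F2

/-- The value `₃F₂(a, b, c; e, f; 1)`, understood by analytic continuation in the parameters.
It is meaningful when none of `e`, `f`, `e + f - a - b - c` lies in `{0, -1, -2, …}`. -/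
noncomputable def F32 (a b c e f : ℂ) : ℂ :=
  Complex.Gamma e * Complex.Gamma f * Complex.Gamma (e + f - a - b - c) * reg3F2 (a, b, c, e, f)

/-- The product `Γ(f + n) / Γ(f) * ₃F₂(-n, b, c; e, f; 1)`, written as the polynomial in `f` that
it is: `Γ(f + n) / (Γ(f) (f)_k) = (f + k)_{n - k}`. -/
noncomputable def gammaTerm3F2 (n : ℕ) (b c e f : ℂ) : ℂ :=
  ∑ k ∈ Finset.range (n + 1),
    poch (-(n : ℂ)) k * poch b k * poch c k / ((k.factorial : ℂ) * poch e k) *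
      poch (f + k) (n - k)

/-! ### The lattice -/

/-- The lattice `ℤ + (N - 1)/2`. -/
def lattice (N : ℕ) : Set ℂ := {x | ∃ k : ℤ, x = k + ((N : ℂ) - 1) / 2}

/-- The inner part `{-(N-1)/2, -(N-3)/2, …, (N-1)/2}`, which has `N` points. -/
def latticeIn (N : ℕ) : Set ℂ := {x | ∃ j : ℕ, j < N ∧ x = j - ((N : ℂ) - 1) / 2}

/-- The outer part `{…, -(N+3)/2, -(N+1)/2} ∪ {(N+1)/2, (N+3)/2, …}`. -/
def latticeOut (N : ℕ) : Set ℂ := lattice N \ latticeIn N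

/-! ### The parameters and the functions attached to them -/

/-- The quadruples `(z, z', w, w')` with `Re (z + z' + w + w') > -1` and
`z + w, z + w', z' + w, z' + w' ∉ {-1, -2, …}`. -/
def D0 : Set (ℂ × ℂ × ℂ × ℂ) :=
  {p | -1 < (p.1 + p.2.1 + p.2.2.1 + p.2.2.2).re ∧
    ∀ k : ℕ, p.1 + p.2.2.1 ≠ -((k : ℂ) + 1) ∧ p.1 + p.2.2.2 ≠ -((k : ℂ) + 1) ∧
      p.2.1 + p.2.2.1 ≠ -((k : ℂ) + 1) ∧ p.2.1 + p.2.2.2 ≠ -((k : ℂ) + 1)}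

section functions

variable (N : ℕ) (z z' w w' x : ℂ)

/-- The weight on the outer lattice. -/
noncomputable def psiOut : ℂ :=
  poch (x - ((N : ℂ) - 1) / 2) N ^ 2 /
    (Complex.Gamma (-x + z + ((N : ℂ) + 1) / 2) * Complex.Gamma (-x + z' + ((N : ℂ) + 1) / 2) *
      Complex.Gamma (x + w + ((N : ℂ) + 1) / 2) * Complex.Gamma (x + w' + ((N : ℂ) + 1) / 2))

/-- The monic polynomial of degree `N`
`Γ(x + w' + (N+1)/2) / Γ(x + w' - (N-1)/2) *
  ₃F₂(-N, z + w', z' + w'; Σ, x + w' - (N-1)/2; 1)`, with `Σ = z + z' + w + w'`. -/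
noncomputable def pN : ℂ :=
  gammaTerm3F2 N (z + w') (z' + w') (z + z' + w + w') (x + w' - ((N : ℂ) - 1) / 2)

/-- The monic polynomial of degree `N - 1`
`Γ(x + w' + (N+1)/2) / Γ(x + w' - (N-3)/2) *
  ₃F₂(-N + 1, z + w' + 1, z' + w' + 1; Σ + 2, x + w' - (N-3)/2; 1)` (for `N ≥ 1`). -/
noncomputable def pNsub1 : ℂ :=
  gammaTerm3F2 (N - 1) (z + w' + 1) (z' + w' + 1) (z + z' + w + w' + 2)
    (x + w' - ((N : ℂ) - 3) / 2)

/-- The constant `h_{N-1}`. -/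
noncomputable def hNsub1 : ℂ :=
  Complex.Gamma N * Complex.Gamma (z + z' + w + w' + 1) * Complex.Gamma (z + z' + w + w' + 2) /
    (Complex.Gamma (z + z' + w + w' + N + 1) * Complex.Gamma (z + w + 1) *
      Complex.Gamma (z + w' + 1) * Complex.Gamma (z' + w + 1) * Complex.Gamma (z' + w' + 1))

/-- `R_out(x) = p_N(x) / ((x - (N-1)/2) ⋯ (x + (N-1)/2))`. -/
noncomputable def Rout : ℂ := pN N z z' w w' x / poch (x - ((N : ℂ) - 1) / 2) N

/-- `S_out(x) = p_{N-1}(x) / (h_{N-1} (x - (N-1)/2) ⋯ (x + (N-1)/2))`. -/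
noncomputable def Sout : ℂ :=
  pNsub1 N z z' w w' x / (hNsub1 N z z' w w' * poch (x - ((N : ℂ) - 1) / 2) N)

/-- The summand `ψ_out(y) S_out(y) / (y - x)`. -/
noncomputable def RinTerm (y : ℂ) : ℂ := psiOut N z z' w w' y * Sout N z z' w w' y / (y - x)

/-- The summand `ψ_out(y) R_out(y) / (y - x)`. -/
noncomputable def SinTerm (y : ℂ) : ℂ := psiOut N z z' w w' y * Rout N z z' w w' y / (y - x)

/-- `R_in(x)`, a Cauchy-type sum over the outer lattice. -/
noncomputable def Rin : ℂ := 1 - ∑' y : latticeOut N, RinTerm N z z' w w' x y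

/-- `S_in(x)`, a Cauchy-type sum over the outer lattice. -/
noncomputable def Sin : ℂ := -∑' y : latticeOut N, SinTerm N z z' w w' x y

/-- The building block of the closed form of `R_in`. -/
noncomputable def RinBlock : ℂ :=
  Complex.sin (Real.pi * z) / Real.pi *
    (Complex.Gamma (z' - z) * Complex.Gamma (z + w + 1) * Complex.Gamma (z + w' + 1) /
      Complex.Gamma (z + z' + w + w' + 1)) *
    (Complex.Gamma (x + ((N : ℂ) + 1) / 2) * Complex.Gamma (-x + ((N : ℂ) + 1) / 2) *
        Complex.Gamma (N + 1 + (z + z' + w + w')) /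
      (Complex.Gamma (-x + z' + ((N : ℂ) + 1) / 2) * Complex.Gamma (x + w + ((N : ℂ) + 1) / 2) *
        Complex.Gamma (N + 1 + z + w'))) *
    F32 (z + w' + 1) (-z' - w) (-x + z + ((N : ℂ) + 1) / 2) (z - z' + 1) (N + 1 + z + w')

/-- The building block of the closed form of `S_in`. -/
noncomputable def SinBlock : ℂ :=
  Complex.sin (Real.pi * z) / Real.pi *
    (Complex.Gamma (z' - z) * Complex.Gamma (z + z' + w + w') /
      (Complex.Gamma (z' + w) * Complex.Gamma (z' + w'))) *
    (Complex.Gamma (x + ((N : ℂ) + 1) / 2) * Complex.Gamma (-x + ((N : ℂ) + 1) / 2) *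
        Complex.Gamma (N + 1) /
      (Complex.Gamma (-x + z' + ((N : ℂ) + 1) / 2) * Complex.Gamma (x + w + ((N : ℂ) + 1) / 2) *
        Complex.Gamma (N + 1 + z + w'))) *
    F32 (-z' - w + 1) (z + w') (-x + z + ((N : ℂ) + 1) / 2) (z - z' + 1) (N + 1 + z + w')

/-- The closed form of `R_in`: the two terms are interchanged under `z ↔ z'`. -/
noncomputable def RinClosed : ℂ := -RinBlock N z z' w w' x - RinBlock N z' z w w' x

/-- The closed form of `S_in`: the two terms are interchanged under `z ↔ z'`. -/
noncomputable def SinClosed : ℂ := -SinBlock N z z' w w' x - SinBlock N z' z w w' x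

end functions

/-- The points `(z, z', w, w', x)` at which none of the `₃F₂` values in the closed forms is singular
in itself: `z - z' ∉ ℤ`, and `x + w + (N+1)/2`, which is the excess of the sum of the lower
parameters over that of the upper ones, is not in `{0, -1, -2, …}`. -/
def generic (N : ℕ) : Set (ℂ × ℂ × ℂ × ℂ × ℂ) :=
  {q | (∀ k : ℤ, q.1 - q.2.1 ≠ k) ∧
    ∀ k : ℕ, q.2.2.2.2 + q.2.2.1 + ((N : ℂ) + 1) / 2 ≠ -(k : ℂ)}

/-! ### The polynomial form of the terminating series -/

theorem poch_ne_zero {f : ℂ} (hf : ∀ k : ℕ, f ≠ -(k : ℂ)) (n : ℕ) : poch f n ≠ 0 := by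
  induction n with
  | zero => simp [poch]
  | succ n ih =>
    have h : f + n ≠ 0 := fun h => hf n (by linear_combination h)
    simpa [poch, ascPochhammer_succ_right, h] using ih

theorem poch_add (f : ℂ) (k m : ℕ) : poch f (k + m) = poch f k * poch (f + k) m := by
  simp [poch, ← ascPochhammer_mul]

theorem Gamma_add_nat {f : ℂ} (hf : ∀ k : ℕ, f ≠ -(k : ℂ)) (n : ℕ) :
    Complex.Gamma (f + n) = poch f n * Complex.Gamma f := by
  induction n with
  | zero => simp [poch]
  | succ n ih =>
    have h : f + n ≠ 0 := fun h => hf n (by linear_combination h)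
    have h2 : poch f (n + 1) = poch f n * (f + n) := by simp [poch, ascPochhammer_succ_right]
    rw [Nat.cast_succ, ← add_assoc, Complex.Gamma_add_one _ h, ih, h2]
    ring

theorem poch_neg_nat (n k : ℕ) (h : n < k) : poch (-(n : ℂ)) k = 0 := by
  obtain ⟨m, rfl⟩ := Nat.exists_eq_add_of_lt h
  rw [add_assoc, poch_add]
  simp [poch, ascPochhammer_succ_left]

/-- Away from the poles of the gamma factors, `gammaTerm3F2` is the gamma quotient times the
terminating series. -/
theorem gammaTerm3F2_eq (n : ℕ) (b c e f : ℂ) (hf : ∀ k : ℕ, f ≠ -(k : ℂ)) :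
    gammaTerm3F2 n b c e f =
      Complex.Gamma (f + n) / Complex.Gamma f * series3F2 (-(n : ℂ)) b c e f := by
  have hG : Complex.Gamma f ≠ 0 := Complex.Gamma_ne_zero hf
  rw [series3F2, tsum_eq_sum (s := Finset.range (n + 1)), gammaTerm3F2, Finset.mul_sum]
  · refine Finset.sum_congr rfl fun k hk => ?_
    have hk' : k ≤ n := Nat.lt_succ_iff.mp (Finset.mem_range.mp hk)
    have h3 : poch f n = poch f k * poch (f + k) (n - k) := by
      rw [← poch_add, Nat.add_sub_cancel' hk']
    have h4 : poch f n * Complex.Gamma f / Complex.Gamma f = poch f n := mul_div_cancel_right₀ _ hG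
    have h5 := poch_ne_zero hf k
    rw [Gamma_add_nat hf, h4, h3, div_mul_eq_mul_div, mul_div_assoc', ← mul_div_mul_right _ _ h5]
    congr 1
    ring
  · intro k hk
    rw [poch_neg_nat n k (by simpa using hk)]
    simp

end ZW

namespace ZW

/-! ### Rising factorials and the reciprocal gamma function -/

@[simp] theorem poch_zero (a : ℂ) : poch a 0 = 1 := by simp [poch]

theorem poch_succ (a : ℂ) (k : ℕ) : poch a (k + 1) = poch a k * (a + k) := by
  simp [poch, ascPochhammer_succ_right]

@[simp] theorem poch_one (a : ℂ) : poch a 1 = a := by simp [poch]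

theorem poch_succ_left (a : ℂ) (k : ℕ) : poch a (k + 1) = a * poch (a + 1) k := by
  rw [add_comm k 1, poch_add, poch_one, Nat.cast_one]

theorem poch_reflect (a : ℂ) (k : ℕ) : poch (a - k) k = (-1) ^ k * poch (1 - a) k := by
  induction k generalizing a with
  | zero => simp
  | succ k ih =>
    rw [poch_succ_left, show a - (k + 1 : ℕ) + 1 = a - k by push_cast; ring, ih, poch_succ]
    push_cast
    ring

/-- The reciprocal gamma function. -/
noncomputable def rG (s : ℂ) : ℂ := (Complex.Gamma s)⁻¹

theorem differentiable_rG : Differentiable ℂ rG := Complex.differentiable_one_div_Gamma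

theorem rG_eq_mul (a : ℂ) : rG a = a * rG (a + 1) :=
  Complex.one_div_Gamma_eq_self_mul_one_div_Gamma_add_one a

theorem rG_eq_poch_mul (a : ℂ) (k : ℕ) : rG a = poch a k * rG (a + k) := by
  induction k with
  | zero => simp
  | succ k ih =>
    rw [ih, poch_succ, rG_eq_mul (a + k)]
    push_cast
    ring_nf

theorem rG_sub_nat (a : ℂ) (k : ℕ) : rG (a - k) = (-1) ^ k * poch (1 - a) k * rG a := by
  rw [rG_eq_poch_mul (a - k) k, poch_reflect, sub_add_cancel]

theorem Gamma_mul_rG {a : ℂ} (h : ∀ k : ℕ, a ≠ -(k : ℂ)) : Complex.Gamma a * rG a = 1 :=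
  mul_inv_cancel₀ (Complex.Gamma_ne_zero h)

theorem ne_neg_nat_of_re_pos {a : ℂ} (h : 0 < a.re) (k : ℕ) : a ≠ -(k : ℂ) := by
  rintro rfl
  simp at h
  exact absurd h (not_lt.mpr (Nat.cast_nonneg k))

/-! ### Terminating summation formulas -/

open Finset in
theorem sum_antidiagonal_assoc (G : ℕ → ℕ → ℕ → ℂ) (m : ℕ) :
    ∑ p ∈ antidiagonal m, ∑ q ∈ antidiagonal p.1, G q.1 q.2 p.2 =
      ∑ p ∈ antidiagonal m, ∑ q ∈ antidiagonal p.2, G p.1 q.1 q.2 := by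
  rw [sum_sigma', sum_sigma']
  refine sum_bij' (fun x _ => ⟨(x.2.1, x.2.2 + x.1.2), (x.2.2, x.1.2)⟩)
    (fun x _ => ⟨(x.1.1 + x.2.1, x.2.2), (x.1.1, x.2.1)⟩) ?_ ?_ ?_ ?_ ?_ <;>
  simp only [mem_sigma, HasAntidiagonal.mem_antidiagonal, Sigma.forall, Prod.forall, and_imp] <;>
  rintro a b c d rfl rfl <;> simp_all [add_assoc]

open Finset in
theorem sum_choose_succ_mul (f : ℕ → ℕ → ℂ) (n : ℕ) :
    ∑ p ∈ antidiagonal (n + 1), ((n + 1).choose p.1 : ℂ) * f p.1 p.2 =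
      ∑ p ∈ antidiagonal n, (n.choose p.1 : ℂ) * (f p.1 (p.2 + 1) + f (p.1 + 1) p.2) := by
  rw [sum_antidiagonal_choose_succ_mul, ← sum_add_distrib]
  refine sum_congr rfl fun p hp => ?_
  rw [Nat.choose_symm_of_eq_add (HasAntidiagonal.mem_antidiagonal.mp hp).symm]
  ring

open Finset in
theorem poch_sub (X D : ℂ) (n : ℕ) :
    poch (X - D) n = ∑ p ∈ antidiagonal n,
      (n.choose p.1 : ℂ) * ((-1) ^ p.1 * poch D p.1 * poch (X + p.1) p.2) := by
  induction n generalizing X with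
  | zero => simp
  | succ n ih =>
    rw [sum_choose_succ_mul
      (fun i j => (-1) ^ i * poch D i * poch (X + i) j), poch_succ_left,
      show X - D + 1 = (X + 1) - D by ring, ih, mul_sum]
    refine sum_congr rfl fun p _ => ?_
    rw [poch_succ D, poch_succ_left (X + p.1)]
    push_cast
    rw [show X + 1 + (p.1 : ℂ) = X + p.1 + 1 by ring, show X + ((p.1 : ℂ) + 1) = X + p.1 + 1 by ring]
    ring

open Finset in
theorem poch_add_eq_sum (u v : ℂ) (n : ℕ) :
    poch (u + v) n = ∑ p ∈ antidiagonal n, (n.choose p.1 : ℂ) * (poch u p.1 * poch v p.2) := by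
  induction n with
  | zero => simp
  | succ n ih =>
    rw [sum_choose_succ_mul (fun i j => poch u i * poch v j), poch_succ, ih, sum_mul]
    refine sum_congr rfl fun p hp => ?_
    rw [poch_succ, poch_succ]
    have : (n : ℂ) = p.1 + p.2 := by exact_mod_cast (HasAntidiagonal.mem_antidiagonal.mp hp).symm
    rw [this]
    ring

theorem choose_mul_choose (k l q : ℕ) :
    ((k + l + q).choose (k + l) : ℂ) * ((k + l).choose k : ℂ) =
      ((k + l + q).choose k : ℂ) * ((l + q).choose l : ℂ) := by
  have h := Nat.choose_mul (n := k + l + q) (k := k + l) (s := k)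
  rw [show k + l + q - k = l + q by omega, show k + l - k = l by omega] at h
  exact_mod_cast h (by omega)

open Finset in
/-- The Pfaff-Saalschütz formula in polynomial form. -/
theorem poch_mul_poch_eq_sum (b c d : ℂ) (m : ℕ) :
    poch b m * poch c m = ∑ p ∈ antidiagonal m, (m.choose p.1 : ℂ) *
      (poch (d - b) p.1 * poch (d - c) p.1 * poch (d + p.1) p.2 * poch (b + c - d) p.2) := by
  set D := d - c with hD
  set G : ℕ → ℕ → ℕ → ℂ := fun k l q => ((k + l + q).choose (k + l) : ℂ) *
    ((k + l).choose k : ℂ) * ((-1) ^ l * poch (d - b) k * poch D (k + l) *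
      poch (b + (k + l : ℕ)) q * poch (d + k) l * poch (d + (k + l : ℕ)) q) with hG
  have h1 : ∀ p ∈ antidiagonal m, (m.choose p.1 : ℂ) *
      (poch (d - b) p.1 * poch D p.1 * poch (d + p.1) p.2 * poch (b + c - d) p.2) =
      ∑ q ∈ antidiagonal p.2, G p.1 q.1 q.2 := by
    rintro ⟨k, r⟩ hp
    rw [show b + c - d = (b + k) - (D + k) by rw [hD]; ring, poch_sub (b + k), mul_sum, mul_sum]
    refine sum_congr rfl ?_
    rintro ⟨l, q⟩ hq
    simp only [HasAntidiagonal.mem_antidiagonal] at hp hq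
    subst hq
    have hm : m = k + l + q := by omega
    subst hm
    simp only [hG]
    rw [choose_mul_choose, poch_add D k l, poch_add (d + k) l q]
    push_cast
    rw [show b + (k : ℂ) + l = b + (k + l) by ring, show d + (k : ℂ) + l = d + (k + l) by ring]
    ring
  rw [sum_congr rfl h1, ← sum_antidiagonal_assoc]
  have h2 : ∀ p ∈ antidiagonal m, ∑ q ∈ antidiagonal p.1, G q.1 q.2 p.2 =
      poch b m * ((m.choose p.1 : ℂ) * ((-1) ^ p.1 * poch D p.1 * poch (d + p.1) p.2)) := by
    rintro ⟨i, r⟩ hp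
    have hb : poch b i = ∑ q ∈ antidiagonal i,
        (i.choose q.1 : ℂ) * ((-1) ^ q.1 * poch (d - b) q.1 * poch (d + q.1) q.2) := by
      rw [← poch_sub]; congr 1; ring
    simp only [HasAntidiagonal.mem_antidiagonal] at hp
    subst hp
    rw [poch_add b i r, hb, sum_mul, sum_mul]
    refine sum_congr rfl ?_
    rintro ⟨k, l⟩ hq
    simp only [HasAntidiagonal.mem_antidiagonal] at hq
    subst hq
    have h : ((-1 : ℂ)) ^ k * (-1) ^ (k + l) = (-1) ^ l := by
      rw [← pow_add, show k + (k + l) = 2 * k + l by ring, pow_add, pow_mul]; simp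
    simp only [hG]
    rw [← h]
    ring
  rw [sum_congr rfl h2, ← mul_sum, ← poch_sub]
  congr 2
  rw [hD]; ring

/-! ### Growth of rising factorials, uniformly on bounded sets -/

theorem norm_one_add_le (u : ℂ) : ‖1 + u‖ ≤ Real.exp (u.re + ‖u‖ ^ 2 / 2) := by
  have h1 : ‖1 + u‖ ^ 2 ≤ Real.exp (u.re + ‖u‖ ^ 2 / 2) ^ 2 := by
    rw [← Real.exp_nat_mul, ← Complex.normSq_eq_norm_sq, ← Complex.normSq_eq_norm_sq]
    refine le_trans (le_of_eq ?_) (Real.add_one_le_exp _)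
    simp only [Complex.normSq_apply, Complex.add_re, Complex.one_re, Complex.add_im, Complex.one_im]
    push_cast
    ring
  exact (pow_le_pow_iff_left₀ (norm_nonneg _) (Real.exp_pos _).le two_ne_zero).mp h1

theorem norm_inv_one_add_le {u : ℂ} (hu : ‖u‖ ≤ 1 / 2) :
    ‖(1 + u)⁻¹‖ ≤ Real.exp (-u.re + 5 * ‖u‖ ^ 2) := by
  have h1 : 1 / 2 ≤ ‖1 + u‖ := by
    have := norm_sub_norm_le (1 : ℂ) (-u)
    rw [norm_neg, norm_one, sub_neg_eq_add] at this
    linarith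
  have h0 : 1 + u ≠ 0 := by
    intro h; rw [h, norm_zero] at h1; linarith
  set q := u ^ 2 / (1 + u) with hq
  have hqn : ‖q‖ ≤ 2 * ‖u‖ ^ 2 := by
    rw [hq, norm_div, norm_pow, div_le_iff₀ (by linarith)]
    nlinarith [sq_nonneg ‖u‖]
  have h2 : (1 + u)⁻¹ = 1 + (-u + q) := by
    rw [hq]; field_simp; ring
  rw [h2]
  refine (norm_one_add_le _).trans (Real.exp_le_exp.mpr ?_)
  have h3 : (-u + q).re ≤ -u.re + 2 * ‖u‖ ^ 2 := by
    simp only [Complex.add_re, Complex.neg_re]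
    linarith [Complex.re_le_norm q]
  have h4 : ‖-u + q‖ ≤ 2 * ‖u‖ := by
    refine (norm_add_le _ _).trans ?_
    rw [norm_neg]
    nlinarith [norm_nonneg u]
  nlinarith [norm_nonneg (-u + q), norm_nonneg u]

/-- Partial sums of `1 / (i + 1)`. -/
noncomputable def harm (k : ℕ) : ℝ := ∑ i ∈ Finset.range k, 1 / ((i : ℝ) + 1)

theorem harm_eq (k : ℕ) : harm k = (harmonic k : ℝ) := by
  simp [harm, harmonic]

theorem log_le_harm (k : ℕ) : Real.log (k + 1) ≤ harm k := by
  rw [harm_eq]; exact_mod_cast log_add_one_le_harmonic k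

theorem harm_le_log (k : ℕ) : harm k ≤ 1 + Real.log (k + 1) := by
  rw [harm_eq]
  refine (harmonic_le_one_add_log k).trans ?_
  rcases Nat.eq_zero_or_pos k with rfl | hk
  · simp
  · gcongr; linarith

theorem exp_mul_harm_le {t M : ℝ} (ht : |t| ≤ M) (k : ℕ) :
    Real.exp (t * harm k) ≤ Real.exp M * ((k : ℝ) + 1) ^ t := by
  have hk : (0 : ℝ) < k + 1 := by positivity
  rw [Real.rpow_def_of_pos hk, ← Real.exp_add]
  refine Real.exp_le_exp.mpr ?_
  have h1 := log_le_harm k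
  have h2 := harm_le_log k
  have h3 : t * (harm k - Real.log (k + 1)) ≤ M * 1 := by
    refine le_trans (le_abs_self _) ?_
    rw [abs_mul]
    refine mul_le_mul ht ?_ (abs_nonneg _) ((abs_nonneg t).trans ht)
    rw [abs_le]; constructor <;> linarith
  nlinarith

theorem sum_inv_sq_le (k : ℕ) : ∑ i ∈ Finset.range k, 1 / ((i : ℝ) + 1) ^ 2 ≤ 2 := by
  have h : ∀ k : ℕ, ∑ i ∈ Finset.range k, 1 / ((i : ℝ) + 1) ^ 2 ≤ 2 - 1 / (k : ℝ) := by
    intro k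
    induction k with
    | zero => simp
    | succ k ih =>
      rw [Finset.sum_range_succ]
      rcases Nat.eq_zero_or_pos k with rfl | hk
      · norm_num
      · have hk' : (0 : ℝ) < k := by exact_mod_cast hk
        have h1 : 1 / ((k : ℝ) + 1) ^ 2 ≤ 1 / ((k : ℝ) * (k + 1)) := by
          apply one_div_le_one_div_of_le <;> nlinarith
        have h2 : 1 / ((k : ℝ) * (k + 1)) = 1 / (k : ℝ) - 1 / ((k : ℝ) + 1) := by
          field_simp; ring
        push_cast
        linarith
  exact (h k).trans (by have : 0 ≤ 1 / (k : ℝ) := by positivity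
                        linarith)

theorem harm_succ (k : ℕ) : harm (k + 1) = harm k + 1 / ((k : ℝ) + 1) :=
  Finset.sum_range_succ _ _

theorem harm_nonneg (k : ℕ) : 0 ≤ harm k :=
  Finset.sum_nonneg fun i _ => by positivity

theorem harm_mono {k l : ℕ} (h : k ≤ l) : harm k ≤ harm l :=
  Finset.sum_le_sum_of_subset_of_nonneg (Finset.range_mono h) fun i _ _ => by positivity

theorem add_nat_eq (a : ℂ) (i : ℕ) : a + i = ((i : ℂ) + 1) * (1 + (a - 1) / ((i : ℂ) + 1)) := by
  have : (i : ℂ) + 1 ≠ 0 := Nat.cast_add_one_ne_zero i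
  field_simp
  ring

theorem shift_re (a : ℂ) (i : ℕ) :
    ((a - 1) / ((i : ℂ) + 1)).re = (a.re - 1) * (1 / ((i : ℝ) + 1)) := by
  rw [show ((i : ℂ) + 1) = (((i : ℝ) + 1 : ℝ) : ℂ) by push_cast; rfl, Complex.div_ofReal_re]
  simp [div_eq_mul_inv]

theorem norm_nat_add_one (i : ℕ) : ‖(i : ℂ) + 1‖ = (i : ℝ) + 1 := by
  have := Complex.norm_natCast (i + 1)
  push_cast at this
  exact this

theorem shift_norm_le {a : ℂ} {M : ℝ} (ha : ‖a‖ ≤ M) (i : ℕ) :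
    ‖(a - 1) / ((i : ℂ) + 1)‖ ≤ (M + 1) * (1 / ((i : ℝ) + 1)) := by
  rw [norm_div, norm_nat_add_one, div_eq_mul_one_div]
  have : ‖a - 1‖ ≤ M + 1 := (norm_sub_le _ _).trans (by simpa using ha)
  gcongr

theorem abs_re_sub_one_le {a : ℂ} {M : ℝ} (ha : ‖a‖ ≤ M) : |a.re - 1| ≤ M + 1 := by
  have := Complex.abs_re_le_norm a
  rw [abs_le] at this ⊢
  constructor <;> linarith

theorem exists_norm_poch_le (M : ℝ) : ∃ C : ℝ, 0 < C ∧ ∀ a : ℂ, ‖a‖ ≤ M → ∀ k : ℕ,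
    ‖poch a k‖ ≤ C * k.factorial * ((k : ℝ) + 1) ^ (a.re - 1) := by
  refine ⟨Real.exp ((M + 1) ^ 2) * Real.exp (M + 1), by positivity, fun a ha k => ?_⟩
  have h : ∀ k : ℕ, ‖poch a k‖ ≤ k.factorial * Real.exp ((a.re - 1) * harm k +
      (M + 1) ^ 2 / 2 * ∑ i ∈ Finset.range k, 1 / ((i : ℝ) + 1) ^ 2) := by
    intro k
    induction k with
    | zero => simp [harm]
    | succ k ih =>
      rw [poch_succ, norm_mul, Nat.factorial_succ, harm_succ, Finset.sum_range_succ]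
      have h1 : ‖a + k‖ ≤ ((k : ℝ) + 1) * Real.exp ((a.re - 1) * (1 / ((k : ℝ) + 1)) +
          (M + 1) ^ 2 / 2 * (1 / ((k : ℝ) + 1) ^ 2)) := by
        rw [add_nat_eq, norm_mul, norm_nat_add_one]
        refine mul_le_mul_of_nonneg_left ((norm_one_add_le _).trans ?_) (by positivity)
        rw [shift_re]
        refine Real.exp_le_exp.mpr (add_le_add le_rfl ?_)
        have := pow_le_pow_left₀ (norm_nonneg _) (shift_norm_le ha k) 2
        rw [mul_pow, div_pow, one_pow] at this
        linarith
      refine (mul_le_mul ih h1 (norm_nonneg _) (by positivity)).trans (le_of_eq ?_)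
      rw [mul_mul_mul_comm, ← Real.exp_add]
      push_cast
      rw [mul_comm ((k.factorial : ℝ))]
      congr 2
      ring
  refine (h k).trans ?_
  rw [Real.exp_add]
  have h1 := exp_mul_harm_le (abs_re_sub_one_le ha) k
  have h2 : Real.exp ((M + 1) ^ 2 / 2 * ∑ i ∈ Finset.range k, 1 / ((i : ℝ) + 1) ^ 2) ≤
      Real.exp ((M + 1) ^ 2) := by
    refine Real.exp_le_exp.mpr ?_
    have := mul_le_mul_of_nonneg_left (sum_inv_sq_le k) (by positivity : 0 ≤ (M + 1) ^ 2 / 2)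
    linarith
  calc _ ≤ (k.factorial : ℝ) * ((Real.exp (M + 1) * ((k : ℝ) + 1) ^ (a.re - 1)) *
        Real.exp ((M + 1) ^ 2)) := by gcongr
    _ = _ := by ring

theorem exists_norm_rG_le (M : ℝ) : ∃ C : ℝ, 0 < C ∧ ∀ a : ℂ, ‖a‖ ≤ M → ∀ k : ℕ,
    ‖rG (a + k)‖ ≤ C / k.factorial * ((k : ℝ) + 1) ^ (1 - a.re) := by
  by_cases hM : 0 ≤ M
  swap
  · exact ⟨1, one_pos, fun a ha => absurd ((norm_nonneg a).trans ha) hM⟩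
  obtain ⟨K, hK⟩ := exists_nat_ge (2 * (M + 1))
  obtain ⟨C1, hC1⟩ := (isCompact_closedBall (0 : ℂ) (M + K)).exists_bound_of_continuousOn
    differentiable_rG.continuous.continuousOn
  set C0 := (|C1| + 1) * (K.factorial * Real.exp ((M + 1) * harm K)) with hC0
  have hC0' : 0 < C0 := by positivity
  refine ⟨C0 * Real.exp (10 * (M + 1) ^ 2) * Real.exp (M + 1), by positivity, fun a ha k => ?_⟩
  have habs := abs_re_sub_one_le ha
  have h : ∀ k : ℕ, ‖rG (a + k)‖ ≤ C0 / k.factorial * Real.exp ((1 - a.re) * harm k +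
      5 * (M + 1) ^ 2 * ∑ i ∈ Finset.range k, 1 / ((i : ℝ) + 1) ^ 2) := by
    have base : ∀ k ≤ K, ‖rG (a + k)‖ ≤ C0 / k.factorial * Real.exp ((1 - a.re) * harm k +
        5 * (M + 1) ^ 2 * ∑ i ∈ Finset.range k, 1 / ((i : ℝ) + 1) ^ 2) := by
      intro k hk
      have h1 : ‖rG (a + k)‖ ≤ |C1| + 1 := by
        refine (hC1 _ ?_).trans ((le_abs_self _).trans (by linarith))
        rw [mem_closedBall_zero_iff]
        refine (norm_add_le _ _).trans (add_le_add ha ?_)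
        rw [Complex.norm_natCast]
        exact_mod_cast hk
      refine h1.trans ?_
      have h2 : (k.factorial : ℝ) ≤ K.factorial := by exact_mod_cast Nat.factorial_le hk
      have h3 : 1 ≤ Real.exp ((M + 1) * harm K) * Real.exp ((1 - a.re) * harm k +
          5 * (M + 1) ^ 2 * ∑ i ∈ Finset.range k, 1 / ((i : ℝ) + 1) ^ 2) := by
        rw [← Real.exp_add, Real.one_le_exp_iff]
        have h5 : 0 ≤ ∑ i ∈ Finset.range k, 1 / ((i : ℝ) + 1) ^ 2 :=
          Finset.sum_nonneg fun i _ => by positivity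
        have h6 : 0 ≤ 5 * (M + 1) ^ 2 * ∑ i ∈ Finset.range k, 1 / ((i : ℝ) + 1) ^ 2 := by
          positivity
        have h7 := harm_mono hk
        have h8 := harm_nonneg k
        have h9 : (M + 1) * harm k ≤ (M + 1) * harm K := by gcongr
        rw [abs_le] at habs
        nlinarith
      rw [hC0, div_mul_eq_mul_div, le_div_iff₀ (by positivity)]
      calc (|C1| + 1) * (k.factorial : ℝ) ≤ (|C1| + 1) * (K.factorial * 1) := by
            rw [mul_one]; gcongr
        _ ≤ (|C1| + 1) * (K.factorial * (Real.exp ((M + 1) * harm K) * Real.exp ((1 - a.re) * harm k +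
          5 * (M + 1) ^ 2 * ∑ i ∈ Finset.range k, 1 / ((i : ℝ) + 1) ^ 2))) := by gcongr
        _ = _ := by ring
    intro k
    induction k with
    | zero => exact base 0 (Nat.zero_le _)
    | succ k ih =>
      rcases le_or_gt (k + 1) K with hk | hk
      · exact base _ hk
      have hkK : (K : ℝ) ≤ k := by exact_mod_cast Nat.lt_succ_iff.mp hk
      have hu : ‖(a - 1) / ((k : ℂ) + 1)‖ ≤ 1 / 2 := by
        refine (shift_norm_le ha k).trans ?_
        rw [mul_one_div, div_le_div_iff₀ (by positivity) two_pos]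
        linarith
      have hne : a + k ≠ 0 := by
        intro h0
        have : ‖a‖ = k := by rw [eq_neg_of_add_eq_zero_left h0, norm_neg, Complex.norm_natCast]
        linarith
      have h1 : ‖(a + k)⁻¹‖ ≤ ((k : ℝ) + 1)⁻¹ * Real.exp ((1 - a.re) * (1 / ((k : ℝ) + 1)) +
          5 * (M + 1) ^ 2 * (1 / ((k : ℝ) + 1) ^ 2)) := by
        rw [add_nat_eq, mul_inv, norm_mul, norm_inv, norm_nat_add_one]
        refine mul_le_mul_of_nonneg_left ((norm_inv_one_add_le hu).trans ?_) (by positivity)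
        rw [shift_re]
        refine Real.exp_le_exp.mpr (add_le_add (le_of_eq (by ring)) ?_)
        have := pow_le_pow_left₀ (norm_nonneg _) (shift_norm_le ha k) 2
        rw [mul_pow, div_pow, one_pow] at this
        linarith
      have h2 : rG (a + (k + 1 : ℕ)) = rG (a + k) * (a + k)⁻¹ := by
        rw [rG_eq_mul (a + k)]
        field_simp
        push_cast
        ring_nf
      rw [h2, norm_mul, Nat.factorial_succ, harm_succ, Finset.sum_range_succ]
      refine (mul_le_mul ih h1 (norm_nonneg _) (by positivity)).trans (le_of_eq ?_)
      rw [mul_mul_mul_comm, ← Real.exp_add]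
      push_cast
      congr 1
      · field_simp
      · congr 1; ring
  refine (h k).trans ?_
  rw [Real.exp_add]
  have h1 := exp_mul_harm_le (M := M + 1) (t := 1 - a.re) (by rwa [abs_sub_comm]) k
  have h2 : Real.exp (5 * (M + 1) ^ 2 * ∑ i ∈ Finset.range k, 1 / ((i : ℝ) + 1) ^ 2) ≤
      Real.exp (10 * (M + 1) ^ 2) := by
    refine Real.exp_le_exp.mpr ?_
    have := mul_le_mul_of_nonneg_left (sum_inv_sq_le k) (by positivity : 0 ≤ 5 * (M + 1) ^ 2)
    linarith
  calc _ ≤ C0 / k.factorial * ((Real.exp (M + 1) * ((k : ℝ) + 1) ^ (1 - a.re)) *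
        Real.exp (10 * (M + 1) ^ 2)) := by gcongr
    _ = _ := by ring

/-! ### Series of holomorphic functions on a normed space -/

theorem differentiableOn_tsum_of_locally_le {E ι : Type*} [NormedAddCommGroup E] [NormedSpace ℂ E]
    {f : ι → E → ℂ} {s : Set E} (hs : IsOpen s) (hf : ∀ i, DifferentiableOn ℂ (f i) s)
    (hb : ∀ x ∈ s, ∃ t ∈ 𝓝 x, ∃ u : ι → ℝ, Summable u ∧ ∀ i, ∀ y ∈ t, ‖f i y‖ ≤ u i) :
    DifferentiableOn ℂ (fun x => ∑' i, f i x) s := by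
  intro x hx
  obtain ⟨t, ht, u, hu, hub⟩ := hb x hx
  obtain ⟨r, hr, hrt⟩ := Metric.mem_nhds_iff.mp (inter_mem ht (hs.mem_nhds hx))
  have hr2 : 0 < r / 2 := by positivity
  have hball : ∀ y ∈ Metric.ball x (r / 2), Metric.ball y (r / 2) ⊆ Metric.ball x r := by
    intro y hy
    refine Metric.ball_subset_ball' ?_
    have := Metric.mem_ball.mp hy
    linarith
  have hsub : Metric.ball x (r / 2) ⊆ Metric.ball x r := Metric.ball_subset_ball (by linarith)
  have hx2 : x ∈ Metric.ball x (r / 2) := Metric.mem_ball_self hr2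
  have key := hasFDerivAt_tsum_of_isPreconnected (𝕜 := ℂ) (u := fun i => 2 * u i / (r / 2))
    (f := f) (f' := fun i y => fderiv ℂ (f i) y) (s := Metric.ball x (r / 2)) (x₀ := x) (x := x)
    ((hu.mul_left 2).div_const _) Metric.isOpen_ball
    (convex_ball x (r / 2)).isPreconnected ?_ ?_ hx2 ?_ hx2
  · exact key.differentiableAt.differentiableWithinAt
  · intro i y hy
    have : y ∈ s := (hrt (hsub hy)).2
    exact ((hf i y this).differentiableAt (hs.mem_nhds this)).hasFDerivAt
  · intro i y hy
    refine Complex.norm_fderiv_le_div_of_mapsTo_ball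
      ((hf i).mono fun z hz => (hrt (hball y hy hz)).2) ?_ hr2
    intro z hz
    rw [Metric.mem_closedBall, dist_eq_norm]
    refine (norm_sub_le _ _).trans ?_
    have h1 := hub i z (hrt (hball y hy hz)).1
    have h2 := hub i y (hrt (hsub hy)).1
    linarith
  · exact Summable.of_norm_bounded hu fun i => hub i x (hrt (hsub hx2)).1

theorem summable_nat_add_one_rpow {p : ℝ} (hp : p < -1) :
    Summable fun k : ℕ => ((k : ℝ) + 1) ^ p := by
  have := (summable_nat_add_iff 1).mpr (Real.summable_nat_rpow.mpr hp)
  simpa using this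

theorem differentiable_poch (k : ℕ) : Differentiable ℂ fun a => poch a k :=
  (ascPochhammer ℂ k).differentiable

@[fun_prop]
theorem _root_.Differentiable.zwPoch {E : Type*} [NormedAddCommGroup E] [NormedSpace ℂ E]
    {g : E → ℂ} (hg : Differentiable ℂ g) (k : ℕ) : Differentiable ℂ fun x => poch (g x) k :=
  (differentiable_poch k).comp hg

@[fun_prop]
theorem _root_.Differentiable.zwRG {E : Type*} [NormedAddCommGroup E] [NormedSpace ℂ E]
    {g : E → ℂ} (hg : Differentiable ℂ g) : Differentiable ℂ fun x => rG (g x) :=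
  differentiable_rG.comp hg

/-! ### The regularized series of type (3,2) -/

/-- The summand `(a)_k (b)_k (c)_k / (k! Γ(e + k) Γ(f + k))`. -/
noncomputable def regTerm (a b c e f : ℂ) (k : ℕ) : ℂ :=
  poch a k * poch b k * poch c k / (k.factorial : ℂ) * (rG (e + k) * rG (f + k))

theorem exists_norm_regTerm_le (M : ℝ) : ∃ C : ℝ, 0 < C ∧ ∀ a b c e f : ℂ, ‖a‖ ≤ M → ‖b‖ ≤ M →
    ‖c‖ ≤ M → ‖e‖ ≤ M → ‖f‖ ≤ M → ∀ k : ℕ,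
    ‖regTerm a b c e f k‖ ≤ C * ((k : ℝ) + 1) ^ (-1 - (e + f - a - b - c).re) := by
  obtain ⟨C1, h1, H1⟩ := exists_norm_poch_le M
  obtain ⟨C2, h2, H2⟩ := exists_norm_rG_le M
  refine ⟨C1 * C1 * C1 * (C2 * C2), by positivity, fun a b c e f ha hb hc he hf k => ?_⟩
  have hk : (0 : ℝ) < k + 1 := by positivity
  have hfac : (0 : ℝ) < k.factorial := by exact_mod_cast k.factorial_pos
  rw [regTerm, norm_mul, norm_div, norm_mul, norm_mul, norm_mul, Complex.norm_natCast]
  have e1 : (-1 - (e + f - a - b - c).re) = (a.re - 1) + (b.re - 1) + (c.re - 1) +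
      ((1 - e.re) + (1 - f.re)) := by simp; ring
  rw [e1, Real.rpow_add hk, Real.rpow_add hk, Real.rpow_add hk, Real.rpow_add hk]
  calc _ ≤ (C1 * k.factorial * ((k : ℝ) + 1) ^ (a.re - 1)) *
        (C1 * k.factorial * ((k : ℝ) + 1) ^ (b.re - 1)) *
        (C1 * k.factorial * ((k : ℝ) + 1) ^ (c.re - 1)) / k.factorial *
        ((C2 / k.factorial * ((k : ℝ) + 1) ^ (1 - e.re)) *
          (C2 / k.factorial * ((k : ℝ) + 1) ^ (1 - f.re))) := by
        gcongr
        · exact H1 a ha k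
        · exact H1 b hb k
        · exact H1 c hc k
        · exact H2 e he k
        · exact H2 f hf k
    _ = _ := by field_simp

/-- The regularized series `∑ k, (a)_k (b)_k (c)_k / (k! Γ(e + k) Γ(f + k))`. -/
noncomputable def regSeries (a b c e f : ℂ) : ℂ := ∑' k, regTerm a b c e f k

theorem exists_bound_norms (a b c e f : ℂ) :
    ∃ M : ℝ, ‖a‖ ≤ M ∧ ‖b‖ ≤ M ∧ ‖c‖ ≤ M ∧ ‖e‖ ≤ M ∧ ‖f‖ ≤ M :=
  ⟨‖a‖ + ‖b‖ + ‖c‖ + ‖e‖ + ‖f‖, by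
    have := norm_nonneg a
    have := norm_nonneg b
    have := norm_nonneg c
    have := norm_nonneg e
    have := norm_nonneg f
    refine ⟨?_, ?_, ?_, ?_, ?_⟩ <;> linarith⟩

theorem summable_regTerm {a b c e f : ℂ} (hs : 0 < (e + f - a - b - c).re) :
    Summable (regTerm a b c e f) := by
  obtain ⟨M, ha, hb, hc, he, hf⟩ := exists_bound_norms a b c e f
  obtain ⟨C, -, h⟩ := exists_norm_regTerm_le M
  exact Summable.of_norm_bounded ((summable_nat_add_one_rpow (by linarith)).mul_left C)
    (h a b c e f ha hb hc he hf)

theorem tendsto_nat_mul_regTerm {a b c e f : ℂ} (hs : 0 < (e + f - a - b - c).re) :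
    Tendsto (fun k : ℕ => (k : ℂ) * regTerm a b c e f k) atTop (𝓝 0) := by
  obtain ⟨M, ha, hb, hc, he, hf⟩ := exists_bound_norms a b c e f
  obtain ⟨C, -, h⟩ := exists_norm_regTerm_le M
  have h1 : Tendsto (fun k : ℕ => C * ((k : ℝ) + 1) ^ (-(e + f - a - b - c).re)) atTop (𝓝 0) := by
    have := ((tendsto_rpow_neg_atTop hs).comp
      (tendsto_natCast_atTop_atTop.atTop_add (tendsto_const_nhds (x := (1 : ℝ))))).const_mul C
    simpa using this
  refine squeeze_zero_norm (fun k => ?_) h1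
  rw [norm_mul, Complex.norm_natCast]
  have hk : (0 : ℝ) < k + 1 := by positivity
  calc (k : ℝ) * ‖regTerm a b c e f k‖ ≤ ((k : ℝ) + 1) *
        (C * ((k : ℝ) + 1) ^ (-1 - (e + f - a - b - c).re)) := by
        gcongr
        · linarith
        · exact h a b c e f ha hb hc he hf k
    _ = _ := by
      rw [show -(e + f - a - b - c).re = 1 + (-1 - (e + f - a - b - c).re) by ring,
        Real.rpow_add hk, Real.rpow_one]
      ring

/-- The first coefficient of the contiguous relation. -/
noncomputable def contigA (a b c e f : ℂ) : ℂ :=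
  a * b + b * c + c * a - e * f + (e + f - a - b - c) * (e + f)

/-- The second coefficient of the contiguous relation. -/
noncomputable def contigB (a b c e f : ℂ) : ℂ :=
  a * b * c + (e + f - a - b - c) * e * f - contigA a b c e f * e

theorem regSeries_contiguous {a b c e f : ℂ} (hs : 0 < (e + f - a - b - c).re) :
    (e + f - a - b - c) * regSeries a b c e f =
      contigA a b c e f * regSeries a b c e (f + 1) +
        contigB a b c e f * regSeries a b c (e + 1) (f + 1) := by
  have s0 := summable_regTerm hs
  have s1 : Summable (regTerm a b c e (f + 1)) := summable_regTerm (by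
    simp at hs ⊢; linarith)
  have s2 : Summable (regTerm a b c (e + 1) (f + 1)) := summable_regTerm (by
    simp at hs ⊢; linarith)
  set u : ℕ → ℂ := fun k => (k : ℂ) * regTerm a b c e f k with hu
  have hstep : ∀ k, u (k + 1) - u k = -((e + f - a - b - c) * regTerm a b c e f k) +
      (contigA a b c e f * regTerm a b c e (f + 1) k +
        contigB a b c e f * regTerm a b c (e + 1) (f + 1) k) := by
    intro k
    have hk : (k : ℂ) + 1 ≠ 0 := Nat.cast_add_one_ne_zero k
    have hfac : (k.factorial : ℂ) ≠ 0 := by exact_mod_cast k.factorial_ne_zero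
    simp only [hu, regTerm, poch_succ, Nat.factorial_succ, contigA, contigB]
    push_cast
    rw [rG_eq_mul (e + k), rG_eq_mul (f + k), show e + k + 1 = e + ((k : ℂ) + 1) by ring,
      show f + k + 1 = f + ((k : ℂ) + 1) by ring, show e + 1 + k = e + ((k : ℂ) + 1) by ring,
      show f + 1 + k = f + ((k : ℂ) + 1) by ring]
    field_simp
    ring
  have hsum : HasSum (fun k => u (k + 1) - u k) (-((e + f - a - b - c) * regSeries a b c e f) +
      (contigA a b c e f * regSeries a b c e (f + 1) +
        contigB a b c e f * regSeries a b c (e + 1) (f + 1))) := by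
    simp only [hstep]
    exact (s0.hasSum.mul_left _).neg.add ((s1.hasSum.mul_left _).add (s2.hasSum.mul_left _))
  have hlim := hsum.tendsto_sum_nat
  simp only [Finset.sum_range_sub] at hlim
  have h0 : Tendsto (fun n => u n - u 0) atTop (𝓝 0) := by
    have := (tendsto_nat_mul_regTerm hs).sub_const (u 0)
    simpa [hu] using this
  have := tendsto_nhds_unique hlim h0
  linear_combination -this

/-! ### The entire continuation -/

/-- The excess of the sum of the lower parameters. -/
noncomputable def excess (p : ℂ × ℂ × ℂ × ℂ × ℂ) : ℂ := p.2.2.2.1 + p.2.2.2.2 - p.1 - p.2.1 - p.2.2.1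

/-- One step of the continuation to the left in the excess. -/
noncomputable def contStep (G : ℂ × ℂ × ℂ × ℂ × ℂ → ℂ) (p : ℂ × ℂ × ℂ × ℂ × ℂ) : ℂ :=
  contigA p.1 p.2.1 p.2.2.1 p.2.2.2.1 p.2.2.2.2 *
      G (p.1, p.2.1, p.2.2.1, p.2.2.2.1, p.2.2.2.2 + 1) +
    contigB p.1 p.2.1 p.2.2.1 p.2.2.2.1 p.2.2.2.2 * (excess p + 1) *
      G (p.1, p.2.1, p.2.2.1, p.2.2.2.1 + 1, p.2.2.2.2 + 1)

/-- The regularized series divided by the gamma function of the excess. -/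
noncomputable def contBase (p : ℂ × ℂ × ℂ × ℂ × ℂ) : ℂ :=
  regSeries p.1 p.2.1 p.2.2.1 p.2.2.2.1 p.2.2.2.2 * rG (excess p)

/-- The continuation to `Re (excess) > -n`. -/
noncomputable def contSeq (n : ℕ) : ℂ × ℂ × ℂ × ℂ × ℂ → ℂ := contStep^[n] contBase

theorem contSeq_succ (n : ℕ) : contSeq (n + 1) = contStep (contSeq n) :=
  Function.iterate_succ_apply' _ _ _

theorem differentiable_excess : Differentiable ℂ excess := by
  unfold excess; fun_prop

theorem isOpen_excess (r : ℝ) : IsOpen {p | r < (excess p).re} :=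
  isOpen_lt continuous_const (Complex.continuous_re.comp differentiable_excess.continuous)

theorem differentiableOn_contBase : DifferentiableOn ℂ contBase {p | 0 < (excess p).re} := by
  refine DifferentiableOn.mul ?_ (differentiable_rG.comp differentiable_excess).differentiableOn
  refine differentiableOn_tsum_of_locally_le (isOpen_excess 0) (fun k => ?_) ?_
  · refine Differentiable.differentiableOn ?_
    unfold regTerm
    fun_prop
  · intro p hp
    obtain ⟨C, hC, h⟩ := exists_norm_regTerm_le (‖p‖ + 1)
    refine ⟨Metric.ball p 1 ∩ {q | (excess p).re / 2 < (excess q).re},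
      inter_mem (Metric.ball_mem_nhds p one_pos) ((isOpen_excess _).mem_nhds ?_),
      fun k => C * ((k : ℝ) + 1) ^ (-1 - (excess p).re / 2), ?_, ?_⟩
    · simp only [Set.mem_ofPred_eq] at hp ⊢; linarith
    · exact (summable_nat_add_one_rpow (by simp only [Set.mem_ofPred_eq] at hp; linarith)).mul_left C
    · rintro k q ⟨hq, hq2⟩
      have hn : ‖q‖ ≤ ‖p‖ + 1 := by
        have h1 := norm_le_norm_add_norm_sub p q
        rw [mem_ball_iff_norm, norm_sub_rev] at hq
        linarith
      have n1 := (norm_fst_le q).trans hn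
      have m1 := (norm_snd_le q).trans hn
      have n2 := (norm_fst_le q.2).trans m1
      have m2 := (norm_snd_le q.2).trans m1
      have n3 := (norm_fst_le q.2.2).trans m2
      have m3 := (norm_snd_le q.2.2).trans m2
      have n4 := (norm_fst_le q.2.2.2).trans m3
      have m4 := (norm_snd_le q.2.2.2).trans m3
      refine (h _ _ _ _ _ n1 n2 n3 n4 m4 k).trans ?_
      have hq2' : (excess p).re / 2 < (excess q).re := hq2
      refine mul_le_mul_of_nonneg_left (Real.rpow_le_rpow_of_exponent_le ?_ ?_) hC.le
      · linarith [(Nat.cast_nonneg k : (0 : ℝ) ≤ k)]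
      · exact sub_le_sub_left hq2'.le _

theorem contStep_contBase {p : ℂ × ℂ × ℂ × ℂ × ℂ} (hp : 0 < (excess p).re) :
    contStep contBase p = contBase p := by
  obtain ⟨a, b, c, e, f⟩ := p
  simp only [excess] at hp
  simp only [contStep, contBase, excess]
  rw [rG_eq_mul (e + f - a - b - c), show e + (f + 1) - a - b - c = e + f - a - b - c + 1 by ring,
    rG_eq_mul (e + f - a - b - c + 1),
    show e + 1 + (f + 1) - a - b - c = e + f - a - b - c + 1 + 1 by ring]
  linear_combination (-((e + f - a - b - c + 1) * rG (e + f - a - b - c + 1 + 1))) *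
    regSeries_contiguous hp

theorem excess_shift_one (a b c e f : ℂ) : excess (a, b, c, e, f + 1) = excess (a, b, c, e, f) + 1 := by
  simp only [excess]; ring

theorem excess_shift_two (a b c e f : ℂ) :
    excess (a, b, c, e + 1, f + 1) = excess (a, b, c, e, f) + 2 := by
  simp only [excess]; ring

theorem contSeq_succ_eq (n : ℕ) {p : ℂ × ℂ × ℂ × ℂ × ℂ} (hp : -(n : ℝ) < (excess p).re) :
    contSeq (n + 1) p = contSeq n p := by
  induction n generalizing p with
  | zero =>
    rw [contSeq_succ]
    exact contStep_contBase (by simpa using hp)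
  | succ n ih =>
    obtain ⟨a, b, c, e, f⟩ := p
    rw [contSeq_succ (n + 1), congrFun (contSeq_succ n)]
    simp only [contStep]
    push_cast at hp
    rw [ih (by rw [excess_shift_one]; simp only [Complex.add_re, Complex.one_re]; linarith),
      ih (by rw [excess_shift_two]; simp only [Complex.add_re, Complex.re_ofNat]; linarith)]

theorem contSeq_eq_of_le {m n : ℕ} (h : m ≤ n) {p : ℂ × ℂ × ℂ × ℂ × ℂ}
    (hp : -(m : ℝ) < (excess p).re) : contSeq n p = contSeq m p := by
  induction n, h using Nat.le_induction with
  | base => rfl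
  | succ n hn ih =>
    rw [contSeq_succ_eq n, ih]
    have : (m : ℝ) ≤ n := by exact_mod_cast hn
    linarith

theorem differentiableOn_contSeq (n : ℕ) :
    DifferentiableOn ℂ (contSeq n) {p | -(n : ℝ) < (excess p).re} := by
  induction n with
  | zero => simpa [contSeq] using differentiableOn_contBase
  | succ n ih =>
    rw [contSeq_succ]
    have h1 : DifferentiableOn ℂ (fun p : ℂ × ℂ × ℂ × ℂ × ℂ => contSeq n
        (p.1, p.2.1, p.2.2.1, p.2.2.2.1, p.2.2.2.2 + 1))
        {p | -((n + 1 : ℕ) : ℝ) < (excess p).re} := by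
      refine ih.comp (Differentiable.differentiableOn (by fun_prop)) ?_
      rintro ⟨a, b, c, e, f⟩ hp
      simp only [Set.mem_ofPred_eq, excess_shift_one, Complex.add_re, Complex.one_re] at hp ⊢
      push_cast at hp
      linarith
    have h2 : DifferentiableOn ℂ (fun p : ℂ × ℂ × ℂ × ℂ × ℂ => contSeq n
        (p.1, p.2.1, p.2.2.1, p.2.2.2.1 + 1, p.2.2.2.2 + 1))
        {p | -((n + 1 : ℕ) : ℝ) < (excess p).re} := by
      refine ih.comp (Differentiable.differentiableOn (by fun_prop)) ?_
      rintro ⟨a, b, c, e, f⟩ hp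
      simp only [Set.mem_ofPred_eq, excess_shift_two, Complex.add_re, Complex.re_ofNat] at hp ⊢
      push_cast at hp
      linarith
    refine DifferentiableOn.add (DifferentiableOn.mul ?_ h1) (DifferentiableOn.mul ?_ h2) <;>
    refine Differentiable.differentiableOn ?_
    · unfold contigA
      fun_prop
    · unfold contigB contigA excess
      fun_prop

/-- The glued continuation. -/
noncomputable def contLim (p : ℂ × ℂ × ℂ × ℂ × ℂ) : ℂ := contSeq (⌊-(excess p).re⌋₊ + 1) p

theorem contLim_eq (n : ℕ) {p : ℂ × ℂ × ℂ × ℂ × ℂ} (hp : -(n : ℝ) < (excess p).re) :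
    contLim p = contSeq n p := by
  rw [contLim]
  have h1 : -((⌊-(excess p).re⌋₊ + 1 : ℕ) : ℝ) < (excess p).re := by
    have := Nat.lt_floor_add_one (-(excess p).re)
    push_cast
    linarith
  rcases le_total n (⌊-(excess p).re⌋₊ + 1) with h | h
  · exact contSeq_eq_of_le h hp
  · exact (contSeq_eq_of_le h h1).symm

theorem differentiable_contLim : Differentiable ℂ contLim := by
  intro p
  obtain ⟨n, hn⟩ := exists_nat_gt (-(excess p).re)
  have hmem : {q | -(n : ℝ) < (excess q).re} ∈ 𝓝 p :=
    (isOpen_excess _).mem_nhds (by simp only [Set.mem_ofPred_eq]; linarith)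
  refine ((differentiableOn_contSeq n).differentiableAt hmem).congr_of_eventuallyEq ?_
  filter_upwards [hmem] with q hq using contLim_eq n hq

theorem regTerm_eq {e f : ℂ} (he : ∀ k : ℕ, e ≠ -(k : ℂ)) (hf : ∀ k : ℕ, f ≠ -(k : ℂ))
    (a b c : ℂ) (k : ℕ) : regTerm a b c e f k =
      poch a k * poch b k * poch c k / ((k.factorial : ℂ) * poch e k * poch f k) *
        (rG e * rG f) := by
  have h1 := poch_ne_zero he k
  have h2 := poch_ne_zero hf k
  have hfac : (k.factorial : ℂ) ≠ 0 := by exact_mod_cast k.factorial_ne_zero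
  rw [regTerm, rG_eq_poch_mul e k, rG_eq_poch_mul f k]
  field_simp

theorem isReg3F2_contLim : IsReg3F2 contLim := by
  refine ⟨differentiable_contLim, fun a b c e f he hf hs => ?_⟩
  rw [contLim_eq 0 (by simpa [excess] using hs)]
  simp only [contSeq, Function.iterate_zero, id, contBase, regSeries, regTerm_eq he hf, excess]
  rw [tsum_mul_right, series3F2, div_eq_mul_inv, mul_inv, mul_inv, rG, rG, rG]
  ring

theorem isReg3F2_reg3F2 : IsReg3F2 reg3F2 := Classical.epsilon_spec ⟨_, isReg3F2_contLim⟩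

theorem differentiable_reg3F2 : Differentiable ℂ reg3F2 := isReg3F2_reg3F2.1

theorem reg3F2_eq {a b c e f : ℂ} (he : ∀ k : ℕ, e ≠ -(k : ℂ)) (hf : ∀ k : ℕ, f ≠ -(k : ℂ))
    (hs : 0 < (e + f - a - b - c).re) :
    reg3F2 (a, b, c, e, f) = regSeries a b c e f * rG (e + f - a - b - c) := by
  rw [isReg3F2_reg3F2.2 a b c e f he hf hs, regSeries]
  simp only [regTerm_eq he hf]
  rw [tsum_mul_right, series3F2, div_eq_mul_inv, mul_inv, mul_inv, rG, rG, rG]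
  ring

/-! ### Gauss's summation formula -/

theorem rG_one : rG 1 = 1 := by simp [rG]

/-- The summand `(a)_k (b)_k / (k! Γ(c + k))`. -/
noncomputable def gaussTerm (a b c : ℂ) (k : ℕ) : ℂ :=
  poch a k * poch b k / (k.factorial : ℂ) * rG (c + k)

theorem gaussTerm_eq_regTerm (a b c : ℂ) : gaussTerm a b c = regTerm a b 1 c 1 := by
  funext k
  rw [gaussTerm, regTerm]
  have := rG_eq_poch_mul 1 k
  rw [rG_one] at this
  linear_combination (poch a k * poch b k / (k.factorial : ℂ) * rG (c + k)) * this

theorem summable_gaussTerm {a b c : ℂ} (h : 0 < (c - a - b).re) : Summable (gaussTerm a b c) := by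
  rw [gaussTerm_eq_regTerm]
  exact summable_regTerm (by simp at h ⊢; linarith)

theorem tsum_gaussTerm_contiguous {a b c : ℂ} (h : 0 < (c - a - b).re) :
    (c - a - b) * ∑' k, gaussTerm a b c k = (c - a) * (c - b) * ∑' k, gaussTerm a b (c + 1) k := by
  have s0 := summable_gaussTerm h
  have s1 : Summable (gaussTerm a b (c + 1)) := summable_gaussTerm (by simp at h ⊢; linarith)
  set u : ℕ → ℂ := fun k => (k : ℂ) * gaussTerm a b c k with hu
  have hstep : ∀ k, u (k + 1) - u k = -((c - a - b) * gaussTerm a b c k) +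
      (c - a) * (c - b) * gaussTerm a b (c + 1) k := by
    intro k
    have hk : (k : ℂ) + 1 ≠ 0 := Nat.cast_add_one_ne_zero k
    have hfac : (k.factorial : ℂ) ≠ 0 := by exact_mod_cast k.factorial_ne_zero
    simp only [hu, gaussTerm, poch_succ, Nat.factorial_succ]
    push_cast
    rw [rG_eq_mul (c + k), show c + k + 1 = c + ((k : ℂ) + 1) by ring,
      show c + 1 + k = c + ((k : ℂ) + 1) by ring]
    field_simp
    ring
  have hlim : HasSum (fun k => u (k + 1) - u k) (-((c - a - b) * ∑' k, gaussTerm a b c k) +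
      (c - a) * (c - b) * ∑' k, gaussTerm a b (c + 1) k) := by
    simp only [hstep]
    exact (s0.hasSum.mul_left _).neg.add (s1.hasSum.mul_left _)
  have hlim := hlim.tendsto_sum_nat
  simp only [Finset.sum_range_sub] at hlim
  have h0 : Tendsto (fun n => u n - u 0) atTop (𝓝 0) := by
    have := (tendsto_nat_mul_regTerm (a := a) (b := b) (c := 1) (e := c) (f := 1)
      (by simp at h ⊢; linarith)).sub_const (u 0)
    simpa [hu, gaussTerm_eq_regTerm] using this
  linear_combination -(tendsto_nhds_unique hlim h0)

theorem tendsto_rG_shift {u : ℂ} (hu : ∀ k : ℕ, u ≠ -(k : ℂ)) :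
    Tendsto (fun n : ℕ => (n : ℂ) ^ u * (n.factorial : ℂ) * rG (u + (n + 1 : ℕ))) atTop (𝓝 1) := by
  have h := (Complex.GammaSeq_tendsto_Gamma u).mul_const (rG u)
  rw [Gamma_mul_rG hu] at h
  refine h.congr fun n => ?_
  have h1 : ∏ j ∈ Finset.range (n + 1), (u + (j : ℂ)) = poch u (n + 1) := by
    generalize n + 1 = m
    induction m with
    | zero => simp
    | succ m ih => rw [Finset.prod_range_succ, ih, poch_succ]
  rw [Complex.GammaSeq, h1, rG_eq_poch_mul u (n + 1)]
  have := poch_ne_zero hu (n + 1)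
  field_simp

theorem norm_poch_re_le {c : ℂ} (hc : 0 < c.re) (m k : ℕ) :
    ‖poch (c.re : ℂ) k‖ ≤ ‖poch (c + m) k‖ := by
  induction k with
  | zero => simp
  | succ k ih =>
    rw [poch_succ, poch_succ, norm_mul, norm_mul]
    refine mul_le_mul ih ?_ (norm_nonneg _) (norm_nonneg _)
    have h1 : ‖(c.re : ℂ) + k‖ = c.re + k := by
      rw [← Complex.ofReal_natCast, ← Complex.ofReal_add, Complex.norm_real, Real.norm_eq_abs,
        abs_of_nonneg (by positivity)]
    rw [h1]
    refine le_trans ?_ (Complex.re_le_norm _)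
    simp

theorem tendsto_inv_poch_shift {c : ℂ} (hc : 0 < c.re) (k : ℕ) :
    Tendsto (fun m : ℕ => (poch (c + m) k)⁻¹) atTop (𝓝 (if k = 0 then 1 else 0)) := by
  cases k with
  | zero => simp
  | succ k =>
    simp only [Nat.add_eq_zero_iff, one_ne_zero, and_false, if_false]
    have hpos : 0 < ‖poch (c.re : ℂ) k‖ :=
      norm_pos_iff.mpr (poch_ne_zero (ne_neg_nat_of_re_pos (by simpa using hc)) k)
    have h1 : Tendsto (fun m : ℕ => ((m : ℝ) * ‖poch (c.re : ℂ) k‖)⁻¹) atTop (𝓝 0) :=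
      (tendsto_natCast_atTop_atTop.atTop_mul_const hpos).inv_tendsto_atTop
    refine squeeze_zero_norm' ?_ h1
    filter_upwards [eventually_gt_atTop 0] with m hm
    have hm' : (0 : ℝ) < m := by exact_mod_cast hm
    rw [poch_succ_left, norm_inv, norm_mul]
    refine inv_anti₀ (by positivity) ?_
    refine mul_le_mul ?_ ?_ (norm_nonneg _) (norm_nonneg _)
    · refine le_trans ?_ (Complex.re_le_norm _)
      simp [hc.le]
    · have := norm_poch_re_le hc (m + 1) k
      push_cast at this
      rwa [← add_assoc] at this

theorem tendsto_Gamma_mul_gauss {a b c : ℂ} (hc : 0 < c.re) (h : 0 < (c - a - b).re) :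
    Tendsto (fun m : ℕ => Complex.Gamma (c + m) * ∑' k, gaussTerm a b (c + m) k) atTop (𝓝 1) := by
  have hcm : ∀ m k : ℕ, c + m ≠ -(k : ℂ) := fun m => ne_neg_nat_of_re_pos (by
    simp only [Complex.add_re, Complex.natCast_re]; positivity)
  have hre : ∀ k : ℕ, (c.re : ℂ) ≠ -(k : ℂ) := ne_neg_nat_of_re_pos (by simpa using hc)
  have key : ∀ {x : ℂ}, (∀ k : ℕ, x ≠ -(k : ℂ)) → ∀ k, Complex.Gamma x * gaussTerm a b x k =
      poch a k * poch b k / (k.factorial : ℂ) * (poch x k)⁻¹ := by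
    intro x hx k
    have h1 := Gamma_mul_rG hx
    rw [rG_eq_poch_mul x k] at h1
    have h2 := poch_ne_zero hx k
    rw [gaussTerm]
    have hfac : (k.factorial : ℂ) ≠ 0 := by exact_mod_cast k.factorial_ne_zero
    field_simp
    linear_combination (poch a k * poch b k) * h1
  have e1 : (1 : ℂ) = ∑' k : ℕ, poch a k * poch b k / (k.factorial : ℂ) * (if k = 0 then 1 else 0) := by
    rw [tsum_eq_single 0]
    · simp
    · intro k hk; simp [hk]
  rw [e1]
  simp_rw [← tsum_mul_left, key (hcm _)]
  refine tendsto_tsum_of_dominated_convergence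
    (bound := fun k => ‖Complex.Gamma (c.re : ℂ) * gaussTerm a b (c.re : ℂ) k‖) ?_ ?_ ?_
  · exact ((summable_gaussTerm (by simpa using h)).mul_left _).norm
  · intro k
    exact (tendsto_inv_poch_shift hc k).const_mul _
  · refine Eventually.of_forall fun m k => ?_
    rw [key hre, norm_mul, norm_mul, norm_inv, norm_inv]
    refine mul_le_mul_of_nonneg_left (inv_anti₀ ?_ (norm_poch_re_le hc m k)) (norm_nonneg _)
    exact norm_pos_iff.mpr (poch_ne_zero hre k)

/-- Gauss's formula, with all parameters in the right half plane. -/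
theorem tsum_gaussTerm_of_re_pos {a b c : ℂ} (hc : 0 < c.re) (ha : 0 < (c - a).re)
    (hb : 0 < (c - b).re) (h : 0 < (c - a - b).re) :
    ∑' k, gaussTerm a b c k = Complex.Gamma (c - a - b) * (rG (c - a) * rG (c - b)) := by
  set Q : ℂ → ℂ := fun x => rG (x - a - b) * (Complex.Gamma (x - a) * Complex.Gamma (x - b)) with hQ
  have hstep : ∀ m : ℕ, (∑' k, gaussTerm a b (c + m) k) * Q (c + m) =
      (∑' k, gaussTerm a b c k) * Q c := by
    intro m
    induction m with
    | zero => simp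
    | succ m ih =>
      rw [← ih]
      have h1 : 0 < (c + m - a - b).re := by
        simp at h ⊢; linarith [(Nat.cast_nonneg m : (0 : ℝ) ≤ m)]
      have h2 : 0 < (c + m - a).re := by
        simp at ha ⊢; linarith [(Nat.cast_nonneg m : (0 : ℝ) ≤ m)]
      have h3 : 0 < (c + m - b).re := by
        simp at hb ⊢; linarith [(Nat.cast_nonneg m : (0 : ℝ) ≤ m)]
      have n2 : c + m - a ≠ 0 := by intro h0; rw [h0] at h2; simp at h2
      have n3 : c + m - b ≠ 0 := by intro h0; rw [h0] at h3; simp at h3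
      have hcont := tsum_gaussTerm_contiguous h1
      simp only [hQ]
      push_cast
      rw [rG_eq_mul (c + m - a - b), show c + ((m : ℂ) + 1) - a - b = c + m - a - b + 1 by ring,
        show c + ((m : ℂ) + 1) - a = c + m - a + 1 by ring,
        show c + ((m : ℂ) + 1) - b = c + m - b + 1 by ring, Complex.Gamma_add_one _ n2,
        Complex.Gamma_add_one _ n3, ← add_assoc]
      linear_combination -(rG (c + m - a - b + 1) * (Complex.Gamma (c + m - a) *
        Complex.Gamma (c + m - b))) * hcont
  have hpos := @ne_neg_nat_of_re_pos
  have hQlim : Tendsto (fun n : ℕ => rG (c + (n + 1 : ℕ)) * Q (c + (n + 1 : ℕ))) atTop (𝓝 1) := by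
    have l1 := tendsto_rG_shift (hpos hc)
    have l2 := tendsto_rG_shift (hpos h)
    have l3 := tendsto_rG_shift (hpos ha)
    have l4 := tendsto_rG_shift (hpos hb)
    have l := (l1.mul l2).div (l3.mul l4) (by simp)
    simp only [mul_one, div_one] at l
    refine l.congr' ?_
    filter_upwards [eventually_gt_atTop 0] with n hn
    have hn' : (n : ℂ) ≠ 0 := by exact_mod_cast hn.ne'
    have hfac : (n.factorial : ℂ) ≠ 0 := by exact_mod_cast n.factorial_ne_zero
    have hp : (n : ℂ) ^ c * (n : ℂ) ^ (c - a - b) = (n : ℂ) ^ (c - a) * (n : ℂ) ^ (c - b) := by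
      rw [← Complex.cpow_add _ _ hn', ← Complex.cpow_add _ _ hn']
      congr 1; ring
    have n1 : (n : ℂ) ^ (c - a) ≠ 0 := by simp [Complex.cpow_eq_zero_iff, hn']
    have n2 : (n : ℂ) ^ (c - b) ≠ 0 := by simp [Complex.cpow_eq_zero_iff, hn']
    have g1 : Complex.Gamma (c - a + (n + 1 : ℕ)) ≠ 0 := Complex.Gamma_ne_zero (hpos (by
      simp only [Complex.add_re, Complex.natCast_re]; positivity))
    have g2 : Complex.Gamma (c - b + (n + 1 : ℕ)) ≠ 0 := Complex.Gamma_ne_zero (hpos (by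
      simp only [Complex.add_re, Complex.natCast_re]; positivity))
    simp only [hQ, Pi.div_apply]
    rw [show c + (n + 1 : ℕ) - a - b = c - a - b + (n + 1 : ℕ) by ring,
      show c + (n + 1 : ℕ) - a = c - a + (n + 1 : ℕ) by ring,
      show c + (n + 1 : ℕ) - b = c - b + (n + 1 : ℕ) by ring]
    rw [show (n : ℂ) ^ c * n.factorial * rG (c + (n + 1 : ℕ)) *
      ((n : ℂ) ^ (c - a - b) * n.factorial * rG (c - a - b + (n + 1 : ℕ))) =
      ((n : ℂ) ^ c * (n : ℂ) ^ (c - a - b)) * (n.factorial * rG (c + (n + 1 : ℕ)) *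
      (n.factorial * rG (c - a - b + (n + 1 : ℕ)))) by ring, hp,
      show rG (c - a + (n + 1 : ℕ)) = (Complex.Gamma (c - a + (n + 1 : ℕ)))⁻¹ from rfl,
      show rG (c - b + (n + 1 : ℕ)) = (Complex.Gamma (c - b + (n + 1 : ℕ)))⁻¹ from rfl]
    field_simp
  have hG := (tendsto_Gamma_mul_gauss hc h).comp (tendsto_add_atTop_nat 1)
  have hfin := hG.mul hQlim
  rw [mul_one] at hfin
  have hconst : (fun n : ℕ => (∑' k, gaussTerm a b c k) * Q c) =ᶠ[atTop]
      fun n : ℕ => ((fun m : ℕ => Complex.Gamma (c + m) * ∑' k, gaussTerm a b (c + m) k) ∘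
        fun n => n + 1) n * (rG (c + (n + 1 : ℕ)) * Q (c + (n + 1 : ℕ))) := by
    refine Eventually.of_forall fun n => ?_
    have hg := Gamma_mul_rG (hpos (show 0 < (c + (n + 1 : ℕ)).re by
      simp only [Complex.add_re, Complex.natCast_re]; positivity))
    simp only [Function.comp]
    rw [← hstep (n + 1)]
    linear_combination (-(∑' k, gaussTerm a b (c + (n + 1 : ℕ)) k) * Q (c + (n + 1 : ℕ))) * hg
  have hval := tendsto_nhds_unique (tendsto_const_nhds.congr' hconst) hfin
  have r1 := Gamma_mul_rG (hpos h)
  have r2 := Gamma_mul_rG (hpos ha)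
  have r3 := Gamma_mul_rG (hpos hb)
  simp only [hQ] at hval
  calc ∑' k, gaussTerm a b c k = (∑' k, gaussTerm a b c k) *
        (Complex.Gamma (c - a - b) * rG (c - a - b)) * (Complex.Gamma (c - a) * rG (c - a)) *
        (Complex.Gamma (c - b) * rG (c - b)) := by rw [r1, r2, r3]; ring
    _ = ((∑' k, gaussTerm a b c k) * (rG (c - a - b) * (Complex.Gamma (c - a) *
        Complex.Gamma (c - b)))) * (Complex.Gamma (c - a - b) * (rG (c - a) * rG (c - b))) := by ring
    _ = _ := by rw [hval, one_mul]

/-- Gauss's summation formula. -/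
theorem tsum_gaussTerm {a b c : ℂ} (h : 0 < (c - a - b).re) :
    ∑' k, gaussTerm a b c k = Complex.Gamma (c - a - b) * (rG (c - a) * rG (c - b)) := by
  obtain ⟨m, hm⟩ := exists_nat_gt (‖c‖ + ‖c - a‖ + ‖c - b‖)
  have hm1 : 0 < (c + m).re ∧ 0 < (c + m - a).re ∧ 0 < (c + m - b).re := by
    have h1 := (abs_le.mp (Complex.abs_re_le_norm c)).1
    have h2 := (abs_le.mp (Complex.abs_re_le_norm (c - a))).1
    have h3 := (abs_le.mp (Complex.abs_re_le_norm (c - b))).1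
    have := norm_nonneg c
    have := norm_nonneg (c - a)
    have := norm_nonneg (c - b)
    simp only [Complex.sub_re, Complex.add_re, Complex.natCast_re] at *
    refine ⟨?_, ?_, ?_⟩ <;> linarith
  clear hm
  induction m generalizing c with
  | zero =>
    simp only [Nat.cast_zero, add_zero] at hm1
    exact tsum_gaussTerm_of_re_pos hm1.1 hm1.2.1 hm1.2.2 h
  | succ m ih =>
    have hne : c - a - b ≠ 0 := by intro h0; rw [h0] at h; simp at h
    have h1 := ih (c := c + 1) (by simp at h ⊢; linarith) (by
      push_cast at hm1
      rwa [show c + 1 + (m : ℂ) = c + (m + 1) by ring])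
    have h2 := tsum_gaussTerm_contiguous h
    rw [h1, show c + 1 - a - b = c - a - b + 1 by ring, Complex.Gamma_add_one _ hne,
      show c + 1 - a = c - a + 1 by ring, show c + 1 - b = c - b + 1 by ring] at h2
    rw [rG_eq_mul (c - a), rG_eq_mul (c - b)]
    refine mul_left_cancel₀ hne ?_
    rw [h2]; ring

/-! ### Thomae's transformation -/

open Finset in
theorem thomae_antidiagonal (a b c d e : ℂ) (m : ℕ) :
    ∑ p ∈ antidiagonal m, poch a (p.1 + p.2) * rG (e + (p.1 + p.2 : ℕ)) *
      (poch (d - b) p.1 * poch (d - c) p.1 / (p.1.factorial : ℂ) * rG (d + p.1)) *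
      (poch (b + c - d) p.2 / (p.2.factorial : ℂ)) = regTerm a b c d e m := by
  have hm : (m.factorial : ℂ) ≠ 0 := by exact_mod_cast m.factorial_ne_zero
  rw [regTerm, mul_assoc (poch a m), poch_mul_poch_eq_sum b c d, mul_sum, sum_div, sum_mul]
  refine sum_congr rfl ?_
  rintro ⟨k, l⟩ hp
  rw [HasAntidiagonal.mem_antidiagonal] at hp
  simp only at hp ⊢
  subst hp
  have hk : (k.factorial : ℂ) ≠ 0 := by exact_mod_cast k.factorial_ne_zero
  have hl : (l.factorial : ℂ) ≠ 0 := by exact_mod_cast l.factorial_ne_zero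
  have hch : ((k + l).factorial : ℂ) = ((k + l).choose k : ℂ) * k.factorial * l.factorial := by
    have := Nat.add_choose_mul_factorial_mul_factorial k l
    rw [← Nat.choose_symm_add] at this
    exact_mod_cast this.symm
  rw [rG_eq_poch_mul (d + k) l, show d + (k : ℂ) + l = d + (k + l : ℕ) by push_cast; ring]
  rw [hch] at hm ⊢
  have hc0 : ((k + l).choose k : ℂ) ≠ 0 := by
    intro h0; rw [h0] at hm; simp at hm
  field_simp

theorem thomae_regSeries {a b c d e : ℂ} (hR : |(d - b - c).re| < (e - a).re / 2) :
    regSeries a b c d e =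
      Complex.Gamma (d + e - a - b - c) * rG (e - a) *
        regSeries a (d - b) (d - c) d (d + e - b - c) := by
  set q := b + c - d with hq
  set F : ℕ × ℕ → ℂ := fun p => poch a (p.1 + p.2) * rG (e + (p.1 + p.2 : ℕ)) *
      (poch (d - b) p.1 * poch (d - c) p.1 / (p.1.factorial : ℂ) * rG (d + p.1)) *
      (poch q p.2 / (p.2.factorial : ℂ)) with hF
  have hR' := abs_lt.mp hR
  have hF_sum : Summable F := by
    set M := ‖a‖ + ‖e‖ + ‖d - b‖ + ‖d - c‖ + ‖d‖ + ‖q‖ with hM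
    obtain ⟨C1, h1, H1⟩ := exists_norm_poch_le M
    obtain ⟨C2, h2, H2⟩ := exists_norm_rG_le M
    set δ := (d - b - c).re with hδ
    set R := (e - a).re with hRdef
    have hb := norm_nonneg a
    have hb := norm_nonneg e
    have hb := norm_nonneg (d - b)
    have hb := norm_nonneg (d - c)
    have hb := norm_nonneg d
    have hb := norm_nonneg q
    have s1 : Summable fun k : ℕ => C1 * C2 * (C1 * C1 * C2) * ((k : ℝ) + 1) ^ (δ - 1 - R / 2) :=
      (summable_nat_add_one_rpow (by linarith)).mul_left _
    have s2 : Summable fun k : ℕ => C1 * ((k : ℝ) + 1) ^ (-δ - 1 - R / 2) :=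
      (summable_nat_add_one_rpow (by linarith)).mul_left _
    refine Summable.of_norm_bounded (s1.mul_of_nonneg s2 (fun k => by positivity)
      fun k => by positivity) ?_
    rintro ⟨k, l⟩
    have hk : (0 : ℝ) < k + 1 := by positivity
    have hl : (0 : ℝ) < l + 1 := by positivity
    have hkf : (0 : ℝ) < k.factorial := by exact_mod_cast k.factorial_pos
    have hlf : (0 : ℝ) < l.factorial := by exact_mod_cast l.factorial_pos
    have hklf : (0 : ℝ) < (k + l).factorial := by exact_mod_cast (k + l).factorial_pos
    have hkl : (0 : ℝ) < ((k + l : ℕ) : ℝ) + 1 := by positivity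
    have b1 : ‖poch a (k + l) * rG (e + (k + l : ℕ))‖ ≤
        C1 * C2 * (((k : ℝ) + 1) ^ (-(R / 2)) * ((l : ℝ) + 1) ^ (-(R / 2))) := by
      rw [norm_mul]
      calc _ ≤ (C1 * (k + l).factorial * (((k + l : ℕ) : ℝ) + 1) ^ (a.re - 1)) *
            (C2 / (k + l).factorial * (((k + l : ℕ) : ℝ) + 1) ^ (1 - e.re)) := by
            gcongr
            · exact H1 a (by linarith) _
            · exact H2 e (by linarith) _
        _ = C1 * C2 * (((k + l : ℕ) : ℝ) + 1) ^ (-R) := by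
            rw [show -R = (a.re - 1) + (1 - e.re) by rw [hRdef]; simp, Real.rpow_add hkl]
            field_simp
        _ ≤ _ := by
            refine mul_le_mul_of_nonneg_left ?_ (by positivity)
            rw [← Real.mul_rpow hk.le hl.le, show -R = (2 : ℕ) * -(R / 2) by push_cast; ring,
              Real.rpow_natCast_mul hkl.le]
            refine Real.rpow_le_rpow_of_nonpos (by positivity) ?_ (by linarith)
            push_cast
            nlinarith [mul_nonneg (Nat.cast_nonneg k : (0 : ℝ) ≤ k) (Nat.cast_nonneg l : (0 : ℝ) ≤ l),
              (Nat.cast_nonneg k : (0 : ℝ) ≤ k), (Nat.cast_nonneg l : (0 : ℝ) ≤ l)]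
    have b2 : ‖poch (d - b) k * poch (d - c) k / (k.factorial : ℂ) * rG (d + k)‖ ≤
        C1 * C1 * C2 * ((k : ℝ) + 1) ^ (δ - 1) := by
      rw [norm_mul, norm_div, norm_mul, Complex.norm_natCast]
      calc _ ≤ (C1 * k.factorial * ((k : ℝ) + 1) ^ ((d - b).re - 1)) *
            (C1 * k.factorial * ((k : ℝ) + 1) ^ ((d - c).re - 1)) / k.factorial *
            (C2 / k.factorial * ((k : ℝ) + 1) ^ (1 - d.re)) := by
            gcongr
            · exact H1 _ (by linarith) _
            · exact H1 _ (by linarith) _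
            · exact H2 d (by linarith) _
        _ = _ := by
            rw [show δ - 1 = ((d - b).re - 1) + ((d - c).re - 1) + (1 - d.re) by
              rw [hδ]; simp; ring, Real.rpow_add hk, Real.rpow_add hk]
            field_simp
    have b3 : ‖poch q l / (l.factorial : ℂ)‖ ≤ C1 * ((l : ℝ) + 1) ^ (-δ - 1) := by
      rw [norm_div, Complex.norm_natCast, div_le_iff₀ hlf]
      refine (H1 q (by linarith) l).trans (le_of_eq ?_)
      rw [show q.re - 1 = -δ - 1 by rw [hq, hδ]; simp; ring]
      ring
    simp only [hF]
    rw [norm_mul, norm_mul]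
    refine (mul_le_mul (mul_le_mul b1 b2 (norm_nonneg _) (by positivity)) b3 (norm_nonneg _)
      (by positivity)).trans (le_of_eq ?_)
    rw [show δ - 1 - R / 2 = -(R / 2) + (δ - 1) by ring, show -δ - 1 - R / 2 = -(R / 2) + (-δ - 1) by
      ring, Real.rpow_add hk, Real.rpow_add hl]
    ring
  have e1 : ∑' p, F p = regSeries a b c d e := by
    have hs := (Finset.HasAntidiagonal.sigmaAntidiagonalEquivProd (A := ℕ)).summable_iff.mpr hF_sum
    rw [← (Finset.HasAntidiagonal.sigmaAntidiagonalEquivProd (A := ℕ)).tsum_eq F, regSeries]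
    refine (hs.tsum_sigma' ?_).trans ?_
    · intro m
      exact (hasSum_fintype _).summable
    · refine tsum_congr fun m => ?_
      rw [← thomae_antidiagonal, tsum_fintype]
      exact Finset.sum_coe_sort (Finset.HasAntidiagonal.antidiagonal m) F
  have e2 : ∑' p, F p = Complex.Gamma (d + e - a - b - c) * rG (e - a) *
        regSeries a (d - b) (d - c) d (d + e - b - c) := by
    rw [hF_sum.tsum_prod, regSeries, ← tsum_mul_left]
    refine tsum_congr fun k => ?_
    have hg := tsum_gaussTerm (a := a + k) (b := q) (c := e + k) (by
      rw [hq]; simp at hR' ⊢; linarith)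
    have : ∀ l, F (k, l) = (poch a k * (poch (d - b) k * poch (d - c) k / (k.factorial : ℂ) *
        rG (d + k))) * gaussTerm (a + k) q (e + k) l := by
      intro l
      simp only [hF, gaussTerm, poch_add a k l]
      push_cast
      rw [add_assoc e]
      ring
    simp_rw [this]
    rw [tsum_mul_left, hg, regTerm, hq, show e + (k : ℂ) - (a + k) = e - a by ring,
      show e - a - (b + c - d) = d + e - a - b - c by ring,
      show e + (k : ℂ) - (b + c - d) = d + e - b - c + k by ring]
    ring
  rw [← e1, e2]

/-- Entire functions that agree on a half plane are equal. -/
theorem entire_eq_of_eq_halfPlane {f g : ℂ → ℂ} (hf : Differentiable ℂ f) (hg : Differentiable ℂ g)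
    (T : ℝ) (h : ∀ t : ℂ, T < t.re → f t = g t) : f = g := by
  refine AnalyticOnNhd.eq_of_eventuallyEq (𝕜 := ℂ) (z₀ := ((T + 1 : ℝ) : ℂ))
    (Complex.analyticOnNhd_univ_iff_differentiable.mpr hf)
    (Complex.analyticOnNhd_univ_iff_differentiable.mpr hg) ?_
  filter_upwards [(isOpen_lt continuous_const Complex.continuous_re).mem_nhds
    (show T < ((T + 1 : ℝ) : ℂ).re by simp)] with t ht using h t ht

/-- Thomae's transformation is a symmetry of the regularized value. -/
theorem reg3F2_thomae (a b c e : ℂ) {d : ℂ} (hd : ∀ k : ℕ, d ≠ -(k : ℂ)) :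
    reg3F2 (a, b, c, d, e) = reg3F2 (a, d - b, d - c, d, d + e - b - c) := by
  have h := entire_eq_of_eq_halfPlane (f := fun t => reg3F2 (a, b, c, d, e + t))
    (g := fun t => reg3F2 (a, d - b, d - c, d, d + (e + t) - b - c))
    (differentiable_reg3F2.comp (by fun_prop)) (differentiable_reg3F2.comp (by fun_prop))
    (‖e‖ + ‖a‖ + ‖d + e - b - c‖ + ‖d + e - a - b - c‖ + 2 * ‖d - b - c‖) ?_
  · simpa using congrFun h 0
  intro t ht
  have n1 := norm_nonneg e
  have n2 := norm_nonneg a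
  have n3 := norm_nonneg (d + e - b - c)
  have n4 := norm_nonneg (d + e - a - b - c)
  have n5 := norm_nonneg (d - b - c)
  have h1 := (abs_le.mp (Complex.abs_re_le_norm e)).1
  have h2 := (abs_le.mp (Complex.abs_re_le_norm a)).2
  have h3 := (abs_le.mp (Complex.abs_re_le_norm (d + e - b - c))).1
  have h4 := (abs_le.mp (Complex.abs_re_le_norm (d + e - a - b - c))).1
  have h5 := Complex.abs_re_le_norm (d - b - c)
  simp only [Complex.sub_re, Complex.add_re] at h1 h2 h3 h4
  have c1 : 0 < (e + t).re := by simp only [Complex.add_re]; linarith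
  have c2 : 0 < (d + (e + t) - b - c).re := by simp only [Complex.sub_re, Complex.add_re]; linarith
  have c3 : 0 < (d + (e + t) - a - b - c).re := by
    simp only [Complex.sub_re, Complex.add_re]; linarith
  have c4 : 0 < (e + t - a).re := by simp only [Complex.sub_re, Complex.add_re]; linarith
  have c5 : |(d - b - c).re| < (e + t - a).re / 2 := by
    refine h5.trans_lt ?_
    simp only [Complex.sub_re, Complex.add_re]
    linarith
  have hs : d + (d + (e + t) - b - c) - a - (d - b) - (d - c) = e + t - a := by ring
  rw [reg3F2_eq hd (ne_neg_nat_of_re_pos c1) c3, reg3F2_eq hd (ne_neg_nat_of_re_pos c2)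
    (by rw [hs]; exact c4), hs, thomae_regSeries c5]
  linear_combination (rG (e + t - a) * regSeries a (d - b) (d - c) d (d + (e + t) - b - c)) *
    Gamma_mul_rG (ne_neg_nat_of_re_pos c3)

/-! ### Sums over the integers -/

/-- `x` is not an integer. -/
def NonInt (x : ℂ) : Prop := ∀ k : ℤ, x ≠ k

theorem NonInt.ne_neg_nat {x : ℂ} (h : NonInt x) (k : ℕ) : x ≠ -(k : ℂ) := by
  simpa using h (-k)

theorem NonInt.add_int {x : ℂ} (h : NonInt x) (n : ℤ) : NonInt (x + n) := fun k hk =>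
  h (k - n) (by push_cast; linear_combination hk)

theorem NonInt.neg {x : ℂ} (h : NonInt x) : NonInt (-x) := fun k hk =>
  h (-k) (by push_cast; linear_combination -hk)

theorem exists_mul_abs_le_norm_int_sub (x : ℂ) :
    ∃ c : ℝ, 0 < c ∧ ∀ j : ℤ, (j : ℂ) ≠ x → c * (|(j : ℝ)| + 1) ≤ ‖(j : ℂ) - x‖ := by
  obtain ⟨n, hn⟩ := exists_nat_ge (2 * ‖x‖ + 1)
  classical
  have hfin : ∀ s : Finset ℤ, ∃ c : ℝ, 0 < c ∧ ∀ j ∈ s, (j : ℂ) ≠ x →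
      c * (|(j : ℝ)| + 1) ≤ ‖(j : ℂ) - x‖ := by
    intro s
    induction s using Finset.induction_on with
    | empty => exact ⟨1, one_pos, by simp⟩
    | insert i s _ ih =>
      obtain ⟨c, hc, h⟩ := ih
      by_cases hi : (i : ℂ) = x
      · refine ⟨c, hc, fun j hj hjx => ?_⟩
        rcases Finset.mem_insert.mp hj with rfl | hj
        · exact absurd hi hjx
        · exact h j hj hjx
      · have hpos : 0 < ‖(i : ℂ) - x‖ := norm_pos_iff.mpr (sub_ne_zero.mpr hi)
        refine ⟨min c (‖(i : ℂ) - x‖ / (|(i : ℝ)| + 1)), lt_min hc (by positivity),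
          fun j hj hjx => ?_⟩
        have habs : (0 : ℝ) < |(j : ℝ)| + 1 := by positivity
        rcases Finset.mem_insert.mp hj with rfl | hj
        · refine (mul_le_mul_of_nonneg_right (min_le_right _ _) habs.le).trans (le_of_eq ?_)
          field_simp
        · exact (mul_le_mul_of_nonneg_right (min_le_left _ _) habs.le).trans (h j hj hjx)
  obtain ⟨c, hc, h⟩ := hfin (Finset.Icc (-n) n)
  refine ⟨min c (1 / 2), lt_min hc (by norm_num), fun j hjx => ?_⟩
  have habs : (0 : ℝ) < |(j : ℝ)| + 1 := by positivity
  by_cases hj : j ∈ Finset.Icc (-(n : ℤ)) n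
  · exact (mul_le_mul_of_nonneg_right (min_le_left _ _) habs.le).trans (h j hj hjx)
  · refine (mul_le_mul_of_nonneg_right (min_le_right _ _) habs.le).trans ?_
    have h1 : (n : ℝ) ≤ |(j : ℝ)| := by
      rw [Finset.mem_Icc, ← abs_le, not_le] at hj
      exact_mod_cast hj.le
    have h2 := norm_sub_norm_le (j : ℂ) x
    rw [Complex.norm_intCast] at h2
    linarith

theorem summable_int_abs_add_one_rpow {p : ℝ} (hp : p < -1) :
    Summable fun j : ℤ => (|(j : ℝ)| + 1) ^ p := by
  refine Summable.of_nat_of_neg ?_ ?_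
  · simpa using summable_nat_add_one_rpow hp
  · simpa using summable_nat_add_one_rpow hp

theorem summable_inv_norm_int_sub_sq {x : ℂ} (hx : NonInt x) :
    Summable fun j : ℤ => (‖(j : ℂ) - x‖⁻¹) ^ 2 := by
  obtain ⟨c, hc, h⟩ := exists_mul_abs_le_norm_int_sub x
  refine Summable.of_nonneg_of_le (fun j => by positivity) (fun j => ?_)
    ((summable_int_abs_add_one_rpow (p := -2) (by norm_num)).mul_left ((c⁻¹) ^ 2))
  have habs : (0 : ℝ) < |(j : ℝ)| + 1 := by positivity
  rw [Real.rpow_neg habs.le, Real.rpow_ofNat, ← inv_pow, ← mul_pow, ← mul_inv]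
  exact pow_le_pow_left₀ (by positivity) (inv_anti₀ (by positivity) (h j (hx j).symm)) 2

theorem inv_mul_inv_le_sq (a b : ℝ) : a * b ≤ a ^ 2 + b ^ 2 := by
  nlinarith [sq_nonneg (a - b), sq_nonneg a, sq_nonneg b]

theorem summable_inv_mul_inv_int_sub {x p : ℂ} (hx : NonInt x) (hp : NonInt p) :
    Summable fun j : ℤ => (((j : ℂ) - p)⁻¹ * ((j : ℂ) - x)⁻¹) := by
  refine Summable.of_norm_bounded
    ((summable_inv_norm_int_sub_sq hp).add (summable_inv_norm_int_sub_sq hx)) fun j => ?_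
  rw [norm_mul, norm_inv, norm_inv]
  exact inv_mul_inv_le_sq _ _

/-- `π cot (π x)`. -/
noncomputable def picot (x : ℂ) : ℂ := Real.pi * Complex.cot (Real.pi * x)

theorem pi_ne_zero' : (Real.pi : ℂ) ≠ 0 := by exact_mod_cast Real.pi_ne_zero

theorem sin_pi_ne_zero {x : ℂ} (hx : NonInt x) : Complex.sin (Real.pi * x) ≠ 0 := by
  rw [Ne, Complex.sin_eq_zero_iff]
  rintro ⟨k, hk⟩
  exact hx k (mul_left_cancel₀ pi_ne_zero' (by rw [hk]; ring))

theorem sin_pi_int (j : ℤ) : Complex.sin (Real.pi * j) = 0 := by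
  rw [mul_comm]; exact Complex.sin_int_mul_pi j

theorem cos_pi_int_sq (j : ℤ) : Complex.cos (Real.pi * j) ^ 2 = 1 := by
  have := Complex.sin_sq_add_cos_sq (Real.pi * j)
  rw [sin_pi_int] at this
  simpa using this

theorem sin_pi_sub_int (x : ℂ) (j : ℤ) : Complex.sin (Real.pi * (x - j)) =
    Complex.cos (Real.pi * j) * Complex.sin (Real.pi * x) := by
  rw [mul_sub, Complex.sin_sub, sin_pi_int]; ring

theorem cos_pi_sub_int (x : ℂ) (j : ℤ) : Complex.cos (Real.pi * (x - j)) =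
    Complex.cos (Real.pi * j) * Complex.cos (Real.pi * x) := by
  rw [mul_sub, Complex.cos_sub, sin_pi_int]; ring

theorem picot_sub_int (x : ℂ) (j : ℤ) : picot (x - j) = picot x := by
  have h : Complex.cos (Real.pi * j) ≠ 0 := by
    intro h0
    have := cos_pi_int_sq j
    rw [h0] at this
    simp at this
  rw [picot, picot, Complex.cot_eq_cos_div_sin, Complex.cot_eq_cos_div_sin, sin_pi_sub_int,
    cos_pi_sub_int, mul_div_mul_left _ _ h]

theorem picot_sub_picot {x y : ℂ} (hx : NonInt x) (hy : NonInt y) : picot y - picot x =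
    Real.pi * Complex.sin (Real.pi * (x - y)) /
      (Complex.sin (Real.pi * x) * Complex.sin (Real.pi * y)) := by
  have h1 := sin_pi_ne_zero hx
  have h2 := sin_pi_ne_zero hy
  rw [picot, picot, Complex.cot_eq_cos_div_sin, Complex.cot_eq_cos_div_sin, mul_sub, Complex.sin_sub]
  field_simp

theorem tsum_inv_mul_inv_int_sub {x p : ℂ} (hx : NonInt x) (hp : NonInt p) (hxp : x ≠ p) :
    ∑' j : ℤ, ((j : ℂ) - p)⁻¹ * ((j : ℂ) - x)⁻¹ = (picot p - picot x) / (x - p) := by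
  have hs := (summable_inv_mul_inv_int_sub hx hp).mul_left (p - x)
  have hval : ∀ j : ℤ, (p - x) * (((j : ℂ) - p)⁻¹ * ((j : ℂ) - x)⁻¹) = 1 / (x - j) - 1 / (p - j) := by
    intro j
    have h1 := sub_ne_zero.mpr (hx j)
    have h2 := sub_ne_zero.mpr (hp j)
    have h3 := sub_ne_zero.mpr (hx j).symm
    have h4 := sub_ne_zero.mpr (hp j).symm
    field_simp
    ring
  obtain ⟨g, hg⟩ : ∃ g : ℤ → ℂ, ∀ j, g j = 1 / (x - j) - 1 / (p - j) := ⟨_, fun _ => rfl⟩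
  simp only [hval, ← hg] at hs
  have hpos : Summable fun n : ℕ => g n := hs.comp_injective Nat.cast_injective
  have hneg : Summable fun n : ℕ => g (-((n : ℤ) + 1)) :=
    hs.comp_injective (i := fun n : ℕ => -((n : ℤ) + 1)) (fun a b h => by simpa using h)
  have hpos1 : Summable fun n : ℕ => g ((n + 1 : ℕ) : ℤ) :=
    (summable_nat_add_iff (f := fun n : ℕ => g n) 1).mpr hpos
  have hx' : x ∈ Complex.integerComplement := by
    rw [Complex.mem_integerComplement_iff]; rintro ⟨n, hn⟩; exact hx n hn.symm
  have hp' : p ∈ Complex.integerComplement := by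
    rw [Complex.mem_integerComplement_iff]; rintro ⟨n, hn⟩; exact hp n hn.symm
  have t1 : Summable fun n : ℕ => 1 / (x - ((n : ℂ) + 1)) + 1 / (x + ((n : ℂ) + 1)) := by
    simpa [cotTerm] using summable_cotTerm hx'
  have t2 : Summable fun n : ℕ => 1 / (p - ((n : ℂ) + 1)) + 1 / (p + ((n : ℂ) + 1)) := by
    simpa [cotTerm] using summable_cotTerm hp'
  have key : ∑' j : ℤ, g j = picot x - picot p := by
    have c3 := t1.tsum_sub t2
    rw [← cot_series_rep' hx', ← cot_series_rep' hp'] at c3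
    have c4 : ∑' n : ℕ, (g ((n + 1 : ℕ) : ℤ) + g (-((n : ℤ) + 1))) =
        ∑' n : ℕ, (1 / (x - ((n : ℂ) + 1)) + 1 / (x + ((n : ℂ) + 1)) -
          (1 / (p - ((n : ℂ) + 1)) + 1 / (p + ((n : ℂ) + 1)))) := by
      refine tsum_congr fun n => ?_
      rw [hg, hg]
      push_cast
      rw [show x - -((n : ℂ) + 1) = x + (n + 1) by ring, show p - -((n : ℂ) + 1) = p + (n + 1) by ring]
      ring
    rw [tsum_of_nat_of_neg_add_one hpos hneg, hpos.tsum_eq_zero_add, add_assoc,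
      ← hpos1.tsum_add hneg, c4, c3, hg, picot, picot]
    simp
    ring
  have hxp' := sub_ne_zero.mpr hxp
  rw [eq_div_iff hxp']
  simp only [hg, ← hval] at key
  rw [tsum_mul_left] at key
  linear_combination -key

/-! ### Sums of simple fractions -/

theorem summable_mul_inv_of_le {f p : ℕ → ℂ} (hf : Summable f) {s : ℂ} {δ : ℝ} (hδ : 0 < δ)
    (hp : ∀ m, δ ≤ ‖s - p m‖) : Summable fun m => f m * (s - p m)⁻¹ := by
  refine Summable.of_norm_bounded (hf.norm.mul_right δ⁻¹) fun m => ?_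
  rw [norm_mul, norm_inv]
  exact mul_le_mul_of_nonneg_left (inv_anti₀ hδ (hp m)) (norm_nonneg _)

/-- The product of two sums of simple fractions with separated poles. -/
theorem tsum_mul_inv_mul_tsum_mul_inv {f g p q : ℕ → ℂ} (hf : Summable f) (hg : Summable g)
    {s : ℂ} {δ : ℝ} (hδ : 0 < δ) (hp : ∀ m, δ ≤ ‖s - p m‖) (hq : ∀ k, δ ≤ ‖s - q k‖)
    (hpq : ∀ m k, δ ≤ ‖p m - q k‖) :
    (∑' m, f m * (s - p m)⁻¹) * (∑' k, g k * (s - q k)⁻¹) =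
      ∑' m, f m * (∑' k, g k * (p m - q k)⁻¹) * (s - p m)⁻¹ +
        ∑' k, g k * (∑' m, f m * (q k - p m)⁻¹) * (s - q k)⁻¹ := by
  have sf := summable_mul_inv_of_le hf hδ hp
  have sg := summable_mul_inv_of_le hg hδ hq
  have hprod : Summable fun z : ℕ × ℕ => ‖f z.1‖ * ‖g z.2‖ :=
    hf.norm.mul_of_nonneg hg.norm (fun _ => norm_nonneg _) fun _ => norm_nonneg _
  have hqp : ∀ m k, δ ≤ ‖q k - p m‖ := fun m k => by rw [norm_sub_rev]; exact hpq m k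
  have s1 : Summable fun z : ℕ × ℕ => f z.1 * (g z.2 * (p z.1 - q z.2)⁻¹) * (s - p z.1)⁻¹ := by
    refine Summable.of_norm_bounded (hprod.mul_right (δ⁻¹ * δ⁻¹)) fun z => ?_
    rw [norm_mul, norm_mul, norm_mul, norm_inv, norm_inv]
    calc _ = ‖f z.1‖ * ‖g z.2‖ * (‖p z.1 - q z.2‖⁻¹ * ‖s - p z.1‖⁻¹) := by ring
      _ ≤ _ := mul_le_mul_of_nonneg_left (mul_le_mul (inv_anti₀ hδ (hpq _ _))
        (inv_anti₀ hδ (hp _)) (by positivity) (by positivity)) (by positivity)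
  have s2 : Summable fun z : ℕ × ℕ => g z.2 * (f z.1 * (q z.2 - p z.1)⁻¹) * (s - q z.2)⁻¹ := by
    refine Summable.of_norm_bounded (hprod.mul_right (δ⁻¹ * δ⁻¹)) fun z => ?_
    rw [norm_mul, norm_mul, norm_mul, norm_inv, norm_inv]
    calc _ = ‖f z.1‖ * ‖g z.2‖ * (‖q z.2 - p z.1‖⁻¹ * ‖s - q z.2‖⁻¹) := by ring
      _ ≤ _ := mul_le_mul_of_nonneg_left (mul_le_mul (inv_anti₀ hδ (hqp _ _))
        (inv_anti₀ hδ (hq _)) (by positivity) (by positivity)) (by positivity)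
  have hne : ∀ {z : ℂ}, δ ≤ ‖z‖ → z ≠ 0 := fun h h0 => by
    rw [h0, norm_zero] at h; linarith
  rw [tsum_mul_tsum_of_summable_norm sf.norm sg.norm]
  have e : ∀ z : ℕ × ℕ, f z.1 * (s - p z.1)⁻¹ * (g z.2 * (s - q z.2)⁻¹) =
      f z.1 * (g z.2 * (p z.1 - q z.2)⁻¹) * (s - p z.1)⁻¹ +
        g z.2 * (f z.1 * (q z.2 - p z.1)⁻¹) * (s - q z.2)⁻¹ := by
    intro z
    have h1 := hne (hp z.1)
    have h2 := hne (hq z.2)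
    have h3 := hne (hpq z.1 z.2)
    have h4 := hne (hqp z.1 z.2)
    rw [show q z.2 - p z.1 = -(p z.1 - q z.2) by ring] at h4 ⊢
    field_simp
    ring
  rw [tsum_congr e, s1.tsum_add s2, s1.tsum_prod]
  refine congrArg₂ _ ?_ (((Equiv.prodComm ℕ ℕ).tsum_eq _).symm.trans
    (((Equiv.prodComm ℕ ℕ).summable_iff.mpr s2).tsum_prod.trans ?_))
  · refine tsum_congr fun m => ?_
    simp only
    rw [tsum_mul_right, tsum_mul_left]
  · refine tsum_congr fun k => ?_
    simp only [Function.comp, Equiv.prodComm_apply, Prod.swap_prod_mk]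
    rw [tsum_mul_right, tsum_mul_left]

/-- Summation over the integers of a sum of simple fractions in an arithmetic progression,
against a Cauchy kernel. -/
theorem tsum_int_tsum_mul_inv {ρ : ℕ → ℂ} (hρ : Summable ρ) {α x : ℂ} (hα : NonInt α)
    (hx : NonInt x) (hxα : NonInt (x - α)) :
    Summable (fun j : ℤ => (∑' m : ℕ, ρ m * ((j : ℂ) - (α - 1 - m))⁻¹) * ((j : ℂ) - x)⁻¹) ∧
    ∑' j : ℤ, (∑' m : ℕ, ρ m * ((j : ℂ) - (α - 1 - m))⁻¹) * ((j : ℂ) - x)⁻¹ =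
      (picot α - picot x) * ∑' m : ℕ, ρ m * (x + 1 - α + m)⁻¹ := by
  have hα' : ∀ m : ℕ, NonInt (α - 1 - m) := fun m => by
    have := hα.add_int (-(1 + m)); push_cast at this; convert this using 1; ring
  have sum1 : Summable fun z : ℤ × ℕ => (‖(z.1 : ℂ) - x‖⁻¹) ^ 2 * ‖ρ z.2‖ :=
    (summable_inv_norm_int_sub_sq hx).mul_of_nonneg hρ.norm (fun _ => by positivity)
      fun _ => norm_nonneg _
  have sum2 : Summable fun z : ℤ × ℕ =>
      (‖(z.1 : ℂ) - (α - 1 - z.2)‖⁻¹) ^ 2 * ‖ρ z.2‖ := by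
    have h := ((summable_inv_norm_int_sub_sq hα).mul_of_nonneg hρ.norm (fun _ => by positivity)
      fun _ => norm_nonneg _).comp_injective
      (i := fun z : ℤ × ℕ => (z.1 + 1 + z.2, z.2)) (fun a b hab => by
        simp only [Prod.mk.injEq] at hab
        refine Prod.ext ?_ hab.2
        have h2 := hab.2
        have h1 := hab.1
        rw [h2] at h1
        simpa using h1)
    refine h.congr fun z => ?_
    simp only [Function.comp]
    push_cast
    rw [show (z.1 : ℂ) + 1 + z.2 - α = z.1 - (α - 1 - z.2) by ring]
  have hs : Summable (Function.uncurry fun (j : ℤ) (m : ℕ) =>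
      ρ m * ((j : ℂ) - (α - 1 - m))⁻¹ * ((j : ℂ) - x)⁻¹) := by
    refine Summable.of_norm_bounded (sum1.add sum2) ?_
    rintro ⟨j, m⟩
    simp only [Function.uncurry_apply_pair]
    rw [norm_mul, norm_mul, norm_inv, norm_inv]
    have := inv_mul_inv_le_sq (‖(j : ℂ) - x‖⁻¹) (‖(j : ℂ) - (α - 1 - m)‖⁻¹)
    nlinarith [norm_nonneg (ρ m)]
  constructor
  · refine hs.prod.congr fun j => ?_
    simp only [Function.uncurry_apply_pair]
    rw [tsum_mul_right]
  · simp_rw [← tsum_mul_right]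
    rw [← hs.tsum_comm, ← tsum_mul_left]
    refine tsum_congr fun m => ?_
    have hxm : x ≠ α - 1 - m := by
      intro h
      exact hxα (-1 - m) (by push_cast; linear_combination h)
    simp_rw [mul_assoc]
    rw [tsum_mul_left, tsum_inv_mul_inv_int_sub hx (hα' m) hxm]
    have h2 : picot (α - 1 - m) = picot α := by
      have := picot_sub_int α (1 + m)
      push_cast at this
      rw [← this]; congr 1; ring
    rw [h2, show x - (α - 1 - m) = x + 1 - α + m by ring]
    ring

/-! ### The beta function as a sum of simple fractions -/

/-- The coefficients in the expansion of `Γ(u) / Γ(u + c)` into simple fractions. -/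
noncomputable def betaCoef (c : ℂ) (m : ℕ) : ℂ := rG c * (poch (1 - c) m / (m.factorial : ℂ))

theorem summable_betaCoef {c : ℂ} (hc : 1 < c.re) : Summable (betaCoef c) := by
  obtain ⟨C, hC, h⟩ := exists_norm_poch_le ‖1 - c‖
  refine Summable.mul_left _ (Summable.of_norm_bounded
    ((summable_nat_add_one_rpow (p := -c.re) (by linarith)).mul_left C) fun m => ?_)
  have hfac : (0 : ℝ) < m.factorial := by exact_mod_cast m.factorial_pos
  rw [norm_div, Complex.norm_natCast, div_le_iff₀ hfac]
  refine (h _ le_rfl m).trans (le_of_eq ?_)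
  rw [show (1 - c).re - 1 = -c.re by simp]
  ring

theorem tsum_betaCoef {c u : ℂ} (hc : 0 < c.re) (hu : ∀ k : ℕ, u ≠ -(k : ℂ)) :
    ∑' m : ℕ, betaCoef c m * (u + m)⁻¹ = Complex.Gamma u * rG (u + c) := by
  have hg := tsum_gaussTerm (a := 1 - c) (b := u) (c := u + 1) (by
    rw [show u + 1 - (1 - c) - u = c by ring]; exact hc)
  have h1 : ∀ m : ℕ, gaussTerm (1 - c) u (u + 1) m =
      poch (1 - c) m / (m.factorial : ℂ) * (u + m)⁻¹ * rG u := by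
    intro m
    have hm : u + m ≠ 0 := fun h => hu m (by linear_combination h)
    rw [gaussTerm, rG_eq_poch_mul u (m + 1), poch_succ, show u + (m + 1 : ℕ) = u + 1 + m by
      push_cast; ring]
    field_simp
  simp only [h1] at hg
  rw [tsum_mul_right, show u + 1 - (1 - c) = u + c by ring, show u + 1 - u = 1 by ring,
    show u + c - u = c by ring, rG_one] at hg
  simp only [betaCoef]
  simp_rw [mul_assoc (rG c)]
  rw [tsum_mul_left]
  have g1 := Gamma_mul_rG hu
  have g2 := Gamma_mul_rG (ne_neg_nat_of_re_pos hc)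
  calc _ = rG c * (∑' m : ℕ, poch (1 - c) m / (m.factorial : ℂ) * (u + m)⁻¹) *
        (Complex.Gamma u * rG u) := by rw [g1]; ring
    _ = Complex.Gamma u * rG c * ((∑' m : ℕ, poch (1 - c) m / (m.factorial : ℂ) * (u + m)⁻¹) *
        rG u) := by ring
    _ = Complex.Gamma u * rG (u + c) * (Complex.Gamma c * rG c) := by rw [hg]; ring
    _ = _ := by rw [g2, mul_one]

/-! ### Cauchy transforms of bilateral gamma products -/

/-- The bilateral product `1 / (Γ(α - j) Γ(α' - j) Γ(b + j) Γ(b' + j))`. -/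
noncomputable def gamProd (α α' b b' : ℂ) (j : ℤ) : ℂ :=
  rG (α - j) * rG (α' - j) * (rG (b + j) * rG (b' + j))

/-- The coefficients `(2 - α - b)_m (2 - α - b')_m / (m! (1 + α' - α)_m)`. -/
noncomputable def blockCoef (α α' b b' : ℂ) (m : ℕ) : ℂ :=
  poch (2 - α - b) m * poch (2 - α - b') m / ((m.factorial : ℂ) * poch (1 + α' - α) m)

theorem rG_reflect {a : ℂ} (ha : NonInt a) :
    rG a = Complex.sin (Real.pi * a) / Real.pi * Complex.Gamma (1 - a) := by
  have h := Complex.Gamma_mul_Gamma_one_sub a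
  have h1 := Gamma_mul_rG ha.ne_neg_nat
  have h2 := sin_pi_ne_zero ha
  have h3 := pi_ne_zero'
  have h4 : Complex.Gamma a ≠ 0 := left_ne_zero_of_mul_eq_one h1
  refine mul_left_cancel₀ h4 ?_
  rw [h1, show Complex.Gamma a * (Complex.sin (Real.pi * a) / Real.pi * Complex.Gamma (1 - a)) =
    Complex.sin (Real.pi * a) / Real.pi * (Complex.Gamma a * Complex.Gamma (1 - a)) by ring, h]
  field_simp

theorem gamProd_eq {α α' : ℂ} (hα : NonInt α) (hα' : NonInt α') (b b' : ℂ) (j : ℤ) :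
    gamProd α α' b b' j = Complex.sin (Real.pi * α) * Complex.sin (Real.pi * α') / Real.pi ^ 2 *
      ((Complex.Gamma (j + 1 - α) * rG (j + 1 - α + (α + b' - 1))) *
        (Complex.Gamma (j + 1 - α') * rG (j + 1 - α' + (α' + b - 1)))) := by
  have h1 := hα.add_int (-j)
  have h2 := hα'.add_int (-j)
  push_cast at h1 h2
  rw [← sub_eq_add_neg] at h1 h2
  rw [gamProd, rG_reflect h1, rG_reflect h2, sin_pi_sub_int, sin_pi_sub_int,
    show 1 - (α - j) = j + 1 - α by ring, show 1 - (α' - j) = j + 1 - α' by ring,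
    show j + 1 - α + (α + b' - 1) = b' + j by ring, show j + 1 - α' + (α' + b - 1) = b + j by ring]
  linear_combination (Complex.sin (Real.pi * α) / Real.pi * Complex.Gamma (j + 1 - α) *
    (Complex.sin (Real.pi * α') / Real.pi * Complex.Gamma (j + 1 - α')) *
    (rG (b + j) * rG (b' + j))) * cos_pi_int_sq j

theorem betaCoef_mul_eq {α α' : ℂ} (h : NonInt (α - α')) (b b' : ℂ) (m : ℕ) :
    betaCoef (α + b' - 1) m * (Complex.Gamma (α - α' - m) * rG (α + b - 1 - m)) =
      Complex.Gamma (α - α') * rG (α + b - 1) * rG (α + b' - 1) * blockCoef α α' b b' m := by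
  have hm := h.add_int (-m)
  push_cast at hm
  rw [← sub_eq_add_neg] at hm
  have h1 := Gamma_mul_rG hm.ne_neg_nat
  have h2 := Gamma_mul_rG h.ne_neg_nat
  have h3 : Complex.Gamma (α - α') ≠ 0 := left_ne_zero_of_mul_eq_one h2
  have hp : poch (1 - (α - α')) m ≠ 0 := poch_ne_zero (fun k hk =>
    h (k + 1) (by push_cast; linear_combination -hk)) m
  have hfac : (m.factorial : ℂ) ≠ 0 := by exact_mod_cast m.factorial_ne_zero
  rw [rG_sub_nat] at h1
  have h5 : Complex.Gamma (α - α' - m) * poch (1 - (α - α')) m =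
      (-1) ^ m * Complex.Gamma (α - α') := by
    have e : ((-1 : ℂ) ^ m) * (-1) ^ m = 1 := by rw [← mul_pow]; simp
    calc _ = (Complex.Gamma (α - α' - m) * ((-1) ^ m * poch (1 - (α - α')) m * rG (α - α'))) *
          ((-1) ^ m * Complex.Gamma (α - α')) * (((-1 : ℂ) ^ m) * (-1) ^ m)⁻¹ *
            (Complex.Gamma (α - α') * rG (α - α'))⁻¹ *
            ((((-1 : ℂ) ^ m) * (-1) ^ m) * (((-1 : ℂ) ^ m) * (-1) ^ m)⁻¹) := by
          rw [h1, e, h2]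
          have : Complex.Gamma (α - α' - m) * poch (1 - (α - α')) m =
            (Complex.Gamma (α - α' - m) * ((-1) ^ m * poch (1 - (α - α')) m * rG (α - α'))) *
              (((-1) ^ m * (-1) ^ m) * ((-1) ^ m * Complex.Gamma (α - α'))) := by
            calc _ = Complex.Gamma (α - α' - m) * poch (1 - (α - α')) m *
                  ((((-1 : ℂ) ^ m) * (-1) ^ m) * (((-1 : ℂ) ^ m) * (-1) ^ m) *
                    (Complex.Gamma (α - α') * rG (α - α'))) := by rw [e, h2]; ring
              _ = _ := by ring
          rw [this, h1, e]; ring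
      _ = _ := by rw [h1, e, h2]; ring
  have e : ((-1 : ℂ) ^ m) * (-1) ^ m = 1 := by rw [← mul_pow]; simp
  rw [betaCoef, blockCoef, rG_sub_nat (α + b - 1), show 1 - (α + b' - 1) = 2 - α - b' by ring,
    show 1 - (α + b - 1) = 2 - α - b by ring, show 1 + α' - α = 1 - (α - α') by ring]
  field_simp
  linear_combination (rG (α + b' - 1) * poch (2 - α - b') m * (-1) ^ m * poch (2 - α - b) m *
    rG (α + b - 1)) * h5 + (rG (α + b' - 1) * poch (2 - α - b') m * poch (2 - α - b) m *
    rG (α + b - 1) * Complex.Gamma (α - α')) * e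

theorem summable_mul_tsum_mul_inv {f g p q : ℕ → ℂ} (hf : Summable f) (hg : Summable g) {δ : ℝ}
    (hδ : 0 < δ) (hpq : ∀ m k, δ ≤ ‖p m - q k‖) :
    Summable fun m => f m * ∑' k, g k * (p m - q k)⁻¹ := by
  refine Summable.of_norm_bounded (hf.norm.mul_right (∑' k, ‖g k‖ * δ⁻¹)) fun m => ?_
  rw [norm_mul]
  refine mul_le_mul_of_nonneg_left ?_ (norm_nonneg _)
  refine tsum_of_norm_bounded (hg.norm.mul_right δ⁻¹).hasSum fun k => ?_
  rw [norm_mul, norm_inv]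
  exact mul_le_mul_of_nonneg_left (inv_anti₀ hδ (hpq m k)) (norm_nonneg _)

theorem exists_le_norm_int_sub {x : ℂ} (hx : NonInt x) :
    ∃ c : ℝ, 0 < c ∧ ∀ j : ℤ, c ≤ ‖(j : ℂ) - x‖ := by
  obtain ⟨c, hc, h⟩ := exists_mul_abs_le_norm_int_sub x
  refine ⟨c, hc, fun j => le_trans ?_ (h j (hx j).symm)⟩
  nlinarith [abs_nonneg (j : ℝ)]

theorem cauchy_gamProd {α α' b b' x : ℂ} (hc : 1 < (α + b' - 1).re) (hc' : 1 < (α' + b - 1).re)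
    (hα : NonInt α) (hα' : NonInt α') (hαα : NonInt (α - α')) (hx : NonInt x)
    (hxα : NonInt (x - α)) (hxα' : NonInt (x - α')) :
    Summable (fun j : ℤ => gamProd α α' b b' j * ((j : ℂ) - x)⁻¹) ∧
    ∑' j : ℤ, gamProd α α' b b' j * ((j : ℂ) - x)⁻¹ =
      (Real.pi * Complex.sin (Real.pi * x))⁻¹ *
        (Complex.sin (Real.pi * α') * Complex.sin (Real.pi * (x - α)) *
            (Complex.Gamma (α - α') * rG (α + b - 1) * rG (α + b' - 1)) *
            ∑' m : ℕ, blockCoef α α' b b' m * (x + 1 - α + m)⁻¹ +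
          Complex.sin (Real.pi * α) * Complex.sin (Real.pi * (x - α')) *
            (Complex.Gamma (α' - α) * rG (α' + b - 1) * rG (α' + b' - 1)) *
            ∑' m : ℕ, blockCoef α' α b b' m * (x + 1 - α' + m)⁻¹) := by
  obtain ⟨δ1, hδ1, d1⟩ := exists_le_norm_int_sub hα
  obtain ⟨δ2, hδ2, d2⟩ := exists_le_norm_int_sub hα'
  obtain ⟨δ3, hδ3, d3⟩ := exists_le_norm_int_sub hαα
  set δ := min δ1 (min δ2 δ3) with hδdef
  have hδ : 0 < δ := lt_min hδ1 (lt_min hδ2 hδ3)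
  have hαα' : NonInt (α' - α) := by have := hαα.neg; rwa [neg_sub] at this
  set f := betaCoef (α + b' - 1)
  set g := betaCoef (α' + b - 1)
  have hf : Summable f := summable_betaCoef hc
  have hg : Summable g := summable_betaCoef hc'
  set p : ℕ → ℂ := fun m => α - 1 - m with hp
  set q : ℕ → ℂ := fun m => α' - 1 - m with hq
  have hjp : ∀ (j : ℤ) m, δ ≤ ‖(j : ℂ) - p m‖ := fun j m => by
    have := d1 (j + 1 + m)
    push_cast at this
    rw [show (j : ℂ) - p m = j + 1 + m - α by simp only [hp]; ring]
    exact (min_le_left _ _).trans this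
  have hjq : ∀ (j : ℤ) m, δ ≤ ‖(j : ℂ) - q m‖ := fun j m => by
    have := d2 (j + 1 + m)
    push_cast at this
    rw [show (j : ℂ) - q m = j + 1 + m - α' by simp only [hq]; ring]
    exact ((min_le_right _ _).trans (min_le_left _ _)).trans this
  have hpq : ∀ m k, δ ≤ ‖p m - q k‖ := fun m k => by
    have := d3 (m - k)
    push_cast at this
    rw [norm_sub_rev, show q k - p m = m - k - (α - α') by simp only [hp, hq]; ring]
    exact ((min_le_right _ _).trans (min_le_right _ _)).trans this
  have hqp : ∀ m k, δ ≤ ‖q m - p k‖ := fun m k => by rw [norm_sub_rev]; exact hpq k m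
  have hF : ∀ {u : ℂ}, NonInt u → ∑' m, f m * (u + m)⁻¹ = Complex.Gamma u * rG (u + (α + b' - 1)) :=
    fun hu => tsum_betaCoef (by linarith) hu.ne_neg_nat
  have hG : ∀ {u : ℂ}, NonInt u → ∑' m, g m * (u + m)⁻¹ = Complex.Gamma u * rG (u + (α' + b - 1)) :=
    fun hu => tsum_betaCoef (by linarith) hu.ne_neg_nat
  have hGp : ∀ m, f m * ∑' k, g k * (p m - q k)⁻¹ =
      Complex.Gamma (α - α') * rG (α + b - 1) * rG (α + b' - 1) * blockCoef α α' b b' m := by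
    intro m
    have hm := hαα.add_int (-m)
    push_cast at hm
    rw [← sub_eq_add_neg] at hm
    rw [← betaCoef_mul_eq hαα b b' m, show α + b - 1 - m = α - α' - m + (α' + b - 1) by ring, ← hG hm]
    congr 2
    funext k
    simp only [hp, hq]
    ring_nf
  have hFq : ∀ m, g m * ∑' k, f k * (q m - p k)⁻¹ =
      Complex.Gamma (α' - α) * rG (α' + b - 1) * rG (α' + b' - 1) * blockCoef α' α b b' m := by
    intro m
    have hm := hαα'.add_int (-m)
    push_cast at hm
    rw [← sub_eq_add_neg] at hm
    have h1 := betaCoef_mul_eq hαα' b' b m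
    rw [show α' + b' - 1 - m = α' - α - m + (α + b' - 1) by ring, ← hF hm] at h1
    rw [show Complex.Gamma (α' - α) * rG (α' + b - 1) * rG (α' + b' - 1) * blockCoef α' α b b' m =
      Complex.Gamma (α' - α) * rG (α' + b' - 1) * rG (α' + b - 1) * blockCoef α' α b' b m by
        simp only [blockCoef]; ring, ← h1]
    congr 2
    funext k
    simp only [hp, hq]
    ring_nf
  have sρ := summable_mul_tsum_mul_inv hf hg hδ hpq
  have sρ' := summable_mul_tsum_mul_inv hg hf hδ hqp
  obtain ⟨t1, e1⟩ := tsum_int_tsum_mul_inv sρ hα hx hxα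
  obtain ⟨t2, e2⟩ := tsum_int_tsum_mul_inv sρ' hα' hx hxα'
  have hterm : ∀ j : ℤ, gamProd α α' b b' j * ((j : ℂ) - x)⁻¹ =
      Complex.sin (Real.pi * α) * Complex.sin (Real.pi * α') / Real.pi ^ 2 *
      ((∑' m : ℕ, (f m * ∑' k, g k * (p m - q k)⁻¹) * ((j : ℂ) - (α - 1 - m))⁻¹) * ((j : ℂ) - x)⁻¹ +
      (∑' m : ℕ, (g m * ∑' k, f k * (q m - p k)⁻¹) * ((j : ℂ) - (α' - 1 - m))⁻¹) *
        ((j : ℂ) - x)⁻¹) := by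
    intro j
    have h1 := hα.neg.add_int (j + 1)
    have h2 := hα'.neg.add_int (j + 1)
    push_cast at h1 h2
    rw [show -α + ((j : ℂ) + 1) = j + 1 - α by ring] at h1
    rw [show -α' + ((j : ℂ) + 1) = j + 1 - α' by ring] at h2
    rw [gamProd_eq hα hα', ← hF h1, ← hG h2, ← add_mul]
    have := tsum_mul_inv_mul_tsum_mul_inv hf hg hδ (hjp j) (hjq j) hpq
    rw [← this, mul_assoc]
    congr 4 <;>
    · funext k
      simp only [hp, hq]
      ring_nf
  constructor
  · refine Summable.congr ?_ fun j => (hterm j).symm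
    exact (t1.add t2).mul_left _
  · rw [tsum_congr hterm, tsum_mul_left, t1.tsum_add t2, e1, e2]
    simp only [hGp, hFq]
    simp_rw [mul_assoc (Complex.Gamma (α - α') * rG (α + b - 1) * rG (α + b' - 1)),
      mul_assoc (Complex.Gamma (α' - α) * rG (α' + b - 1) * rG (α' + b' - 1))]
    rw [tsum_mul_left, tsum_mul_left, picot_sub_picot hx hα, picot_sub_picot hx hα']
    have n1 := sin_pi_ne_zero hα
    have n2 := sin_pi_ne_zero hα'
    have n3 := sin_pi_ne_zero hx
    have n4 := pi_ne_zero'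
    field_simp

/-! ### Growth of bilateral gamma products -/

theorem exists_norm_rG_sub_le (M : ℝ) : ∃ C : ℝ, 0 < C ∧ ∀ a : ℂ, ‖a‖ ≤ M → ∀ k : ℕ,
    ‖rG (a - k)‖ ≤ C * k.factorial * ((k : ℝ) + 1) ^ (-a.re) := by
  obtain ⟨C1, h1, H1⟩ := exists_norm_poch_le (M + 1)
  obtain ⟨C2, h2, H2⟩ := exists_norm_rG_le M
  refine ⟨C1 * C2, by positivity, fun a ha k => ?_⟩
  have b1 := H1 (1 - a) ((norm_sub_le _ _).trans (by rw [norm_one]; linarith)) k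
  have b2 := H2 a ha 0
  rw [show (1 - a).re - 1 = -a.re by simp] at b1
  simp only [Nat.cast_zero, add_zero, zero_add, Real.one_rpow, mul_one, Nat.factorial_zero,
    Nat.cast_one, div_one] at b2
  rw [rG_sub_nat, norm_mul, norm_mul, norm_pow, norm_neg, norm_one, one_pow, one_mul]
  calc _ ≤ C1 * k.factorial * ((k : ℝ) + 1) ^ (-a.re) * C2 := by gcongr
    _ = _ := by ring

theorem exists_norm_gamProd_le (M : ℝ) : ∃ C : ℝ, 0 < C ∧ ∀ α α' b b' : ℂ, ‖α‖ ≤ M → ‖α'‖ ≤ M →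
    ‖b‖ ≤ M → ‖b'‖ ≤ M → ∀ j : ℤ,
    ‖gamProd α α' b b' j‖ ≤ C * (|(j : ℝ)| + 1) ^ (2 - (α + α' + b + b').re) := by
  obtain ⟨C1, h1, H1⟩ := exists_norm_rG_sub_le M
  obtain ⟨C2, h2, H2⟩ := exists_norm_rG_le M
  have key : ∀ α α' b b' : ℂ, ‖α‖ ≤ M → ‖α'‖ ≤ M → ‖b‖ ≤ M → ‖b'‖ ≤ M → ∀ k : ℕ,
      ‖rG (α - k) * rG (α' - k) * (rG (b + k) * rG (b' + k))‖ ≤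
        C1 * C1 * (C2 * C2) * ((k : ℝ) + 1) ^ (2 - (α + α' + b + b').re) := by
    intro α α' b b' hα hα' hb hb' k
    have hk : (0 : ℝ) < k + 1 := by positivity
    have hfac : (0 : ℝ) < k.factorial := by exact_mod_cast k.factorial_pos
    rw [norm_mul, norm_mul, norm_mul]
    rw [show 2 - (α + α' + b + b').re = -α.re + -α'.re + ((1 - b.re) + (1 - b'.re)) by
      simp only [Complex.add_re]; ring, Real.rpow_add hk, Real.rpow_add hk, Real.rpow_add hk]
    calc _ ≤ (C1 * k.factorial * ((k : ℝ) + 1) ^ (-α.re)) *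
          (C1 * k.factorial * ((k : ℝ) + 1) ^ (-α'.re)) *
          ((C2 / k.factorial * ((k : ℝ) + 1) ^ (1 - b.re)) *
            (C2 / k.factorial * ((k : ℝ) + 1) ^ (1 - b'.re))) := by
          gcongr
          · exact H1 α hα k
          · exact H1 α' hα' k
          · exact H2 b hb k
          · exact H2 b' hb' k
      _ = _ := by field_simp
  refine ⟨C1 * C1 * (C2 * C2), by positivity, fun α α' b b' hα hα' hb hb' j => ?_⟩
  obtain ⟨k, rfl | rfl⟩ := j.eq_nat_or_neg
  · simpa [gamProd] using key α α' b b' hα hα' hb hb' k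
  · have h := key b b' α α' hb hb' hα hα' k
    rw [show b + b' + α + α' = α + α' + b + b' by ring] at h
    simp only [gamProd]
    push_cast
    rw [abs_neg, Nat.abs_cast, sub_neg_eq_add, sub_neg_eq_add, ← sub_eq_add_neg, ← sub_eq_add_neg,
      mul_comm (rG (α + k) * rG (α' + k))]
    exact h

theorem summable_gamProd_mul {α α' b b' : ℂ} {g : ℤ → ℂ} {C r : ℝ}
    (hg : ∀ j, ‖g j‖ ≤ C * (|(j : ℝ)| + 1) ^ r) (hr : r + 3 < (α + α' + b + b').re) :
    Summable fun j => gamProd α α' b b' j * g j := by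
  obtain ⟨M, h1, h2, h3, h4, -⟩ := exists_bound_norms α α' b b' 0
  obtain ⟨C', hC', h⟩ := exists_norm_gamProd_le M
  refine Summable.of_norm_bounded ((summable_int_abs_add_one_rpow
    (p := 2 - (α + α' + b + b').re + r) (by linarith)).mul_left (C' * C)) fun j => ?_
  have hj : (0 : ℝ) < |(j : ℝ)| + 1 := by positivity
  rw [norm_mul, Real.rpow_add hj]
  refine (mul_le_mul (h α α' b b' h1 h2 h3 h4 j) (hg j) (norm_nonneg _) (by positivity)).trans
    (le_of_eq (by ring))

/-! ### The Rodrigues formula -/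

open Finset in
theorem sum_poch_four_eq (u u' s s' : ℂ) (n : ℕ) :
    ∑ p ∈ antidiagonal n, (n.choose p.1 : ℂ) * ((-1) ^ p.1 * poch u p.1 * poch u' p.1 *
        poch (s + p.1) p.2 * poch (s' + p.1) p.2) =
      ∑ p ∈ antidiagonal n, (n.choose p.1 : ℂ) * (poch (s' - u) p.1 * poch (s - u') p.2 *
        poch u' p.1 * poch (s' + p.1) p.2) := by
  set G : ℕ → ℕ → ℕ → ℂ := fun k l r => ((k + l + r).choose (k + l) : ℂ) *
    ((k + l).choose k : ℂ) * ((-1) ^ l * poch (s' - u) k * poch (s' + k) l *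
      poch (s' + (k + l : ℕ)) r * poch u' (k + l) * poch (s + (k + l : ℕ)) r) with hG
  have h1 : ∀ p ∈ antidiagonal n, (n.choose p.1 : ℂ) * ((-1) ^ p.1 * poch u p.1 * poch u' p.1 *
      poch (s + p.1) p.2 * poch (s' + p.1) p.2) = ∑ q ∈ antidiagonal p.1, G q.1 q.2 p.2 := by
    rintro ⟨i, r⟩ hp
    simp only [HasAntidiagonal.mem_antidiagonal] at hp
    subst hp
    have hu : poch u i = ∑ q ∈ antidiagonal i, (i.choose q.1 : ℂ) *
        ((-1) ^ q.1 * poch (s' - u) q.1 * poch (s' + q.1) q.2) := by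
      rw [← poch_sub]; congr 1; ring
    simp only
    rw [hu, mul_sum, sum_mul, sum_mul, sum_mul, mul_sum]
    refine sum_congr rfl ?_
    rintro ⟨k, l⟩ hq
    simp only [HasAntidiagonal.mem_antidiagonal] at hq
    subst hq
    have h : ((-1 : ℂ)) ^ k * (-1) ^ (k + l) = (-1) ^ l := by
      rw [← pow_add, show k + (k + l) = 2 * k + l by ring, pow_add, pow_mul]; simp
    simp only [hG]
    rw [← h]
    ring
  rw [sum_congr rfl h1, sum_antidiagonal_assoc]
  refine sum_congr rfl ?_
  rintro ⟨k, m⟩ hp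
  simp only [HasAntidiagonal.mem_antidiagonal] at hp
  subst hp
  simp only
  rw [show s - u' = (s + k) - (u' + k) by ring, poch_sub (s + k), mul_sum, sum_mul, sum_mul, mul_sum]
  refine sum_congr rfl ?_
  rintro ⟨l, r⟩ hq
  simp only [HasAntidiagonal.mem_antidiagonal] at hq
  subst hq
  simp only [hG]
  rw [choose_mul_choose, poch_add u' k l, poch_add (s' + k) l r, ← add_assoc k l r]
  push_cast
  rw [show s' + (k : ℂ) + l = s' + (k + l) by ring, show s + (k : ℂ) + l = s + (k + l) by ring]
  ring

open Finset in
theorem sum_poch_four_eq' (u u' s s' : ℂ) (n : ℕ) :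
    ∑ p ∈ antidiagonal n, (n.choose p.1 : ℂ) * ((-1) ^ p.1 * poch u p.1 * poch u' p.1 *
        poch (s + p.1) p.2 * poch (s' + p.1) p.2) =
      ∑ p ∈ antidiagonal n, (n.choose p.1 : ℂ) * ((-1) ^ p.1 * poch (s' - u) p.1 *
        poch (s' - u') p.1 * poch (s + s' - u - u' + p.1) p.2 * poch (s' + p.1) p.2) := by
  rw [sum_poch_four_eq]
  set G : ℕ → ℕ → ℕ → ℂ := fun i m l => ((i + m + l).choose (i + m) : ℂ) *
    ((i + m).choose i : ℂ) * ((-1) ^ i * poch (s' - u) (i + m) * poch (s' - u') i *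
      poch (s - u') l * poch (s' + i) (m + l)) with hG
  have h1 : ∀ p ∈ antidiagonal n, (n.choose p.1 : ℂ) * (poch (s' - u) p.1 * poch (s - u') p.2 *
        poch u' p.1 * poch (s' + p.1) p.2) = ∑ q ∈ antidiagonal p.1, G q.1 q.2 p.2 := by
    rintro ⟨i, r⟩ hp
    simp only [HasAntidiagonal.mem_antidiagonal] at hp
    subst hp
    have hu : poch u' i = ∑ q ∈ antidiagonal i, (i.choose q.1 : ℂ) *
        ((-1) ^ q.1 * poch (s' - u') q.1 * poch (s' + q.1) q.2) := by
      rw [← poch_sub]; congr 1; ring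
    simp only
    rw [hu, mul_sum, sum_mul, mul_sum]
    refine sum_congr rfl ?_
    rintro ⟨k, l⟩ hq
    simp only [HasAntidiagonal.mem_antidiagonal] at hq
    subst hq
    simp only [hG]
    rw [poch_add (s' + k) l r]
    push_cast
    rw [show s' + (k : ℂ) + l = s' + (k + l) by ring]
    ring
  rw [sum_congr rfl h1, sum_antidiagonal_assoc]
  refine sum_congr rfl ?_
  rintro ⟨i, r⟩ hp
  simp only [HasAntidiagonal.mem_antidiagonal] at hp
  subst hp
  simp only
  rw [show s + s' - u - u' + i = (s' - u + i) + (s - u') by ring, poch_add_eq_sum, mul_sum, sum_mul,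
    mul_sum]
  refine sum_congr rfl ?_
  rintro ⟨m, l⟩ hq
  simp only [HasAntidiagonal.mem_antidiagonal] at hq
  subst hq
  simp only [hG]
  rw [choose_mul_choose, poch_add (s' - u) i m, ← add_assoc i m l]
  ring

theorem poch_neg_nat_eq (n k : ℕ) :
    poch (-(n : ℂ)) k = (-1) ^ k * ((k.factorial : ℂ) * (n.choose k : ℂ)) := by
  rw [poch, ascPochhammer_eval_neg_eq_descPochhammer, descPochhammer_eval_eq_descFactorial,
    Nat.descFactorial_eq_factorial_mul_choose]
  push_cast
  ring

open Finset in
theorem poch_mul_gammaTerm3F2 (n : ℕ) (b c f : ℂ) {e : ℂ} (he : ∀ k : ℕ, e ≠ -(k : ℂ)) :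
    poch e n * gammaTerm3F2 n b c e f = ∑ p ∈ antidiagonal n, (n.choose p.1 : ℂ) *
      ((-1) ^ p.1 * poch b p.1 * poch c p.1 * poch (e + p.1) p.2 * poch (f + p.1) p.2) := by
  rw [gammaTerm3F2, mul_sum, Nat.sum_antidiagonal_eq_sum_range_succ (fun k l : ℕ =>
    (n.choose k : ℂ) * ((-1) ^ k * poch b k * poch c k * poch (e + k) l * poch (f + k) l)) n]
  refine sum_congr rfl fun k hk => ?_
  have hk' : k ≤ n := Nat.lt_succ_iff.mp (mem_range.mp hk)
  have h1 : poch e n = poch e k * poch (e + k) (n - k) := by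
    rw [← poch_add, Nat.add_sub_cancel' hk']
  have h2 := poch_ne_zero he k
  have hfac : (k.factorial : ℂ) ≠ 0 := by exact_mod_cast k.factorial_ne_zero
  rw [h1, poch_neg_nat_eq]
  field_simp

/-- The orthogonal polynomial of degree `n` attached to the weight
`gamProd α α' (b + n) (b' + n)`. -/
noncomputable def orthPoly (n : ℕ) (α α' b b' y : ℂ) : ℂ :=
  gammaTerm3F2 n (α + b' - 1) (α' + b' - 1) (α + α' + b + b' - 2) (y + b')

open Finset in
/-- The Rodrigues formula. -/
theorem rodrigues (n : ℕ) {α α' b b' : ℂ} (hσ : ∀ k : ℕ, α + α' + b + b' - 2 ≠ -(k : ℂ)) (j : ℤ) :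
    poch (α + α' + b + b' - 2) n * (orthPoly n α α' b b' j * gamProd α α' (b + n) (b' + n) j) =
      ∑ p ∈ antidiagonal n, (n.choose p.1 : ℂ) * ((-1) ^ p.1 * gamProd α α' b b' (j + p.1)) := by
  have h1 : ∀ p ∈ antidiagonal n, (n.choose p.1 : ℂ) * ((-1) ^ p.1 * gamProd α α' b b' (j + p.1)) =
      (n.choose p.1 : ℂ) * ((-1) ^ p.1 * poch (1 - (α - j)) p.1 * poch (1 - (α' - j)) p.1 *
        poch (j + b + p.1) p.2 * poch (j + b' + p.1) p.2) * gamProd α α' (b + n) (b' + n) j := by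
    rintro ⟨i, r⟩ hp
    simp only [HasAntidiagonal.mem_antidiagonal] at hp
    subst hp
    have e : ((-1 : ℂ) ^ i) * (-1) ^ i = 1 := by rw [← mul_pow]; simp
    simp only [gamProd]
    push_cast
    rw [← sub_sub, ← sub_sub, rG_sub_nat (α - j), rG_sub_nat (α' - j),
      rG_eq_poch_mul (b + (j + i)) r, rG_eq_poch_mul (b' + (j + i)) r,
      show b + ((j : ℂ) + i) + r = b + (i + r) + j by ring,
      show b' + ((j : ℂ) + i) + r = b' + (i + r) + j by ring,
      show b + ((j : ℂ) + i) = j + b + i by ring, show b' + ((j : ℂ) + i) = j + b' + i by ring]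
    linear_combination (((i + r).choose i : ℂ) * ((-1) ^ i * poch (1 - (α - j)) i *
      poch (1 - (α' - j)) i * poch (j + b + i) r * poch (j + b' + i) r) * (rG (α - j) * rG (α' - j) *
        (rG (b + (i + r) + j) * rG (b' + (i + r) + j)))) * e
  rw [sum_congr rfl h1, ← sum_mul, sum_poch_four_eq', ← mul_assoc, orthPoly,
    poch_mul_gammaTerm3F2 _ _ _ _ hσ]
  congr 1
  refine sum_congr rfl fun p _ => ?_
  rw [show (j : ℂ) + b' - (1 - (α - j)) = α + b' - 1 by ring,
    show (j : ℂ) + b' - (1 - (α' - j)) = α' + b' - 1 by ring,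
    show (j : ℂ) + b + (j + b') - (1 - (α - j)) - (1 - (α' - j)) = α + α' + b + b' - 2 by ring]

open Finset in
theorem hasSum_orthPoly_mul (n : ℕ) {α α' b b' : ℂ}
    (hσ : ∀ k : ℕ, α + α' + b + b' - 2 ≠ -(k : ℂ)) {g : ℤ → ℂ}
    (hg : ∀ i : ℕ, i ≤ n → Summable fun j : ℤ => gamProd α α' b b' j * g (j - i)) :
    HasSum (fun j : ℤ => poch (α + α' + b + b' - 2) n *
        (orthPoly n α α' b b' j * gamProd α α' (b + n) (b' + n) j) * g j)
      (∑ p ∈ antidiagonal n, (n.choose p.1 : ℂ) * ((-1) ^ p.1 *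
        ∑' j : ℤ, gamProd α α' b b' j * g (j - p.1))) := by
  simp_rw [rodrigues n hσ, sum_mul]
  refine hasSum_sum fun p hp => ?_
  have hp' : p.1 ≤ n := by
    have := HasAntidiagonal.mem_antidiagonal.mp hp; omega
  have h := ((Equiv.addRight (p.1 : ℤ)).hasSum_iff.mpr (hg p.1 hp').hasSum).mul_left
    ((n.choose p.1 : ℂ) * (-1) ^ p.1)
  rw [← mul_assoc]
  have h2 : (fun j : ℤ => (n.choose p.1 : ℂ) * ((-1) ^ p.1 * gamProd α α' b b' (j + p.1)) * g j) =
      fun j => (n.choose p.1 : ℂ) * (-1) ^ p.1 *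
        ((fun j => gamProd α α' b b' j * g (j - p.1)) ∘ ⇑(Equiv.addRight (p.1 : ℤ))) j := by
    funext j
    simp only [Function.comp, Equiv.coe_addRight, add_sub_cancel_right]
    ring
  rw [h2]
  exact h

/-! ### The Cauchy transform of the orthogonal polynomials, for large parameters -/

open Finset in
theorem sum_choose_mul_inv_add (n : ℕ) {v : ℂ} (hv : ∀ k : ℕ, v ≠ -(k : ℂ)) :
    ∑ p ∈ antidiagonal n, (n.choose p.1 : ℂ) * ((-1) ^ p.1 * (v + p.1)⁻¹) =
      (n.factorial : ℂ) * (poch v (n + 1))⁻¹ := by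
  induction n generalizing v with
  | zero => simp
  | succ n ih =>
    have hv1 : ∀ k : ℕ, v + 1 ≠ -(k : ℂ) := fun k hk =>
      hv (k + 1) (by push_cast; linear_combination hk)
    rw [sum_choose_succ_mul (fun i _ => (-1) ^ i * (v + i)⁻¹)]
    have h1 : ∀ p ∈ antidiagonal n, (n.choose p.1 : ℂ) * ((-1) ^ p.1 * (v + p.1)⁻¹ +
        (-1) ^ (p.1 + 1) * (v + (p.1 + 1 : ℕ))⁻¹) = (n.choose p.1 : ℂ) * ((-1) ^ p.1 * (v + p.1)⁻¹) -
        (n.choose p.1 : ℂ) * ((-1) ^ p.1 * (v + 1 + p.1)⁻¹) := by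
      intro p _
      push_cast
      rw [show v + ((p.1 : ℂ) + 1) = v + 1 + p.1 by ring]
      ring
    rw [sum_congr rfl h1, sum_sub_distrib, ih hv, ih hv1]
    have e1 : poch v (n + 1 + 1) = v * poch (v + 1) (n + 1) := poch_succ_left _ _
    have e2 := poch_succ v (n + 1)
    have n1 := poch_ne_zero hv (n + 1)
    have n2 := poch_ne_zero hv1 (n + 1)
    have n3 := poch_ne_zero hv (n + 1 + 1)
    have i1 : (poch v (n + 1))⁻¹ = (v + (n + 1 : ℕ)) * (poch v (n + 1 + 1))⁻¹ := by
      rw [← div_eq_mul_inv, eq_div_iff n3, e2]; field_simp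
    have i2 : (poch (v + 1) (n + 1))⁻¹ = v * (poch v (n + 1 + 1))⁻¹ := by
      rw [← div_eq_mul_inv, eq_div_iff n3, e1]; field_simp
    rw [i1, i2, Nat.factorial_succ]
    push_cast
    ring

theorem blockCoef_mul_inv {α α' u : ℂ} (h : NonInt (α - α')) (hu : ∀ k : ℕ, u ≠ -(k : ℂ))
    (b b' : ℂ) (n m : ℕ) : blockCoef α α' b b' m * (poch (u + m) (n + 1))⁻¹ =
      Complex.Gamma (1 + α' - α) * Complex.Gamma u *
        regTerm (2 - α - b) (2 - α - b') u (1 + α' - α) (u + (n + 1 : ℕ)) m := by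
  have hE : ∀ k : ℕ, 1 + α' - α ≠ -(k : ℂ) := fun k hk =>
    h (k + 1) (by push_cast; linear_combination -hk)
  have hum : ∀ k : ℕ, u + m ≠ -(k : ℂ) := fun k hk =>
    hu (k + m) (by push_cast; linear_combination hk)
  have g1 := Gamma_mul_rG hE
  have g2 := Gamma_mul_rG hu
  rw [rG_eq_poch_mul (1 + α' - α) m] at g1
  rw [rG_eq_poch_mul u m, rG_eq_poch_mul (u + m) (n + 1),
    show u + (m : ℂ) + (n + 1 : ℕ) = u + (n + 1 : ℕ) + m by ring] at g2
  have n1 := poch_ne_zero hE m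
  have n2 := poch_ne_zero hum (n + 1)
  have hfac : (m.factorial : ℂ) ≠ 0 := by exact_mod_cast m.factorial_ne_zero
  rw [regTerm, blockCoef]
  field_simp
  linear_combination (-(poch (2 - α - b) m * poch (2 - α - b') m)) *
    (g1 * (Complex.Gamma u * (poch u m * (poch (u + m) (n + 1) * rG (u + (n + 1 : ℕ) + m)))) + g2)

theorem excess_block (α α' b b' u : ℂ) (n : ℕ) :
    1 + α' - α + (u + (n + 1 : ℕ)) - (2 - α - b) - (2 - α - b') - u =
      α + α' + b + b' - 2 + n := by
  push_cast; ring

/-- Parameters for which all the series below converge absolutely and no gamma factor is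
singular. -/
structure LargeRegion (α α' b b' x : ℂ) : Prop where
  two_lt : 2 < (α + b' - 1).re
  two_lt' : 2 < (α' + b - 1).re
  nonInt_fst : NonInt α
  nonInt_snd : NonInt α'
  nonInt_sub : NonInt (α - α')
  nonInt_x : NonInt x
  nonInt_x_sub_fst : NonInt (x - α)
  nonInt_x_sub_snd : NonInt (x - α')
  nonInt_b : NonInt b
  nonInt_fst_add : NonInt (α + b)
  nonInt_snd_add : NonInt (α' + b)

theorem LargeRegion.re_pos {α α' b b' x : ℂ} (h : LargeRegion α α' b b' x) :
    4 < (α + α' + b + b' - 2).re := by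
  have h1 := h.two_lt
  have h2 := h.two_lt'
  simp only [Complex.sub_re, Complex.add_re, Complex.one_re, Complex.re_ofNat] at *
  linarith

theorem LargeRegion.ne_neg_nat {α α' b b' x : ℂ} (h : LargeRegion α α' b b' x) (k : ℕ) :
    α + α' + b + b' - 2 ≠ -(k : ℂ) :=
  ne_neg_nat_of_re_pos (by linarith [h.re_pos]) k

theorem summable_blockCoef_mul_inv {α α' u b b' : ℂ} (h : NonInt (α - α'))
    (hu : ∀ k : ℕ, u ≠ -(k : ℂ)) (hσ : 0 < (α + α' + b + b' - 2).re) (n : ℕ) :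
    Summable fun m : ℕ => blockCoef α α' b b' m * (poch (u + m) (n + 1))⁻¹ := by
  simp_rw [blockCoef_mul_inv h hu]
  refine Summable.mul_left _ (summable_regTerm ?_)
  rw [excess_block, Complex.add_re, Complex.natCast_re]
  positivity

/-- The value of the sum of simple fractions attached to one sequence of poles. -/
theorem tsum_blockCoef_mul_inv {α α' b b' x : ℂ} (h : NonInt (α - α')) (hx : NonInt (x - α))
    (hσ : 0 < (α + α' + b + b' - 2).re) (n : ℕ) :
    ∑' m : ℕ, blockCoef α α' b b' m * (poch (x + 1 - α + m) (n + 1))⁻¹ =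
      Complex.Gamma (1 + α' - α) * Complex.Gamma (x + 1 - α) *
        Complex.Gamma (α + α' + b + b' - 2 + n) *
        reg3F2 (2 - α - b, α' + b' - 1, α' - x, 1 + α' - α, α' + b' + n) := by
  have hu : NonInt (x + 1 - α) := by
    have := hx.add_int 1; push_cast at this; convert this using 1; ring
  have hf : NonInt (x + 1 - α + (n + 1 : ℕ)) := by exact_mod_cast hu.add_int (n + 1 : ℕ)
  have hE : ∀ k : ℕ, 1 + α' - α ≠ -(k : ℂ) := fun k hk =>
    h (k + 1) (by push_cast; linear_combination -hk)
  have hpos : 0 < (α + α' + b + b' - 2 + n).re := by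
    rw [Complex.add_re, Complex.natCast_re]; positivity
  have hth := reg3F2_thomae (2 - α - b) (2 - α - b') (x + 1 - α) (x + 1 - α + (n + 1 : ℕ)) hE
  rw [reg3F2_eq hE hf.ne_neg_nat (by rw [excess_block]; exact hpos), excess_block,
    show 1 + α' - α - (2 - α - b') = α' + b' - 1 by ring,
    show 1 + α' - α - (x + 1 - α) = α' - x by ring,
    show 1 + α' - α + (x + 1 - α + (n + 1 : ℕ)) - (2 - α - b') - (x + 1 - α) = α' + b' + n by
      push_cast; ring] at hth
  simp_rw [blockCoef_mul_inv h hu.ne_neg_nat]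
  rw [tsum_mul_left, ← hth, regSeries]
  linear_combination (-(Complex.Gamma (1 + α' - α) * Complex.Gamma (x + 1 - α) *
    ∑' k, regTerm (2 - α - b) (2 - α - b') (x + 1 - α) (1 + α' - α) (x + 1 - α + (n + 1 : ℕ)) k)) *
    Gamma_mul_rG (ne_neg_nat_of_re_pos hpos)

/-- One of the two terms of the closed form of the Cauchy transform. -/
noncomputable def closedBlock (n : ℕ) (α α' b b' x : ℂ) : ℂ :=
  Complex.sin (Real.pi * α') * (Complex.Gamma (α - α') * Complex.Gamma (1 + α' - α)) *
    (rG (α + b - 1) * rG (α + b' - 1) * rG (α - x)) *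
    reg3F2 (2 - α - b, α' + b' - 1, α' - x, 1 + α' - α, α' + b' + n)

theorem sin_mul_Gamma_eq {α x : ℂ} (hx : NonInt (x - α)) :
    Complex.sin (Real.pi * (x - α)) * Complex.Gamma (x + 1 - α) = -(Real.pi * rG (α - x)) := by
  have h : NonInt (α - x) := by have := hx.neg; rwa [neg_sub] at this
  rw [rG_reflect h, show 1 - (α - x) = x + 1 - α by ring, show α - x = -(x - α) by ring, mul_neg,
    Complex.sin_neg]
  have := pi_ne_zero'
  field_simp

open Finset in
theorem sum_choose_tsum_blockCoef {α α' b b' u : ℂ} (h : NonInt (α - α')) (hu : NonInt u)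
    (hσ : 0 < (α + α' + b + b' - 2).re) (n : ℕ) :
    ∑ p ∈ antidiagonal n, (n.choose p.1 : ℂ) * ((-1) ^ p.1 *
      ∑' m : ℕ, blockCoef α α' b b' m * (u + m + p.1)⁻¹) = (n.factorial : ℂ) *
      ∑' m : ℕ, blockCoef α α' b b' m * (poch (u + m) (n + 1))⁻¹ := by
  have hui : ∀ i : ℕ, NonInt (u + i) := fun i => by exact_mod_cast hu.add_int i
  have s : ∀ i : ℕ, Summable fun m : ℕ => blockCoef α α' b b' m * (u + m + i)⁻¹ := fun i => by
    refine (summable_blockCoef_mul_inv h (hui i).ne_neg_nat hσ 0).congr fun m => ?_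
    rw [zero_add, poch_one, add_right_comm]
  calc _ = ∑ p ∈ antidiagonal n, ∑' m : ℕ, (n.choose p.1 : ℂ) * ((-1) ^ p.1 *
        (blockCoef α α' b b' m * (u + m + p.1)⁻¹)) := by
        refine sum_congr rfl fun p _ => ?_
        rw [tsum_mul_left, tsum_mul_left]
    _ = ∑' m : ℕ, ∑ p ∈ antidiagonal n, (n.choose p.1 : ℂ) * ((-1) ^ p.1 *
        (blockCoef α α' b b' m * (u + m + p.1)⁻¹)) :=
        (Summable.tsum_finsetSum fun p _ => ((s p.1).mul_left _).mul_left _).symm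
    _ = _ := by
        rw [← tsum_mul_left]
        refine tsum_congr fun m => ?_
        rw [mul_left_comm, ← sum_choose_mul_inv_add n (hui m).ne_neg_nat, mul_sum]
        refine sum_congr rfl fun p _ => ?_
        ring

theorem sin_pi_add_nat (y : ℂ) (i : ℕ) : Complex.sin (Real.pi * (y + i)) =
    Complex.cos (Real.pi * (-(i : ℤ) : ℤ)) * Complex.sin (Real.pi * y) := by
  rw [← sin_pi_sub_int]
  push_cast
  rw [sub_neg_eq_add]

theorem LargeRegion.nonInt_sub' {α α' b b' x : ℂ} (h : LargeRegion α α' b b' x) :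
    NonInt (α' - α) := by
  have := h.nonInt_sub.neg; rwa [neg_sub] at this

/-- The partial fraction expansion of the Cauchy transform of the weight at shifted points. -/
theorem LargeRegion.cauchy_gamProd_add_nat {α α' b b' x : ℂ} (h : LargeRegion α α' b b' x)
    (i : ℕ) :
    Summable (fun j : ℤ => gamProd α α' b b' j * (((j - (i : ℤ) : ℤ) : ℂ) - x)⁻¹) ∧
    ∑' j : ℤ, gamProd α α' b b' j * (((j - (i : ℤ) : ℤ) : ℂ) - x)⁻¹ =
      (Real.pi * Complex.sin (Real.pi * x))⁻¹ * (Complex.sin (Real.pi * α') *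
        Complex.sin (Real.pi * (x - α)) * (Complex.Gamma (α - α') * rG (α + b - 1) *
        rG (α + b' - 1))) * ∑' m : ℕ, blockCoef α α' b b' m * (x + 1 - α + m + i)⁻¹ +
      (Real.pi * Complex.sin (Real.pi * x))⁻¹ * (Complex.sin (Real.pi * α) *
        Complex.sin (Real.pi * (x - α')) * (Complex.Gamma (α' - α) * rG (α' + b - 1) *
        rG (α' + b' - 1))) * ∑' m : ℕ, blockCoef α' α b b' m * (x + 1 - α' + m + i)⁻¹ := by
  have hxi : NonInt (x + i) := by exact_mod_cast h.nonInt_x.add_int i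
  have hxα : NonInt (x + i - α) := by
    have := h.nonInt_x_sub_fst.add_int i
    rwa [show x - α + (i : ℤ) = x + i - α by push_cast; ring] at this
  have hxα' : NonInt (x + i - α') := by
    have := h.nonInt_x_sub_snd.add_int i
    rwa [show x - α' + (i : ℤ) = x + i - α' by push_cast; ring] at this
  obtain ⟨hs, hv⟩ := cauchy_gamProd (b := b) (b' := b') (x := x + i) (by linarith [h.two_lt])
    (by linarith [h.two_lt']) h.nonInt_fst h.nonInt_snd h.nonInt_sub hxi hxα hxα'
  have e1 : (fun j : ℤ => gamProd α α' b b' j * (((j - (i : ℤ) : ℤ) : ℂ) - x)⁻¹) =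
      fun j : ℤ => gamProd α α' b b' j * ((j : ℂ) - (x + i))⁻¹ := funext fun j => by
    push_cast; rw [sub_sub, add_comm x]
  have e2 : ∀ (γ : ℂ) (m : ℕ), x + i + 1 - γ + m = x + 1 - γ + m + i := fun γ m => by ring
  simp_rw [e2] at hv
  rw [e1]
  refine ⟨hs, hv.trans ?_⟩
  have hcos : Complex.cos (Real.pi * (-(i : ℤ) : ℤ)) ≠ 0 := by
    intro h0
    have := cos_pi_int_sq (-(i : ℤ))
    rw [h0] at this
    simp at this
  rw [sin_pi_add_nat, show x + i - α = (x - α) + i by ring, show x + i - α' = (x - α') + i by ring,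
    sin_pi_add_nat, sin_pi_add_nat]
  generalize Complex.cos (Real.pi * (-(i : ℤ) : ℤ)) = c at hcos
  rw [mul_inv, mul_inv, mul_inv]
  linear_combination ((Real.pi : ℂ)⁻¹ * (Complex.sin (Real.pi * x))⁻¹ * (Complex.sin (Real.pi * α') *
    Complex.sin (Real.pi * (x - α)) * (Complex.Gamma (α - α') * rG (α + b - 1) *
    rG (α + b' - 1)) * ∑' m : ℕ, blockCoef α α' b b' m * (x + 1 - α + m + i)⁻¹ +
    Complex.sin (Real.pi * α) * Complex.sin (Real.pi * (x - α')) * (Complex.Gamma (α' - α) *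
    rG (α' + b - 1) * rG (α' + b' - 1)) *
    ∑' m : ℕ, blockCoef α' α b b' m * (x + 1 - α' + m + i)⁻¹)) * mul_inv_cancel₀ hcos

open Finset in
theorem LargeRegion.sum_cauchy_gamProd {α α' b b' x : ℂ} (h : LargeRegion α α' b b' x) (n : ℕ) :
    ∑ p ∈ antidiagonal n, (n.choose p.1 : ℂ) * ((-1) ^ p.1 *
      ∑' j : ℤ, gamProd α α' b b' j * (((j - (p.1 : ℤ) : ℤ) : ℂ) - x)⁻¹) =
      -((n.factorial : ℂ) * Complex.Gamma (α + α' + b + b' - 2 + n) / Complex.sin (Real.pi * x) *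
        (closedBlock n α α' b b' x + closedBlock n α' α b b' x)) := by
  have hσpos : 0 < (α + α' + b + b' - 2).re := by linarith [h.re_pos]
  have hσpos' : 0 < (α' + α + b + b' - 2).re := by rwa [add_comm α' α]
  have hu : NonInt (x + 1 - α) := by
    have := h.nonInt_x_sub_fst.add_int 1; push_cast at this; convert this using 1; ring
  have hu' : NonInt (x + 1 - α') := by
    have := h.nonInt_x_sub_snd.add_int 1; push_cast at this; convert this using 1; ring
  have c1 := sum_choose_tsum_blockCoef h.nonInt_sub hu hσpos n
  have c2 := sum_choose_tsum_blockCoef h.nonInt_sub' hu' hσpos' n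
  rw [tsum_blockCoef_mul_inv h.nonInt_sub h.nonInt_x_sub_fst hσpos] at c1
  rw [tsum_blockCoef_mul_inv h.nonInt_sub' h.nonInt_x_sub_snd hσpos', add_comm α' α] at c2
  have s1 := sin_mul_Gamma_eq h.nonInt_x_sub_fst
  have s2 := sin_mul_Gamma_eq h.nonInt_x_sub_snd
  have hpi := mul_inv_cancel₀ pi_ne_zero'
  have split : ∀ (k1 k2 : ℂ) (f1 f2 : ℕ → ℂ),
      ∑ p ∈ antidiagonal n, (n.choose p.1 : ℂ) * ((-1) ^ p.1 * (k1 * f1 p.1 + k2 * f2 p.1)) =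
        k1 * ∑ p ∈ antidiagonal n, (n.choose p.1 : ℂ) * ((-1) ^ p.1 * f1 p.1) +
        k2 * ∑ p ∈ antidiagonal n, (n.choose p.1 : ℂ) * ((-1) ^ p.1 * f2 p.1) := by
    intro k1 k2 f1 f2
    rw [mul_sum, mul_sum, ← sum_add_distrib]
    refine sum_congr rfl fun p _ => ?_
    ring
  simp_rw [(h.cauchy_gamProd_add_nat _).2]
  rw [split _ _ (fun i => ∑' m : ℕ, blockCoef α α' b b' m * (x + 1 - α + m + i)⁻¹)
    (fun i => ∑' m : ℕ, blockCoef α' α b b' m * (x + 1 - α' + m + i)⁻¹), c1, c2, closedBlock,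
    closedBlock, mul_inv, div_eq_mul_inv]
  generalize Complex.Gamma (x + 1 - α) = A1 at *
  generalize Complex.Gamma (x + 1 - α') = A2 at *
  generalize rG (α - x) = B1 at *
  generalize rG (α' - x) = B2 at *
  generalize Complex.sin (Real.pi * (x - α)) = t1 at *
  generalize Complex.sin (Real.pi * (x - α')) = t2 at *
  generalize reg3F2 _ = F1
  generalize reg3F2 _ = F2
  generalize (Complex.sin (Real.pi * x))⁻¹ = sx
  generalize Complex.Gamma (α + α' + b + b' - 2 + n) = G
  have key : ∀ (f s' g g1 r r' F pi ipi s t A B : ℂ), s * A = -(pi * B) → pi * ipi = 1 →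
      ipi * t * (s' * s * (g1 * r * r')) * (f * (g * A * G * F)) =
      -(f * G * t * (s' * (g1 * g) * (r * r' * B) * F)) := by
    intro f s' g g1 r r' F pi ipi s t A B h1 h2
    linear_combination (ipi * t * s' * g1 * r * r' * f * g * G * F) * h1 -
      (t * s' * g1 * r * r' * f * g * G * F * B) * h2
  rw [mul_add, neg_add]
  congr 1
  · rw [key _ _ _ _ _ _ _ _ _ _ _ _ _ s1 hpi]
  · rw [key _ _ _ _ _ _ _ _ _ _ _ _ _ s2 hpi]

open Finset in
theorem LargeRegion.cauchy_orthPoly {α α' b b' x : ℂ} (h : LargeRegion α α' b b' x) (n : ℕ) :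
    HasSum (fun j : ℤ => orthPoly n α α' b b' j * gamProd α α' (b + n) (b' + n) j * ((j : ℂ) - x)⁻¹)
      (-((n.factorial : ℂ) * Complex.Gamma (α + α' + b + b' - 2) / Complex.sin (Real.pi * x) *
        (closedBlock n α α' b b' x + closedBlock n α' α b b' x))) := by
  have hσ := h.ne_neg_nat
  have hsum := hasSum_orthPoly_mul n hσ (g := fun j => ((j : ℂ) - x)⁻¹)
    (fun i _ => (h.cauchy_gamProd_add_nat i).1)
  rw [h.sum_cauchy_gamProd] at hsum
  have hp := poch_ne_zero hσ n
  have hfin := hsum.mul_left (poch (α + α' + b + b' - 2) n)⁻¹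
  rw [Gamma_add_nat hσ] at hfin
  have e1 : (fun j : ℤ => (poch (α + α' + b + b' - 2) n)⁻¹ * (poch (α + α' + b + b' - 2) n *
      (orthPoly n α α' b b' j * gamProd α α' (b + n) (b' + n) j) * ((j : ℂ) - x)⁻¹)) =
      fun j : ℤ => orthPoly n α α' b b' j * gamProd α α' (b + n) (b' + n) j * ((j : ℂ) - x)⁻¹ :=
    funext fun j => by field_simp
  rw [e1] at hfin
  have e2 : ∀ (q f G s K : ℂ), q ≠ 0 → q⁻¹ * -(f * (q * G) / s * K) = -(f * G / s * K) := by
    intro q f G s K hq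
    rw [mul_neg, ← mul_assoc, mul_left_comm f q, mul_div_assoc, ← mul_assoc,
      inv_mul_cancel₀ hq, one_mul]
  rwa [e2 _ _ _ _ _ hp] at hfin

/-! ### The bilateral summation formula of Dougall -/

theorem LargeRegion.tsum_gamProd {α α' b b' x : ℂ} (h : LargeRegion α α' b b' x) :
    ∑' j : ℤ, gamProd α α' b b' j = Complex.Gamma (α + α' + b + b' - 3) *
      (rG (α + b - 1) * rG (α + b' - 1) * rG (α' + b - 1) * rG (α' + b' - 1)) := by
  have hb := h.nonInt_b
  have n1 : NonInt (1 - b) := by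
    have := hb.neg.add_int 1; push_cast at this; convert this using 1; ring
  have n2 : NonInt (1 - b - α) := by
    have := h.nonInt_fst_add.neg.add_int 1; push_cast at this; convert this using 1; ring
  have n3 : NonInt (1 - b - α') := by
    have := h.nonInt_snd_add.neg.add_int 1; push_cast at this; convert this using 1; ring
  have hαα' : NonInt (α' - α) := by have := h.nonInt_sub.neg; rwa [neg_sub] at this
  have hpos := h.re_pos
  have e1 : ∀ j : ℤ, gamProd α α' (b - 1) b' j * ((j : ℂ) - (1 - b))⁻¹ = gamProd α α' b b' j := by
    intro j
    have : (j : ℂ) - (1 - b) ≠ 0 := sub_ne_zero.mpr (n1 j).symm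
    rw [gamProd, gamProd, rG_eq_mul (b - 1 + j), show b - 1 + (j : ℂ) + 1 = b + j by ring,
      show b - 1 + (j : ℂ) = j - (1 - b) by ring]
    field_simp
  have hC := (cauchy_gamProd (b := b - 1) (b' := b') (x := 1 - b) (by linarith [h.two_lt])
    (by have := h.two_lt'; simp only [Complex.sub_re, Complex.add_re, Complex.one_re] at *; linarith)
    h.nonInt_fst h.nonInt_snd h.nonInt_sub n1 n2 n3).2
  rw [tsum_congr e1] at hC
  have block : ∀ {α α' : ℂ}, NonInt (α - α') → NonInt (α + b) → 4 < (α + α' + b + b' - 2).re →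
      rG (α + (b - 1) - 1) * ∑' m : ℕ, blockCoef α α' (b - 1) b' m * (1 - b + 1 - α + m)⁻¹ =
      -(rG (α + b - 1) * (Complex.Gamma (1 + α' - α) * Complex.Gamma (α + α' + b + b' - 3) *
        (rG (α' + b - 1) * rG (α' + b' - 1)))) := by
    intro α α' hαα hαb hpos
    have hv : NonInt (2 - α - b) := by
      have := hαb.neg.add_int 2; push_cast at this; convert this using 1; ring
    have hv0 : 2 - α - b ≠ 0 := by simpa using hv 0
    have hE : ∀ k : ℕ, 1 + α' - α ≠ -(k : ℂ) := fun k hk =>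
      hαα (k + 1) (by push_cast; linear_combination -hk)
    have g1 := Gamma_mul_rG hE
    have hg := tsum_gaussTerm (a := 2 - α - b) (b := 2 - α - b') (c := 1 + α' - α) (by
      simp only [Complex.sub_re, Complex.add_re, Complex.one_re, Complex.re_ofNat] at *; linarith)
    rw [show 1 + α' - α - (2 - α - b) - (2 - α - b') = α + α' + b + b' - 3 by ring,
      show 1 + α' - α - (2 - α - b) = α' + b - 1 by ring,
      show 1 + α' - α - (2 - α - b') = α' + b' - 1 by ring] at hg
    have e2 : ∀ m : ℕ, blockCoef α α' (b - 1) b' m * (1 - b + 1 - α + m)⁻¹ =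
        (2 - α - b)⁻¹ * Complex.Gamma (1 + α' - α) * gaussTerm (2 - α - b) (2 - α - b') (1 + α' - α) m := by
      intro m
      have hm : 2 - α - b + m ≠ 0 := fun h0 => hv (-m) (by push_cast; linear_combination h0)
      have n1 := poch_ne_zero hE m
      have hfac : (m.factorial : ℂ) ≠ 0 := by exact_mod_cast m.factorial_ne_zero
      have hp : (2 - α - b) * poch (2 - α - b + 1) m = poch (2 - α - b) m * (2 - α - b + m) := by
        rw [← poch_succ, poch_succ_left]
      rw [rG_eq_poch_mul _ m] at g1
      rw [blockCoef, gaussTerm, show 2 - α - (b - 1) = 2 - α - b + 1 by ring,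
        show 1 - b + 1 - α + (m : ℂ) = 2 - α - b + m by ring]
      field_simp
      linear_combination (poch (2 - α - b') m) * hp -
        (poch (2 - α - b') m * poch (2 - α - b) m * (2 - α - b + m)) * g1
    rw [tsum_congr e2, tsum_mul_left, hg, show α + (b - 1) - 1 = α + b - 2 by ring,
      rG_eq_mul (α + b - 2), show α + b - 2 + 1 = α + b - 1 by ring]
    field_simp
    ring
  have B1 := block h.nonInt_sub h.nonInt_fst_add hpos
  have B2 := block hαα' h.nonInt_snd_add (by rwa [add_comm α' α])
  rw [add_comm α' α] at B2
  have R1 := Complex.Gamma_mul_Gamma_one_sub (α - α')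
  have R2 := Complex.Gamma_mul_Gamma_one_sub (α' - α)
  rw [show 1 - (α - α') = 1 + α' - α by ring] at R1
  rw [show 1 - (α' - α) = 1 + α - α' by ring, show α' - α = -(α - α') by ring, mul_neg,
    Complex.sin_neg, show -(α - α') = α' - α by ring] at R2
  have s1 := sin_pi_ne_zero n1
  have s2 := sin_pi_ne_zero h.nonInt_sub
  have hpi := pi_ne_zero'
  have trig : Complex.sin (Real.pi * α) * Complex.sin (Real.pi * (1 - b - α')) -
      Complex.sin (Real.pi * α') * Complex.sin (Real.pi * (1 - b - α)) =
      Complex.sin (Real.pi * (1 - b)) * Complex.sin (Real.pi * (α - α')) := by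
    rw [mul_sub (Real.pi : ℂ) (1 - b), mul_sub (Real.pi : ℂ) (1 - b), mul_sub (Real.pi : ℂ) α,
      Complex.sin_sub, Complex.sin_sub, Complex.sin_sub]
    ring
  rw [hC]
  have T1 : Complex.sin (Real.pi * α') * Complex.sin (Real.pi * (1 - b - α)) *
      (Complex.Gamma (α - α') * rG (α + (b - 1) - 1) * rG (α + b' - 1)) *
      ∑' m : ℕ, blockCoef α α' (b - 1) b' m * (1 - b + 1 - α + m)⁻¹ =
      -(Complex.sin (Real.pi * α') * Complex.sin (Real.pi * (1 - b - α)) *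
        (Real.pi / Complex.sin (Real.pi * (α - α'))) * (Complex.Gamma (α + α' + b + b' - 3) *
        (rG (α + b - 1) * rG (α + b' - 1) * rG (α' + b - 1) * rG (α' + b' - 1)))) := by
    rw [← R1]
    linear_combination (Complex.sin (Real.pi * α') * Complex.sin (Real.pi * (1 - b - α)) *
      Complex.Gamma (α - α') * rG (α + b' - 1)) * B1
  have T2 : Complex.sin (Real.pi * α) * Complex.sin (Real.pi * (1 - b - α')) *
      (Complex.Gamma (α' - α) * rG (α' + (b - 1) - 1) * rG (α' + b' - 1)) *
      ∑' m : ℕ, blockCoef α' α (b - 1) b' m * (1 - b + 1 - α' + m)⁻¹ =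
      -(Complex.sin (Real.pi * α) * Complex.sin (Real.pi * (1 - b - α')) *
        (Real.pi / -Complex.sin (Real.pi * (α - α'))) * (Complex.Gamma (α + α' + b + b' - 3) *
        (rG (α + b - 1) * rG (α + b' - 1) * rG (α' + b - 1) * rG (α' + b' - 1)))) := by
    rw [← R2]
    linear_combination (Complex.sin (Real.pi * α) * Complex.sin (Real.pi * (1 - b - α')) *
      Complex.Gamma (α' - α) * rG (α' + b' - 1)) * B2
  rw [T1, T2]
  field_simp
  linear_combination (Complex.Gamma (α + α' + b + b' - 3) * rG (α + b - 1) * rG (α + b' - 1) *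
    rG (α' + b - 1) * rG (α' + b' - 1)) * trig

/-! ### Sums of the orthogonal polynomials against polynomials -/

open Finset in
theorem sum_choose_mul_eval {q : Polynomial ℂ} {n : ℕ} (hq : q.natDegree ≤ n) (y : ℂ) :
    ∑ p ∈ antidiagonal n, (n.choose p.1 : ℂ) * ((-1) ^ p.1 * q.eval (y - p.1)) =
      (n.factorial : ℂ) * q.coeff n := by
  have h1 : (fwdDiff 1)^[n] q.eval (y - n) = (n.factorial : ℂ) * q.coeff n := by
    rcases hq.lt_or_eq with h | rfl
    · rw [Polynomial.fwdDiff_iter_eq_zero_of_degree_lt h, Polynomial.coeff_eq_zero_of_natDegree_lt h]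
      simp
    · rw [Polynomial.fwdDiff_iter_degree_eq_factorial]
      simp [mul_comm]
  rw [← h1, fwdDiff_iter_eq_sum_shift, ← Nat.sum_antidiagonal_swap,
    Nat.sum_antidiagonal_eq_sum_range_succ_mk]
  refine sum_congr rfl fun k hk => ?_
  have hk' : k ≤ n := Nat.lt_succ_iff.mp (mem_range.mp hk)
  simp only [Prod.swap_prod_mk, nsmul_eq_mul, mul_one, zsmul_eq_mul]
  rw [Nat.choose_symm hk', Nat.cast_sub hk', show y - ((n : ℂ) - k) = y - n + k by ring]
  push_cast
  ring

theorem exists_norm_eval_le {q : Polynomial ℂ} {n : ℕ} (hq : q.natDegree ≤ n) :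
    ∃ C : ℝ, 0 < C ∧ ∀ j : ℤ, ‖q.eval (j : ℂ)‖ ≤ C * (|(j : ℝ)| + 1) ^ (n : ℝ) := by
  refine ⟨1 + ∑ i ∈ Finset.range (n + 1), ‖q.coeff i‖, by positivity, fun j => ?_⟩
  have h1 : 1 ≤ |(j : ℝ)| + 1 := by linarith [abs_nonneg (j : ℝ)]
  rw [Polynomial.eval_eq_sum_range' (Nat.lt_succ_of_le hq), Real.rpow_natCast, add_mul, one_mul,
    Finset.sum_mul]
  refine (norm_sum_le _ _).trans ((Finset.sum_le_sum fun i hi => ?_).trans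
    (le_add_of_nonneg_left (by positivity)))
  have hi' : i ≤ n := Nat.lt_succ_iff.mp (Finset.mem_range.mp hi)
  rw [norm_mul, norm_pow, Complex.norm_intCast]
  gcongr
  calc |(j : ℝ)| ^ i ≤ (|(j : ℝ)| + 1) ^ i := by gcongr; linarith
    _ ≤ _ := pow_le_pow_right₀ h1 hi'

open Finset in
theorem hasSum_orthPoly_mul_eval {n : ℕ} {α α' b b' : ℂ}
    (hσ : ∀ k : ℕ, α + α' + b + b' - 2 ≠ -(k : ℂ)) (hr : n + 3 < (α + α' + b + b').re)
    {q : Polynomial ℂ} (hq : q.natDegree ≤ n) :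
    HasSum (fun j : ℤ => orthPoly n α α' b b' j * gamProd α α' (b + n) (b' + n) j * q.eval (j : ℂ))
      ((poch (α + α' + b + b' - 2) n)⁻¹ *
        ((n.factorial : ℂ) * q.coeff n * ∑' j : ℤ, gamProd α α' b b' j)) := by
  have hs : ∀ i : ℕ, Summable fun j : ℤ => gamProd α α' b b' j * q.eval (((j - i : ℤ)) : ℂ) := by
    intro i
    obtain ⟨C, -, hC⟩ := exists_norm_eval_le (q := q.comp (Polynomial.X - Polynomial.C (i : ℂ)))
      (n := n) (by rw [Polynomial.natDegree_comp, Polynomial.natDegree_X_sub_C, mul_one]; exact hq)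
    refine (summable_gamProd_mul hC hr).congr fun j => ?_
    simp
  have hp := poch_ne_zero hσ n
  have h := (hasSum_orthPoly_mul n hσ (g := fun j => q.eval (j : ℂ)) (fun i _ => hs i)).mul_left
    (poch (α + α' + b + b' - 2) n)⁻¹
  have e1 : ∑ p ∈ antidiagonal n, (n.choose p.1 : ℂ) * ((-1) ^ p.1 *
      ∑' j : ℤ, gamProd α α' b b' j * q.eval (((j - p.1 : ℤ)) : ℂ)) =
      (n.factorial : ℂ) * q.coeff n * ∑' j : ℤ, gamProd α α' b b' j := by
    calc _ = ∑ p ∈ antidiagonal n, ∑' j : ℤ, (n.choose p.1 : ℂ) * ((-1) ^ p.1 *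
          (gamProd α α' b b' j * q.eval (((j - p.1 : ℤ)) : ℂ))) := by
          refine sum_congr rfl fun p _ => ?_
          rw [tsum_mul_left, tsum_mul_left]
      _ = ∑' j : ℤ, ∑ p ∈ antidiagonal n, (n.choose p.1 : ℂ) * ((-1) ^ p.1 *
          (gamProd α α' b b' j * q.eval (((j - p.1 : ℤ)) : ℂ))) :=
          (Summable.tsum_finsetSum fun p _ => ((hs p.1).mul_left _).mul_left _).symm
      _ = _ := by
          rw [← tsum_mul_left]
          refine tsum_congr fun j => ?_
          rw [← sum_choose_mul_eval hq j, sum_mul]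
          refine sum_congr rfl fun p _ => ?_
          push_cast
          ring
  have e2 : (fun j : ℤ => (poch (α + α' + b + b' - 2) n)⁻¹ * (poch (α + α' + b + b' - 2) n *
      (orthPoly n α α' b b' j * gamProd α α' (b + n) (b' + n) j) * q.eval (j : ℂ))) =
      fun j : ℤ => orthPoly n α α' b b' j * gamProd α α' (b + n) (b' + n) j * q.eval (j : ℂ) :=
    funext fun j => by field_simp
  rwa [e1, e2] at h

theorem LargeRegion.cauchy_eval_mul {α α' b b' x : ℂ} (h : LargeRegion α α' b b' x) {n : ℕ}
    (hr : n + 3 < (α + α' + b + b').re) {q : Polynomial ℂ} (hq : q.natDegree ≤ n + 1) :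
    HasSum (fun j : ℤ => q.eval (j : ℂ) *
        (orthPoly n α α' b b' j * gamProd α α' (b + n) (b' + n) j) * ((j : ℂ) - x)⁻¹)
      (q.eval x * -((n.factorial : ℂ) * Complex.Gamma (α + α' + b + b' - 2) /
          Complex.sin (Real.pi * x) * (closedBlock n α α' b b' x + closedBlock n α' α b b' x)) +
        q.coeff (n + 1) * ((n.factorial : ℂ) * (poch (α + α' + b + b' - 2) n)⁻¹ *
          (Complex.Gamma (α + α' + b + b' - 3) *
      (rG (α + b - 1) * rG (α + b' - 1) * rG (α' + b - 1) * rG (α' + b' - 1))))) := by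
  set r := q /ₘ (Polynomial.X - Polynomial.C x) with hrdef
  have hrdeg : r.natDegree ≤ n := by
    rw [hrdef, Polynomial.natDegree_divByMonic _ (Polynomial.monic_X_sub_C x),
      Polynomial.natDegree_X_sub_C]
    omega
  have hcoeff : r.coeff n = q.coeff (n + 1) := by
    rw [hrdef, Polynomial.coeff_divByMonic_X_sub_C]
    rcases hq.lt_or_eq with h | h
    · rw [Finset.Icc_eq_empty (by omega), Finset.sum_empty,
        Polynomial.coeff_eq_zero_of_natDegree_lt h]
    · rw [h, Finset.Icc_self, Finset.sum_singleton]
      simp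
  have hdiv : ∀ y : ℂ, q.eval y = q.eval x + (y - x) * r.eval y := by
    intro y
    have := congrArg (Polynomial.eval y)
      (Polynomial.modByMonic_add_div q (Polynomial.X - Polynomial.C x))
    rw [Polynomial.modByMonic_X_sub_C_eq_C_eval] at this
    simpa using this.symm
  have H := ((h.cauchy_orthPoly n).mul_left (q.eval x)).add
    (hasSum_orthPoly_mul_eval h.ne_neg_nat hr hrdeg)
  rw [hcoeff, h.tsum_gamProd] at H
  have e1 : ∀ j : ℤ, q.eval x * (orthPoly n α α' b b' j * gamProd α α' (b + n) (b' + n) j *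
      ((j : ℂ) - x)⁻¹) + orthPoly n α α' b b' j * gamProd α α' (b + n) (b' + n) j * r.eval (j : ℂ) =
      q.eval (j : ℂ) * (orthPoly n α α' b b' j * gamProd α α' (b + n) (b' + n) j) *
        ((j : ℂ) - x)⁻¹ := by
    intro j
    have hj : (j : ℂ) - x ≠ 0 := sub_ne_zero.mpr (h.nonInt_x j).symm
    rw [hdiv j]
    field_simp
  simp_rw [e1] at H
  rwa [mul_assoc (n.factorial : ℂ), mul_left_comm (poch _ n)⁻¹,
    mul_left_comm (poch _ n)⁻¹ (q.coeff _), mul_left_comm (n.factorial : ℂ) (q.coeff _),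
    ← mul_assoc (n.factorial : ℂ)] at H

/-! ### Regularity of the Cauchy transforms -/

/-- The monic polynomial of degree `N` with the zeros `0, 1, …, N - 1`. -/
noncomputable def innerPoly (N : ℕ) : Polynomial ℂ :=
  (ascPochhammer ℂ N).comp (Polynomial.X - Polynomial.C ((N : ℂ) - 1))

theorem eval_innerPoly (N : ℕ) (x : ℂ) : (innerPoly N).eval x = poch (x - ((N : ℂ) - 1)) N := by
  rw [innerPoly, Polynomial.eval_comp, poch]
  simp

theorem natDegree_innerPoly (N : ℕ) : (innerPoly N).natDegree = N := by
  rw [innerPoly, Polynomial.natDegree_comp, Polynomial.natDegree_X_sub_C, mul_one,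
    ascPochhammer_natDegree]

theorem coeff_innerPoly (N : ℕ) : (innerPoly N).coeff N = 1 := by
  have h : (innerPoly N).Monic := (monic_ascPochhammer ℂ N).comp_X_sub_C _
  rw [Polynomial.Monic, Polynomial.leadingCoeff, natDegree_innerPoly] at h
  exact h

theorem eval_innerPoly_eq_zero_iff (N : ℕ) (x : ℂ) :
    (innerPoly N).eval x = 0 ↔ ∃ k < N, x = (k : ℂ) := by
  rw [eval_innerPoly, poch, ascPochhammer_eval_eq_zero_iff]
  constructor
  · rintro ⟨k, hk, h⟩
    refine ⟨N - 1 - k, by omega, ?_⟩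
    rw [Nat.cast_sub (by omega), Nat.cast_sub (by omega), h]
    push_cast
    ring
  · rintro ⟨k, hk, h⟩
    refine ⟨N - 1 - k, by omega, ?_⟩
    rw [Nat.cast_sub (by omega), Nat.cast_sub (by omega), h]
    push_cast
    ring

/-- The complement of the set of poles of the Cauchy transforms. -/
def regularSet (N : ℕ) : Set ℂ := {x | ∀ j : ℤ, (innerPoly N).eval (j : ℂ) ≠ 0 → x ≠ j}

theorem isOpen_regularSet (N : ℕ) : IsOpen (regularSet N) := by
  have h : regularSet N = (((↑) : ℤ → ℂ) '' {j | (innerPoly N).eval (j : ℂ) ≠ 0})ᶜ := by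
    ext x
    simp only [regularSet, Set.mem_ofPred_eq, Set.mem_compl_iff, Set.mem_image, not_exists, not_and]
    exact forall₂_congr fun j _ => ⟨fun h h' => h h'.symm, fun h h' => h h'.symm⟩
  rw [h]
  exact (Complex.isClosedEmbedding_intCast.isClosedMap _ (isClosed_discrete _)).isOpen_compl

theorem NonInt.mem_regularSet {x : ℂ} (h : NonInt x) (N : ℕ) : x ∈ regularSet N := fun j _ => h j

theorem exists_mul_le_norm_of_mem_regularSet {N : ℕ} {x : ℂ} (hx : x ∈ regularSet N) :
    ∃ c : ℝ, 0 < c ∧ ∀ y : ℂ, ‖y - x‖ ≤ c → ∀ j : ℤ, (innerPoly N).eval (j : ℂ) ≠ 0 →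
      c * (|(j : ℝ)| + 1) ≤ ‖(j : ℂ) - y‖ := by
  obtain ⟨c, hc, h⟩ := exists_mul_abs_le_norm_int_sub x
  refine ⟨c / 2, by positivity, fun y hy j hj => ?_⟩
  have h1 := h j (hx j hj).symm
  have h2 : ‖(j : ℂ) - x‖ ≤ ‖(j : ℂ) - y‖ + ‖y - x‖ := norm_sub_le_norm_sub_add_norm_sub _ _ _
  have h3 : c / 2 ≤ c / 2 * (|(j : ℝ)| + 1) :=
    le_mul_of_one_le_right (by positivity) (by linarith [abs_nonneg (j : ℝ)])
  linarith

/-- A term of the Cauchy transform of the weight. -/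
noncomputable def cauchyTerm (N : ℕ) (j : ℤ) (p : ℂ × ℂ × ℂ × ℂ × ℂ) : ℂ :=
  (innerPoly N).eval (j : ℂ) * gamProd p.1 p.2.1 p.2.2.1 p.2.2.2.1 j * ((j : ℂ) - p.2.2.2.2)⁻¹

/-- The points at which the sums of `cauchyTerm` converge. -/
def cauchyDomain (N : ℕ) : Set (ℂ × ℂ × ℂ × ℂ × ℂ) :=
  {p | (N : ℝ) + 2 < (p.1 + p.2.1 + p.2.2.1 + p.2.2.2.1).re} ∩
    (fun p => p.2.2.2.2) ⁻¹' regularSet N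

theorem isOpen_cauchyDomain (N : ℕ) : IsOpen (cauchyDomain N) :=
  (isOpen_lt continuous_const (by fun_prop)).inter ((isOpen_regularSet N).preimage (by fun_prop))

theorem exists_cauchyTerm_le {N : ℕ} {p : ℂ × ℂ × ℂ × ℂ × ℂ} (hp : p ∈ cauchyDomain N) :
    ∃ t ∈ 𝓝 p, ∃ u : ℤ → ℝ, Summable u ∧ ∀ j, ∀ y ∈ t, ‖cauchyTerm N j y‖ ≤ u j := by
  obtain ⟨hA, hx⟩ := hp
  rw [Set.mem_ofPred_eq] at hA
  obtain ⟨c, hc, H1⟩ := exists_mul_le_norm_of_mem_regularSet hx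
  obtain ⟨C2, hC2, H2⟩ := exists_norm_eval_le (natDegree_innerPoly N).le
  obtain ⟨C3, hC3, H3⟩ := exists_norm_gamProd_le (‖p‖ + 1)
  obtain ⟨r, hr1, hr2⟩ := exists_between hA
  refine ⟨{y | ‖y‖ < ‖p‖ + 1} ∩ {y | r < (y.1 + y.2.1 + y.2.2.1 + y.2.2.2.1).re} ∩
    {y | ‖y.2.2.2.2 - p.2.2.2.2‖ < c}, ?_, fun j => C2 * C3 * c⁻¹ * (|(j : ℝ)| + 1) ^ (N + 1 - r),
    (summable_int_abs_add_one_rpow (by linarith)).mul_left _, ?_⟩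
  · refine inter_mem (inter_mem ?_ ?_) ?_
    · exact (isOpen_lt (by fun_prop) (by fun_prop)).mem_nhds (by simp)
    · exact (isOpen_lt (by fun_prop) (by fun_prop)).mem_nhds hr2
    · exact (isOpen_lt (by fun_prop) (by fun_prop)).mem_nhds (by simpa using hc)
  · rintro j ⟨α, α', b, b', x⟩ ⟨⟨h1, h2⟩, h3⟩
    simp only [Set.mem_ofPred_eq] at h1 h2 h3
    have hj : (0 : ℝ) < |(j : ℝ)| + 1 := by positivity
    have hj1 : (1 : ℝ) ≤ |(j : ℝ)| + 1 := by linarith [abs_nonneg (j : ℝ)]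
    rw [cauchyTerm]
    by_cases h0 : (innerPoly N).eval (j : ℂ) = 0
    · rw [h0, zero_mul, zero_mul, norm_zero]
      positivity
    · have n0 := norm_fst_le (α, α', b, b', x)
      have n1 := norm_snd_le (α, α', b, b', x)
      have n2 := norm_fst_le (α', b, b', x)
      have n3 := norm_snd_le (α', b, b', x)
      have n4 := norm_fst_le (b, b', x)
      have n5 := norm_snd_le (b, b', x)
      have n6 := norm_fst_le (b', x)
      simp only at n0 n1 n2 n3 n4 n5 n6
      have hg := H3 α α' b b' (by linarith) (by linarith) (by linarith) (by linarith) j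
      have hg' : ‖gamProd α α' b b' j‖ ≤ C3 * (|(j : ℝ)| + 1) ^ (2 - r) :=
        hg.trans (by gcongr)
      have hinv : ‖((j : ℂ) - x)⁻¹‖ ≤ c⁻¹ * (|(j : ℝ)| + 1) ^ (-1 : ℝ) := by
        rw [norm_inv, Real.rpow_neg_one, ← mul_inv]
        exact inv_anti₀ (by positivity) (H1 x h3.le j h0)
      beta_reduce
      rw [norm_mul, norm_mul, show (N : ℝ) + 1 - r = N + (2 - r) + -1 by ring, Real.rpow_add hj,
        Real.rpow_add hj]
      calc _ ≤ (C2 * (|(j : ℝ)| + 1) ^ (N : ℝ)) * (C3 * (|(j : ℝ)| + 1) ^ (2 - r)) *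
            (c⁻¹ * (|(j : ℝ)| + 1) ^ (-1 : ℝ)) := by
            gcongr
            exact H2 j
        _ = _ := by ring

theorem summable_cauchyTerm {N : ℕ} {p : ℂ × ℂ × ℂ × ℂ × ℂ} (hp : p ∈ cauchyDomain N) :
    Summable fun j => cauchyTerm N j p := by
  obtain ⟨t, ht, u, hu, h⟩ := exists_cauchyTerm_le hp
  exact Summable.of_norm_bounded hu fun j => h j p (mem_of_mem_nhds ht)

theorem differentiableOn_cauchyTerm (N : ℕ) (j : ℤ) :
    DifferentiableOn ℂ (cauchyTerm N j) (cauchyDomain N) := by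
  by_cases h0 : (innerPoly N).eval (j : ℂ) = 0
  · have : cauchyTerm N j = fun _ => 0 := by
      funext p; rw [cauchyTerm, h0, zero_mul, zero_mul]
    rw [this]
    exact differentiableOn_const 0
  · unfold cauchyTerm gamProd
    refine DifferentiableOn.mul (Differentiable.differentiableOn (by fun_prop))
      (DifferentiableOn.inv (by fun_prop) fun p hp => ?_)
    exact sub_ne_zero.mpr (hp.2 j h0).symm

theorem differentiableOn_tsum_cauchyTerm (N : ℕ) :
    DifferentiableOn ℂ (fun p => ∑' j, cauchyTerm N j p) (cauchyDomain N) :=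
  differentiableOn_tsum_of_locally_le (isOpen_cauchyDomain N) (differentiableOn_cauchyTerm N)
    fun _ hp => exists_cauchyTerm_le hp

/-- A term of the Cauchy transform of an orthogonal polynomial. -/
noncomputable def orthTerm (N n : ℕ) (j : ℤ) (p : ℂ × ℂ × ℂ × ℂ × ℂ) : ℂ :=
  (innerPoly N).eval (j : ℂ) * (orthPoly n p.1 p.2.1 (p.2.2.1 - n) (p.2.2.2.1 - n) j *
    gamProd p.1 p.2.1 p.2.2.1 p.2.2.2.1 j) * ((j : ℂ) - p.2.2.2.2)⁻¹

/-- The Cauchy transform of an orthogonal polynomial. -/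
noncomputable def orthTransform (N n : ℕ) (p : ℂ × ℂ × ℂ × ℂ × ℂ) : ℂ := ∑' j, orthTerm N n j p

/-- A domain of holomorphy for `orthTransform`. -/
def orthDomain (N n : ℕ) : Set (ℂ × ℂ × ℂ × ℂ × ℂ) :=
  {p | 2 * (n : ℝ) + 2 < (p.1 + p.2.1 + p.2.2.1 + p.2.2.2.1).re} ∩
    {p | (N : ℝ) + n + 2 < (p.1 + p.2.1 + p.2.2.1 + p.2.2.2.1).re} ∩
    (fun p => p.2.2.2.2) ⁻¹' regularSet N

theorem isOpen_orthDomain (N n : ℕ) : IsOpen (orthDomain N n) :=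
  ((isOpen_lt continuous_const (by fun_prop)).inter
    (isOpen_lt continuous_const (by fun_prop))).inter
    ((isOpen_regularSet N).preimage (by fun_prop))

/-- The coefficients in the expansion of `orthTerm` into `cauchyTerm`. -/
noncomputable def orthCoef (n k : ℕ) (p : ℂ × ℂ × ℂ × ℂ × ℂ) : ℂ :=
  poch (-(n : ℂ)) k * poch (p.1 + (p.2.2.2.1 - n) - 1) k *
    poch (p.2.1 + (p.2.2.2.1 - n) - 1) k / ((k.factorial : ℂ) *
      poch (p.1 + p.2.1 + (p.2.2.1 - n) + (p.2.2.2.1 - n) - 2) k)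

theorem orthTerm_eq (N n : ℕ) (j : ℤ) (p : ℂ × ℂ × ℂ × ℂ × ℂ) :
    orthTerm N n j p = ∑ k ∈ Finset.range (n + 1), orthCoef n k p *
      cauchyTerm N j (p.1, p.2.1, p.2.2.1, p.2.2.2.1 - n + k, p.2.2.2.2) := by
  obtain ⟨α, α', b, b', x⟩ := p
  simp only [orthTerm, orthPoly, gammaTerm3F2]
  rw [Finset.sum_mul, Finset.mul_sum, Finset.sum_mul]
  refine Finset.sum_congr rfl fun k hk => ?_
  have hk' : k ≤ n := Nat.lt_succ_iff.mp (Finset.mem_range.mp hk)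
  have h := rG_eq_poch_mul (b' - n + k + j) (n - k)
  rw [Nat.cast_sub hk', show b' - n + k + (j : ℂ) + (n - k) = b' + j by ring,
    show b' - n + k + (j : ℂ) = j + (b' - n) + k by ring] at h
  simp only [orthCoef, cauchyTerm, gamProd]
  rw [show b' - n + k + (j : ℂ) = j + (b' - n) + k by ring, h]
  ring

theorem mem_cauchyDomain_of_mem_orthDomain {N n : ℕ} {p : ℂ × ℂ × ℂ × ℂ × ℂ}
    (hp : p ∈ orthDomain N n) (k : ℕ) :
    (p.1, p.2.1, p.2.2.1, p.2.2.2.1 - n + k, p.2.2.2.2) ∈ cauchyDomain N := by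
  obtain ⟨⟨-, h⟩, hx⟩ := hp
  refine ⟨?_, hx⟩
  rw [Set.mem_ofPred_eq] at *
  have : (0 : ℝ) ≤ k := Nat.cast_nonneg k
  simp only [Complex.add_re, Complex.sub_re, Complex.natCast_re] at *
  linarith

theorem summable_orthTerm {N n : ℕ} {p : ℂ × ℂ × ℂ × ℂ × ℂ} (hp : p ∈ orthDomain N n) :
    Summable fun j => orthTerm N n j p := by
  simp_rw [orthTerm_eq]
  exact summable_sum fun k _ =>
    (summable_cauchyTerm (mem_cauchyDomain_of_mem_orthDomain hp k)).mul_left _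

theorem differentiableOn_orthTransform (N n : ℕ) :
    DifferentiableOn ℂ (orthTransform N n) (orthDomain N n) := by
  have h : ∀ p ∈ orthDomain N n, orthTransform N n p =
      ∑ k ∈ Finset.range (n + 1), orthCoef n k p *
        ∑' j, cauchyTerm N j (p.1, p.2.1, p.2.2.1, p.2.2.2.1 - n + k, p.2.2.2.2) := by
    intro p hp
    rw [orthTransform, tsum_congr fun j => orthTerm_eq N n j p, Summable.tsum_finsetSum fun k _ =>
      (summable_cauchyTerm (mem_cauchyDomain_of_mem_orthDomain hp k)).mul_left _]
    exact Finset.sum_congr rfl fun k _ => tsum_mul_left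
  refine DifferentiableOn.congr ?_ h
  refine DifferentiableOn.fun_sum fun k _ => DifferentiableOn.mul ?_ ?_
  · unfold orthCoef
    have h1 : Differentiable ℂ fun p : ℂ × ℂ × ℂ × ℂ × ℂ => poch (-(n : ℂ)) k *
      poch (p.1 + (p.2.2.2.1 - n) - 1) k * poch (p.2.1 + (p.2.2.2.1 - n) - 1) k := by fun_prop
    have h2 : Differentiable ℂ fun p : ℂ × ℂ × ℂ × ℂ × ℂ => (k.factorial : ℂ) *
      poch (p.1 + p.2.1 + (p.2.2.1 - n) + (p.2.2.2.1 - n) - 2) k := by fun_prop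
    simp_rw [div_eq_mul_inv]
    refine h1.differentiableOn.mul (h2.differentiableOn.inv fun p hp => mul_ne_zero
      (Nat.cast_ne_zero.mpr k.factorial_ne_zero) (poch_ne_zero (ne_neg_nat_of_re_pos ?_) k))
    have := hp.1.1
    rw [Set.mem_ofPred_eq] at this
    simp only [Complex.add_re, Complex.sub_re, Complex.natCast_re, Complex.re_ofNat] at *
    linarith
  · exact (differentiableOn_tsum_cauchyTerm N).comp (by fun_prop)
      fun p hp => mem_cauchyDomain_of_mem_orthDomain hp k

/-! ### Analytic continuation of the evaluation -/

theorem nonInt_of_im_ne_zero {x : ℂ} (h : x.im ≠ 0) : NonInt x := fun k hk => h (by simp [hk])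

/-- The value of the Cauchy transform of the orthogonal polynomial of degree `n`. -/
noncomputable def transformValue (N n : ℕ) (α α' b b' x : ℂ) : ℂ :=
  (innerPoly N).eval x * -((n.factorial : ℂ) * Complex.Gamma (α + α' + b + b' - 2) /
      Complex.sin (Real.pi * x) * (closedBlock n α α' b b' x + closedBlock n α' α b b' x)) +
    (innerPoly N).coeff (n + 1) * ((n.factorial : ℂ) * (poch (α + α' + b + b' - 2) n)⁻¹ *
      (Complex.Gamma (α + α' + b + b' - 3) *
        (rG (α + b - 1) * rG (α + b' - 1) * rG (α' + b - 1) * rG (α' + b' - 1))))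

theorem LargeRegion.orthTransform_eq {α α' b b' x : ℂ} (h : LargeRegion α α' b b' x) {N n : ℕ}
    (hN : N ≤ n + 1) (hr : n + 3 < (α + α' + b + b').re) :
    orthTransform N n (α, α', b + n, b' + n, x) = transformValue N n α α' b b' x := by
  have H := h.cauchy_eval_mul hr (q := innerPoly N) (by rw [natDegree_innerPoly]; exact hN)
  rw [transformValue, ← H.tsum_eq, orthTransform]
  simp only [orthTerm, add_sub_cancel_right]

theorem differentiable_closedBlock (n : ℕ) (α α' b b' x : ℂ) :
    Differentiable ℂ fun t => closedBlock n (α + t) (α' + t) (b + t) (b' + t) x := by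
  have e : (fun t => closedBlock n (α + t) (α' + t) (b + t) (b' + t) x) = fun t =>
      Complex.sin (Real.pi * (α' + t)) * (Complex.Gamma (α - α') * Complex.Gamma (1 + α' - α)) *
        (rG (α + t + (b + t) - 1) * rG (α + t + (b' + t) - 1) * rG (α + t - x)) *
        reg3F2 (2 - (α + t) - (b + t), α' + t + (b' + t) - 1, α' + t - x, 1 + α' - α,
          α' + t + (b' + t) + n) := by
    funext t
    rw [closedBlock, add_sub_add_right_eq_sub, show 1 + (α' + t) - (α + t) = 1 + α' - α by ring]
  rw [e]
  have h := differentiable_reg3F2.comp (f := fun t : ℂ => (2 - (α + t) - (b + t),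
    α' + t + (b' + t) - 1, α' + t - x, 1 + α' - α, α' + t + (b' + t) + n)) (by fun_prop)
  have h' : Differentiable ℂ fun t => reg3F2 (2 - (α + t) - (b + t), α' + t + (b' + t) - 1,
    α' + t - x, 1 + α' - α, α' + t + (b' + t) + n) := h
  fun_prop

theorem differentiableAt_Gamma_of_re_pos {s : ℂ} (h : 0 < s.re) :
    DifferentiableAt ℂ Complex.Gamma s :=
  Complex.differentiableAt_Gamma s (ne_neg_nat_of_re_pos h)

theorem DifferentiableOn.zwGamma {f : ℂ → ℂ} {s : Set ℂ} (hf : DifferentiableOn ℂ f s)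
    (h : ∀ t ∈ s, 0 < (f t).re) : DifferentiableOn ℂ (fun t => Complex.Gamma (f t)) s :=
  fun t ht => (differentiableAt_Gamma_of_re_pos (h t ht)).comp_differentiableWithinAt t (hf t ht)

theorem differentiableOn_transformValue {N n : ℕ} (hN : N ≤ n + 1) (α α' b b' x : ℂ) {s : Set ℂ}
    (h0 : ∀ t ∈ s, 0 < (α + t + (α' + t) + (b + t) + (b' + t) - 2).re)
    (h1 : ∀ t ∈ s, (N : ℝ) - n < (α + t + (α' + t) + (b + t) + (b' + t) - 2).re) :
    DifferentiableOn ℂ (fun t => transformValue N n (α + t) (α' + t) (b + t) (b' + t) x) s := by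
  unfold transformValue
  refine DifferentiableOn.add ?_ ?_
  · refine DifferentiableOn.const_mul (DifferentiableOn.neg (DifferentiableOn.mul
      (DifferentiableOn.div_const (DifferentiableOn.const_mul ?_ _) _) ?_)) _
    · exact DifferentiableOn.zwGamma (Differentiable.differentiableOn (by fun_prop)) h0
    · exact ((differentiable_closedBlock n α α' b b' x).add
        (differentiable_closedBlock n α' α b b' x)).differentiableOn
  · rcases hN.lt_or_eq with h | rfl
    · rw [Polynomial.coeff_eq_zero_of_natDegree_lt (by rwa [natDegree_innerPoly])]
      simp only [zero_mul]
      exact differentiableOn_const 0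
    · refine DifferentiableOn.const_mul (DifferentiableOn.mul (DifferentiableOn.const_mul
        (DifferentiableOn.inv (Differentiable.differentiableOn (by fun_prop)) fun t ht =>
          poch_ne_zero (ne_neg_nat_of_re_pos (h0 t ht)) n) _) (DifferentiableOn.mul
        (DifferentiableOn.zwGamma (Differentiable.differentiableOn (by fun_prop)) fun t ht => ?_)
        (Differentiable.differentiableOn (by fun_prop)))) _
      have := h1 t ht
      push_cast at this
      simp only [Complex.add_re, Complex.sub_re, Complex.re_ofNat] at *
      linarith

theorem orthTransform_eq {N n : ℕ} (hN : N ≤ n + 1) {α α' b b' x : ℂ}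
    (h0 : 0 < (α + α' + b + b' - 2).re) (h1 : (N : ℝ) - n < (α + α' + b + b' - 2).re)
    (hαα : NonInt (α - α')) (hx : NonInt x) :
    orthTransform N n (α, α', b + n, b' + n, x) = transformValue N n α α' b b' x := by
  set m : ℝ := max 0 ((N : ℝ) - n) with hm
  set s : Set ℂ := {t | (m - (α + α' + b + b' - 2).re) / 4 < t.re} with hs
  have hm0 : 0 ≤ m := le_max_left _ _
  have hm1 : (N : ℝ) - n ≤ m := le_max_right _ _
  have hso : IsOpen s := isOpen_lt continuous_const Complex.continuous_re
  have hsc : IsPreconnected s := (convex_halfSpace_re_gt _).isPreconnected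
  have key : ∀ t ∈ s, m < (α + t + (α' + t) + (b + t) + (b' + t) - 2).re := by
    intro t ht
    rw [hs, Set.mem_ofPred_eq] at ht
    simp only [Complex.add_re, Complex.sub_re, Complex.re_ofNat] at *
    linarith
  have hd : DifferentiableOn ℂ
      (fun t => orthTransform N n (α + t, α' + t, b + t + n, b' + t + n, x)) s := by
    refine (differentiableOn_orthTransform N n).comp
      (Differentiable.differentiableOn (by fun_prop)) fun t ht => ?_
    have := key t ht
    refine ⟨⟨?_, ?_⟩, hx.mem_regularSet N⟩ <;> rw [Set.mem_ofPred_eq] <;>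
    · simp only [Complex.add_re, Complex.sub_re, Complex.re_ofNat, Complex.natCast_re] at *
      linarith
  have hd' := differentiableOn_transformValue hN α α' b b' x
    (fun t ht => hm0.trans_lt (key t ht)) (fun t ht => hm1.trans_lt (key t ht))
  set T : ℝ := ‖α‖ + ‖α'‖ + ‖b‖ + ‖b'‖ + ‖x‖ + n + 3 + m with hT
  have r1 := abs_le.mp (Complex.abs_re_le_norm α)
  have r2 := abs_le.mp (Complex.abs_re_le_norm α')
  have r3 := abs_le.mp (Complex.abs_re_le_norm b)
  have r4 := abs_le.mp (Complex.abs_re_le_norm b')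
  have i1 := abs_le.mp (Complex.abs_im_le_norm α)
  have i2 := abs_le.mp (Complex.abs_im_le_norm α')
  have i3 := abs_le.mp (Complex.abs_im_le_norm b)
  have i4 := abs_le.mp (Complex.abs_im_le_norm b')
  have i5 := abs_le.mp (Complex.abs_im_le_norm x)
  have n1 := norm_nonneg α
  have n2 := norm_nonneg α'
  have n3 := norm_nonneg b
  have n4 := norm_nonneg b'
  have n5 := norm_nonneg x
  have n6 : (0 : ℝ) ≤ n := Nat.cast_nonneg n
  have large : ∀ t : ℂ, T < t.re → T < t.im →
      LargeRegion (α + t) (α' + t) (b + t) (b' + t) x := by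
    intro t ht1 ht2
    refine ⟨?_, ?_, nonInt_of_im_ne_zero (ne_of_gt ?_), nonInt_of_im_ne_zero (ne_of_gt ?_),
      by rwa [add_sub_add_right_eq_sub], hx, nonInt_of_im_ne_zero (ne_of_lt ?_),
      nonInt_of_im_ne_zero (ne_of_lt ?_), nonInt_of_im_ne_zero (ne_of_gt ?_),
      nonInt_of_im_ne_zero (ne_of_gt ?_), nonInt_of_im_ne_zero (ne_of_gt ?_)⟩ <;>
    · simp only [Complex.add_re, Complex.sub_re, Complex.one_re, Complex.add_im, Complex.sub_im]
      linarith
  have hev : ∀ t : ℂ, T < t.re → T < t.im →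
      orthTransform N n (α + t, α' + t, b + t + n, b' + t + n, x) =
        transformValue N n (α + t) (α' + t) (b + t) (b' + t) x := fun t ht1 ht2 =>
    (large t ht1 ht2).orthTransform_eq hN (by simp only [Complex.add_re]; linarith)
  set t₀ : ℂ := ⟨T + 1, T + 1⟩ with ht₀
  have hnhds : {t : ℂ | T < t.re} ∩ {t | T < t.im} ∈ 𝓝 t₀ :=
    ((isOpen_lt continuous_const Complex.continuous_re).inter
      (isOpen_lt continuous_const Complex.continuous_im)).mem_nhds
      ⟨by simp [ht₀], by simp [ht₀]⟩
  have ht₀s : t₀ ∈ s := by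
    rw [hs, Set.mem_ofPred_eq]
    simp only [ht₀, Complex.add_re, Complex.sub_re, Complex.re_ofNat]
    linarith
  have h0s : (0 : ℂ) ∈ s := by
    rw [hs, Set.mem_ofPred_eq, Complex.zero_re]
    have : m < (α + α' + b + b' - 2).re := max_lt h0 h1
    linarith
  have := (hd.analyticOnNhd hso).eqOn_of_preconnected_of_eventuallyEq (hd'.analyticOnNhd hso) hsc
    ht₀s (eventually_of_mem hnhds fun t ht => hev t ht.1 ht.2) h0s
  simpa using this

/-! ### Removal of the singularities at the inner points -/

theorem eval_innerPoly_div_sin (N : ℕ) {x : ℂ} (hx : NonInt x) :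
    (innerPoly N).eval x / Complex.sin (Real.pi * x) =
      (-1) ^ (N + 1) * (Complex.Gamma (x + 1) * Complex.Gamma (N - x)) / Real.pi := by
  have h1 : NonInt (x - ((N : ℂ) - 1)) := by
    have := hx.add_int (1 - N); push_cast at this; convert this using 1; ring
  have h2 := Gamma_add_nat h1.ne_neg_nat N
  rw [show x - ((N : ℂ) - 1) + N = x + 1 by ring] at h2
  have h3 := Complex.Gamma_mul_Gamma_one_sub (x - ((N : ℂ) - 1))
  rw [show 1 - (x - ((N : ℂ) - 1)) = N - x by ring] at h3
  have h4 : Complex.sin (Real.pi * (x - ((N : ℂ) - 1))) =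
      (-1) ^ (N + 1) * Complex.sin (Real.pi * x) := by
    have := Complex.sin_antiperiodic.sub_nat_mul_eq (x := Real.pi * x + Real.pi) N
    rw [Complex.sin_add_pi] at this
    rw [show (Real.pi : ℂ) * (x - ((N : ℂ) - 1)) = Real.pi * x + Real.pi - N * Real.pi by ring, this]
    ring
  have hs := sin_pi_ne_zero hx
  have hpi := pi_ne_zero'
  rw [h4] at h3
  have e : ((-1 : ℂ) ^ (N + 1)) * (-1) ^ (N + 1) = 1 := by rw [← mul_pow]; simp
  have e0 : ((-1 : ℂ) ^ (N + 1)) ≠ 0 := pow_ne_zero _ (by norm_num)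
  rw [h2, eval_innerPoly, mul_assoc, h3]
  field_simp

/-- The value of the Cauchy transform, in a form which is meaningful at the inner points. -/
noncomputable def transformValueReg (N n : ℕ) (α α' b b' x : ℂ) : ℂ :=
  (-1) ^ N * ((n.factorial : ℂ) * Complex.Gamma (α + α' + b + b' - 2)) / Real.pi *
      (Complex.Gamma (x + 1) * Complex.Gamma (N - x)) *
      (closedBlock n α α' b b' x + closedBlock n α' α b b' x) +
    (innerPoly N).coeff (n + 1) * ((n.factorial : ℂ) * (poch (α + α' + b + b' - 2) n)⁻¹ *
      (Complex.Gamma (α + α' + b + b' - 3) *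
        (rG (α + b - 1) * rG (α + b' - 1) * rG (α' + b - 1) * rG (α' + b' - 1))))

theorem transformValue_eq (N n : ℕ) (α α' b b' : ℂ) {x : ℂ} (hx : NonInt x) :
    transformValue N n α α' b b' x = transformValueReg N n α α' b b' x := by
  rw [transformValue, transformValueReg]
  congr 1
  linear_combination (-((n.factorial : ℂ) * Complex.Gamma (α + α' + b + b' - 2) *
    (closedBlock n α α' b b' x + closedBlock n α' α b b' x))) * eval_innerPoly_div_sin N hx

theorem continuous_closedBlock (n : ℕ) (α α' b b' : ℂ) :
    Continuous fun x => closedBlock n α α' b b' x := by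
  have h : Differentiable ℂ fun x => reg3F2 (2 - α - b, α' + b' - 1, α' - x, 1 + α' - α,
      α' + b' + n) := differentiable_reg3F2.comp (f := fun x : ℂ => (2 - α - b, α' + b' - 1,
        α' - x, 1 + α' - α, α' + b' + n)) (by fun_prop)
  unfold closedBlock
  exact Differentiable.continuous (𝕜 := ℂ) (by fun_prop)

theorem continuousAt_transformValueReg (N n : ℕ) (α α' b b' : ℂ) {x : ℂ}
    (h1 : ∀ k : ℕ, x + 1 ≠ -(k : ℂ)) (h2 : ∀ k : ℕ, N - x ≠ -(k : ℂ)) :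
    ContinuousAt (fun x => transformValueReg N n α α' b b' x) x := by
  have g1 : ContinuousAt (fun x => Complex.Gamma (x + 1)) x :=
    ContinuousAt.comp (f := fun x : ℂ => x + 1) (Complex.differentiableAt_Gamma _ h1).continuousAt
      (by fun_prop)
  have g2 : ContinuousAt (fun x => Complex.Gamma ((N : ℂ) - x)) x :=
    ContinuousAt.comp (f := fun x : ℂ => (N : ℂ) - x)
      (Complex.differentiableAt_Gamma _ h2).continuousAt (by fun_prop)
  have c1 := continuous_closedBlock n α α' b b'
  have c2 := continuous_closedBlock n α' α b b'
  unfold transformValueReg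
  fun_prop

theorem mem_orthDomain_iff (N n : ℕ) (α α' b b' x : ℂ) :
    (α, α', b + n, b' + n, x) ∈ orthDomain N n ↔ (0 < (α + α' + b + b' - 2).re ∧
      (N : ℝ) - n < (α + α' + b + b' - 2).re) ∧ x ∈ regularSet N := by
  rw [orthDomain, Set.mem_inter_iff, Set.mem_inter_iff, Set.mem_ofPred_eq, Set.mem_ofPred_eq,
    Set.mem_preimage]
  simp only [Complex.add_re, Complex.sub_re, Complex.re_ofNat, Complex.natCast_re]
  constructor <;> rintro ⟨⟨h1, h2⟩, h3⟩ <;> exact ⟨⟨by linarith, by linarith⟩, h3⟩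

theorem continuousAt_orthTransform {N n : ℕ} {p : ℂ × ℂ × ℂ × ℂ × ℂ} (hp : p ∈ orthDomain N n) :
    ContinuousAt (orthTransform N n) p :=
  ((differentiableOn_orthTransform N n).differentiableAt
    ((isOpen_orthDomain N n).mem_nhds hp)).continuousAt

theorem eq_of_continuousAt_of_nonInt {f g : ℂ → ℂ} {x : ℂ} (hf : ContinuousAt f x)
    (hg : ContinuousAt g x) (h : ∀ y, NonInt y → f y = g y) : f x = g x := by
  by_cases hx : NonInt x
  · exact h x hx
  have him : x.im = 0 := by
    by_contra h0
    exact hx (nonInt_of_im_ne_zero h0)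
  have hc : Tendsto (fun ε : ℝ => x + ε * Complex.I) (𝓝[>] 0) (𝓝 x) := by
    have : Continuous fun ε : ℝ => x + ε * Complex.I := by fun_prop
    have h0 := (this.tendsto 0).mono_left (nhdsWithin_le_nhds (s := Set.Ioi 0))
    simpa using h0
  refine tendsto_nhds_unique_of_eventuallyEq (hf.tendsto.comp hc) (hg.tendsto.comp hc) ?_
  filter_upwards [self_mem_nhdsWithin] with ε hε
  refine h _ (nonInt_of_im_ne_zero ?_)
  simpa [him] using (ne_of_gt hε : ε ≠ 0)

theorem orthTransform_eq_reg {N n : ℕ} (hN : N ≤ n + 1) {α α' b b' x : ℂ}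
    (h0 : 0 < (α + α' + b + b' - 2).re) (h1 : (N : ℝ) - n < (α + α' + b + b' - 2).re)
    (hαα : NonInt (α - α')) (hx : x ∈ regularSet N) :
    orthTransform N n (α, α', b + n, b' + n, x) = transformValueReg N n α α' b b' x := by
  have hpole : ∀ k : ℤ, (∀ i : ℕ, i < N → k ≠ i) → x ≠ k := by
    intro k hk
    refine hx k fun h => ?_
    obtain ⟨i, hi, h⟩ := (eval_innerPoly_eq_zero_iff N _).mp h
    exact hk i hi (by exact_mod_cast h)
  refine eq_of_continuousAt_of_nonInt (f := fun x => orthTransform N n (α, α', b + n, b' + n, x))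
    (g := fun x => transformValueReg N n α α' b b' x)
    (ContinuousAt.comp (f := fun x : ℂ => (α, α', b + n, b' + n, x))
      (continuousAt_orthTransform ((mem_orthDomain_iff N n α α' b b' x).mpr ⟨⟨h0, h1⟩, hx⟩))
      (by fun_prop))
    (continuousAt_transformValueReg N n α α' b b' ?_ ?_)
    fun y hy => by rw [orthTransform_eq hN h0 h1 hαα hy, transformValue_eq N n α α' b b' hy]
  · intro k hk
    refine hpole (-k - 1) (fun i _ => by omega) ?_
    push_cast
    linear_combination hk
  · intro k hk
    refine hpole (N + k) (fun i hi => by omega) ?_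
    push_cast
    linear_combination -hk

/-! ### Sums over the outer lattice -/

theorem latticeOut_eq (N : ℕ) : latticeOut N =
    (fun j : ℤ => (j : ℂ) - ((N : ℂ) - 1) / 2) '' {j | (innerPoly N).eval (j : ℂ) ≠ 0} := by
  ext x
  simp only [latticeOut, Set.mem_sdiff, Set.mem_image, Set.mem_ofPred_eq, ne_eq,
    eval_innerPoly_eq_zero_iff]
  constructor
  · rintro ⟨⟨k, rfl⟩, h⟩
    refine ⟨k + N - 1, fun ⟨i, hi, h'⟩ => h ⟨i, hi, ?_⟩, ?_⟩
    · rw [← h']; push_cast; ring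
    · push_cast; ring
  · rintro ⟨j, hj, rfl⟩
    refine ⟨⟨j - N + 1, ?_⟩, fun ⟨i, hi, h'⟩ => hj ⟨i, hi, ?_⟩⟩
    · push_cast; ring
    · linear_combination h'

theorem hasSum_latticeOut {N : ℕ} {f : ℂ → ℂ} {g : ℤ → ℂ} {s : ℂ}
    (hfg : ∀ j : ℤ, f ((j : ℂ) - ((N : ℂ) - 1) / 2) = g j)
    (hg : ∀ j : ℤ, (innerPoly N).eval (j : ℂ) = 0 → g j = 0) (h : HasSum g s) :
    HasSum (fun y : latticeOut N => f y) s := by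
  have hinj : Function.Injective fun j : ℤ => (j : ℂ) - ((N : ℂ) - 1) / 2 := fun i j hij => by
    simpa using hij
  rw [latticeOut_eq, ← (Equiv.Set.image _ _ hinj).hasSum_iff]
  have e : (fun y : ((fun j : ℤ => (j : ℂ) - ((N : ℂ) - 1) / 2) ''
      {j | (innerPoly N).eval (j : ℂ) ≠ 0} : Set ℂ) => f y) ∘ (Equiv.Set.image _ _ hinj) =
      g ∘ ((↑) : {j : ℤ | (innerPoly N).eval (j : ℂ) ≠ 0} → ℤ) := by
    funext j
    exact hfg j
  rw [e]
  exact (hasSum_subtype_iff_of_support_subset fun j hj h0 => hj (hg j h0)).mpr h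

theorem mem_regularSet_iff (N : ℕ) (x : ℂ) :
    x + ((N : ℂ) - 1) / 2 ∈ regularSet N ↔ x ∉ latticeOut N := by
  rw [latticeOut_eq, regularSet, Set.mem_ofPred_eq, Set.mem_image, not_exists]
  refine forall_congr' fun j => ?_
  rw [not_and, Set.mem_ofPred_eq]
  refine forall_congr' fun _ => not_congr ⟨fun h => ?_, fun h => ?_⟩
  · rw [← h]; ring
  · rw [← h]; ring

/-- The change of parameters. -/
noncomputable def shiftPoint (N : ℕ) (q : ℂ × ℂ × ℂ × ℂ × ℂ) : ℂ × ℂ × ℂ × ℂ × ℂ :=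
  (q.1 + N, q.2.1 + N, q.2.2.1 + 1, q.2.2.2.1 + 1, q.2.2.2.2 + ((N : ℂ) - 1) / 2)

theorem psiOut_eq (N : ℕ) (z z' w w' : ℂ) (j : ℤ) :
    psiOut N z z' w w' (j - ((N : ℂ) - 1) / 2) =
      (innerPoly N).eval (j : ℂ) ^ 2 * gamProd (z + N) (z' + N) (w + 1) (w' + 1) j := by
  rw [psiOut, gamProd, eval_innerPoly, div_eq_mul_inv, mul_inv, mul_inv, mul_inv]
  simp only [rG]
  rw [show (j : ℂ) - ((N : ℂ) - 1) / 2 - ((N : ℂ) - 1) / 2 = j - ((N : ℂ) - 1) by ring,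
    show -((j : ℂ) - ((N : ℂ) - 1) / 2) + z + ((N : ℂ) + 1) / 2 = z + N - j by ring,
    show -((j : ℂ) - ((N : ℂ) - 1) / 2) + z' + ((N : ℂ) + 1) / 2 = z' + N - j by ring,
    show (j : ℂ) - ((N : ℂ) - 1) / 2 + w + ((N : ℂ) + 1) / 2 = w + 1 + j by ring,
    show (j : ℂ) - ((N : ℂ) - 1) / 2 + w' + ((N : ℂ) + 1) / 2 = w' + 1 + j by ring]
  ring

theorem SinTerm_eq (N : ℕ) (z z' w w' x : ℂ) (j : ℤ) :
    SinTerm N z z' w w' x (j - ((N : ℂ) - 1) / 2) =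
      orthTerm N N j (shiftPoint N (z, z', w, w', x)) := by
  rw [SinTerm, psiOut_eq, Rout, pN, orthTerm, shiftPoint, orthPoly,
    show (j : ℂ) - ((N : ℂ) - 1) / 2 - ((N : ℂ) - 1) / 2 = j - ((N : ℂ) - 1) by ring,
    ← eval_innerPoly]
  simp only
  rw [show z + N + (w' + 1 - N) - 1 = z + w' by ring,
    show z' + N + (w' + 1 - N) - 1 = z' + w' by ring,
    show z + N + (z' + N) + (w + 1 - N) + (w' + 1 - N) - 2 = z + z' + w + w' by ring,
    show (j : ℂ) - ((N : ℂ) - 1) / 2 + w' - ((N : ℂ) - 1) / 2 = j + (w' + 1 - N) by ring,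
    show (j : ℂ) - ((N : ℂ) - 1) / 2 - x = j - (x + ((N : ℂ) - 1) / 2) by ring]
  by_cases h : (innerPoly N).eval (j : ℂ) = 0
  · rw [h]; ring
  · field_simp

theorem RinTerm_eq {N : ℕ} (hN : 1 ≤ N) (z z' w w' x : ℂ) (j : ℤ) :
    RinTerm N z z' w w' x (j - ((N : ℂ) - 1) / 2) =
      orthTerm N (N - 1) j (shiftPoint N (z, z', w, w', x)) / hNsub1 N z z' w w' := by
  rw [RinTerm, psiOut_eq, Sout, pNsub1, orthTerm, shiftPoint, orthPoly,
    show (j : ℂ) - ((N : ℂ) - 1) / 2 - ((N : ℂ) - 1) / 2 = j - ((N : ℂ) - 1) by ring,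
    ← eval_innerPoly, Nat.cast_sub hN, Nat.cast_one]
  simp only
  rw [show z + N + (w' + 1 - (N - 1)) - 1 = z + w' + 1 by ring,
    show z' + N + (w' + 1 - (N - 1)) - 1 = z' + w' + 1 by ring,
    show z + N + (z' + N) + (w + 1 - (N - 1)) + (w' + 1 - (N - 1)) - 2 =
      z + z' + w + w' + 2 by ring,
    show (j : ℂ) - ((N : ℂ) - 1) / 2 + w' - ((N : ℂ) - 3) / 2 = j + (w' + 1 - (N - 1)) by ring,
    show (j : ℂ) - ((N : ℂ) - 1) / 2 - x = j - (x + ((N : ℂ) - 1) / 2) by ring]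
  by_cases h : (innerPoly N).eval (j : ℂ) = 0
  · rw [h]; ring
  · field_simp

theorem orthTerm_eq_zero {N : ℕ} {j : ℤ} (h : (innerPoly N).eval (j : ℂ) = 0) (n : ℕ)
    (p : ℂ × ℂ × ℂ × ℂ × ℂ) : orthTerm N n j p = 0 := by
  rw [orthTerm, h, zero_mul, zero_mul]

theorem shiftPoint_mem_orthDomain {N n : ℕ} (hn : n ≤ N) {z z' w w' x : ℂ}
    (hS : 0 < (z + z' + w + w').re) (hx : x ∉ latticeOut N) :
    shiftPoint N (z, z', w, w', x) ∈ orthDomain N n := by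
  have hn' : (n : ℝ) ≤ N := Nat.cast_le.mpr hn
  refine ⟨⟨?_, ?_⟩, (mem_regularSet_iff N x).mpr hx⟩ <;> rw [Set.mem_ofPred_eq, shiftPoint] <;>
  · simp only [Complex.add_re, Complex.natCast_re, Complex.one_re] at *
    linarith

theorem hasSum_SinTerm {N : ℕ} {z z' w w' x : ℂ} (hS : 0 < (z + z' + w + w').re)
    (hx : x ∉ latticeOut N) : HasSum (fun y : latticeOut N => SinTerm N z z' w w' x y)
      (orthTransform N N (shiftPoint N (z, z', w, w', x))) :=
  hasSum_latticeOut (SinTerm_eq N z z' w w' x) (fun _ h => orthTerm_eq_zero h _ _)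
    (summable_orthTerm (shiftPoint_mem_orthDomain le_rfl hS hx)).hasSum

theorem hasSum_RinTerm {N : ℕ} (hN : 1 ≤ N) {z z' w w' x : ℂ} (hS : 0 < (z + z' + w + w').re)
    (hx : x ∉ latticeOut N) : HasSum (fun y : latticeOut N => RinTerm N z z' w w' x y)
      (orthTransform N (N - 1) (shiftPoint N (z, z', w, w', x)) / hNsub1 N z z' w w') :=
  hasSum_latticeOut (RinTerm_eq hN z z' w w' x)
    (fun _ h => by rw [orthTerm_eq_zero h, zero_div])
    ((summable_orthTerm (shiftPoint_mem_orthDomain (Nat.sub_le _ _) hS hx)).hasSum.div_const _)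

theorem Sin_eq {N : ℕ} {z z' w w' x : ℂ} (hS : 0 < (z + z' + w + w').re)
    (hx : x ∉ latticeOut N) :
    Sin N z z' w w' x = -orthTransform N N (shiftPoint N (z, z', w, w', x)) := by
  rw [Sin, (hasSum_SinTerm hS hx).tsum_eq]

theorem Rin_eq {N : ℕ} (hN : 1 ≤ N) {z z' w w' x : ℂ} (hS : 0 < (z + z' + w + w').re)
    (hx : x ∉ latticeOut N) : Rin N z z' w w' x =
      1 - orthTransform N (N - 1) (shiftPoint N (z, z', w, w', x)) / hNsub1 N z z' w w' := by
  rw [Rin, (hasSum_RinTerm hN hS hx).tsum_eq]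

/-! ### Continuity of the sums in all variables -/

theorem isOpen_ne_neg_nat : IsOpen {s : ℂ | ∀ k : ℕ, s ≠ -((k : ℂ) + 1)} := by
  have h : {s : ℂ | ∀ k : ℕ, s ≠ -((k : ℂ) + 1)} = (((↑) : ℤ → ℂ) '' {j | j < 0})ᶜ := by
    ext s
    simp only [Set.mem_ofPred_eq, Set.mem_compl_iff, Set.mem_image, not_exists, not_and]
    constructor
    · rintro h j hj rfl
      refine h (-j - 1).toNat ?_
      have : (((-j - 1).toNat : ℤ) : ℂ) = ((-j - 1 : ℤ) : ℂ) := by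
        rw [Int.toNat_of_nonneg (by omega)]
      push_cast at this
      rw [this]; ring
    · rintro h k rfl
      exact h (-(k + 1)) (by omega) (by push_cast; ring)
  rw [h]
  exact (Complex.isClosedEmbedding_intCast.isClosedMap _ (isClosed_discrete _)).isOpen_compl

/-- The points `(z, z', w, w', x)` at which the sums are studied. -/
def sumDomain (N : ℕ) : Set (ℂ × ℂ × ℂ × ℂ × ℂ) :=
  {q | (q.1, q.2.1, q.2.2.1, q.2.2.2.1) ∈ D0 ∧ 0 < (q.1 + q.2.1 + q.2.2.1 + q.2.2.2.1).re ∧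
    q.2.2.2.2 ∉ latticeOut N}

theorem isOpen_sumDomain (N : ℕ) : IsOpen (sumDomain N) := by
  have h : sumDomain N = {q | -1 < (q.1 + q.2.1 + q.2.2.1 + q.2.2.2.1).re} ∩
      ((fun q => q.1 + q.2.2.1) ⁻¹' {s : ℂ | ∀ k : ℕ, s ≠ -((k : ℂ) + 1)} ∩
      (fun q => q.1 + q.2.2.2.1) ⁻¹' {s : ℂ | ∀ k : ℕ, s ≠ -((k : ℂ) + 1)} ∩
      (fun q => q.2.1 + q.2.2.1) ⁻¹' {s : ℂ | ∀ k : ℕ, s ≠ -((k : ℂ) + 1)} ∩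
      (fun q => q.2.1 + q.2.2.2.1) ⁻¹' {s : ℂ | ∀ k : ℕ, s ≠ -((k : ℂ) + 1)}) ∩
      {q | 0 < (q.1 + q.2.1 + q.2.2.1 + q.2.2.2.1).re} ∩
      (fun q => q.2.2.2.2 + ((N : ℂ) - 1) / 2) ⁻¹' regularSet N := by
    ext q
    simp only [sumDomain, D0, Set.mem_inter_iff, Set.mem_ofPred_eq, Set.mem_preimage,
      mem_regularSet_iff, forall_and]
    tauto
  rw [h]
  refine (((isOpen_lt continuous_const (by fun_prop)).inter ((((isOpen_ne_neg_nat.preimage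
    (by fun_prop)).inter (isOpen_ne_neg_nat.preimage (by fun_prop))).inter
    (isOpen_ne_neg_nat.preimage (by fun_prop))).inter (isOpen_ne_neg_nat.preimage
    (by fun_prop)))).inter (isOpen_lt continuous_const (by fun_prop))).inter
    ((isOpen_regularSet N).preimage (by fun_prop))

theorem continuousAt_Gamma_comp {E : Type*} [TopologicalSpace E] {f : E → ℂ} {q : E}
    (hf : ContinuousAt f q) (h : ∀ k : ℕ, f q ≠ -(k : ℂ)) :
    ContinuousAt (fun q => Complex.Gamma (f q)) q :=
  ContinuousAt.comp (Complex.differentiableAt_Gamma _ h).continuousAt hf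

theorem ne_neg_nat_of_ne_neg_succ {s : ℂ} (h : ∀ k : ℕ, s ≠ -((k : ℂ) + 1)) (k : ℕ) :
    s + 1 ≠ -(k : ℂ) := fun hk => h k (by linear_combination hk)

theorem hNsub1_ne_zero {N : ℕ} (hN : 1 ≤ N) {z z' w w' : ℂ} (hD : (z, z', w, w') ∈ D0)
    (hS : 0 < (z + z' + w + w').re) : hNsub1 N z z' w w' ≠ 0 := by
  have hN' : (1 : ℝ) ≤ N := Nat.one_le_cast.mpr hN
  have h := hD.2
  simp only [forall_and] at h
  obtain ⟨h1, h2, h3, h4⟩ := h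
  have e1 : (z + z' + w + w' + 1).re = (z + z' + w + w').re + 1 := by simp
  have e2 : (z + z' + w + w' + 2).re = (z + z' + w + w').re + 2 := by simp
  have e3 : (z + z' + w + w' + N + 1).re = (z + z' + w + w').re + N + 1 := by simp
  unfold hNsub1
  refine div_ne_zero (mul_ne_zero (mul_ne_zero ?_ ?_) ?_)
    (mul_ne_zero (mul_ne_zero (mul_ne_zero (mul_ne_zero ?_ ?_) ?_) ?_) ?_)
  · exact Complex.Gamma_ne_zero_of_re_pos (by rw [Complex.natCast_re]; linarith)
  · exact Complex.Gamma_ne_zero_of_re_pos (by linarith)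
  · exact Complex.Gamma_ne_zero_of_re_pos (by linarith)
  · exact Complex.Gamma_ne_zero_of_re_pos (by linarith)
  · exact Complex.Gamma_ne_zero (ne_neg_nat_of_ne_neg_succ h1)
  · exact Complex.Gamma_ne_zero (ne_neg_nat_of_ne_neg_succ h2)
  · exact Complex.Gamma_ne_zero (ne_neg_nat_of_ne_neg_succ h3)
  · exact Complex.Gamma_ne_zero (ne_neg_nat_of_ne_neg_succ h4)

theorem continuousAt_hNsub1 {N : ℕ} {q : ℂ × ℂ × ℂ × ℂ × ℂ} (hq : q ∈ sumDomain N) :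
    ContinuousAt (fun q : ℂ × ℂ × ℂ × ℂ × ℂ => hNsub1 N q.1 q.2.1 q.2.2.1 q.2.2.2.1) q := by
  obtain ⟨hD, hS, -⟩ := hq
  have h := hD.2
  simp only [forall_and] at h
  obtain ⟨h1, h2, h3, h4⟩ := h
  have e1 : (q.1 + q.2.1 + q.2.2.1 + q.2.2.2.1 + 1).re =
    (q.1 + q.2.1 + q.2.2.1 + q.2.2.2.1).re + 1 := by simp
  have e2 : (q.1 + q.2.1 + q.2.2.1 + q.2.2.2.1 + 2).re =
    (q.1 + q.2.1 + q.2.2.1 + q.2.2.2.1).re + 2 := by simp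
  have e3 : (q.1 + q.2.1 + q.2.2.1 + q.2.2.2.1 + N + 1).re =
    (q.1 + q.2.1 + q.2.2.1 + q.2.2.2.1).re + N + 1 := by simp
  have hN : (0 : ℝ) ≤ N := Nat.cast_nonneg N
  have n0 := ne_neg_nat_of_re_pos (a := q.1 + q.2.1 + q.2.2.1 + q.2.2.2.1 + N + 1) (by linarith)
  have n1 := ne_neg_nat_of_ne_neg_succ h1
  have n2 := ne_neg_nat_of_ne_neg_succ h2
  have n3 := ne_neg_nat_of_ne_neg_succ h3
  have n4 := ne_neg_nat_of_ne_neg_succ h4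
  unfold hNsub1
  refine ContinuousAt.div (ContinuousAt.mul (ContinuousAt.mul continuousAt_const ?_) ?_)
    (ContinuousAt.mul (ContinuousAt.mul (ContinuousAt.mul (ContinuousAt.mul ?_ ?_) ?_) ?_) ?_)
    (mul_ne_zero (mul_ne_zero (mul_ne_zero (mul_ne_zero (Complex.Gamma_ne_zero n0)
      (Complex.Gamma_ne_zero n1)) (Complex.Gamma_ne_zero n2)) (Complex.Gamma_ne_zero n3))
      (Complex.Gamma_ne_zero n4))
  · exact continuousAt_Gamma_comp (by fun_prop) (ne_neg_nat_of_re_pos (by linarith))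
  · exact continuousAt_Gamma_comp (by fun_prop) (ne_neg_nat_of_re_pos (by linarith))
  · exact continuousAt_Gamma_comp (by fun_prop) n0
  · exact continuousAt_Gamma_comp (by fun_prop) n1
  · exact continuousAt_Gamma_comp (by fun_prop) n2
  · exact continuousAt_Gamma_comp (by fun_prop) n3
  · exact continuousAt_Gamma_comp (by fun_prop) n4

theorem continuous_shiftPoint (N : ℕ) : Continuous (shiftPoint N) := by
  unfold shiftPoint; fun_prop

theorem continuousAt_Sin {N : ℕ} {q : ℂ × ℂ × ℂ × ℂ × ℂ} (hq : q ∈ sumDomain N) :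
    ContinuousAt (fun q : ℂ × ℂ × ℂ × ℂ × ℂ => Sin N q.1 q.2.1 q.2.2.1 q.2.2.2.1 q.2.2.2.2) q := by
  have h : ContinuousAt (fun q => -orthTransform N N (shiftPoint N q)) q :=
    (ContinuousAt.comp (continuousAt_orthTransform
      (shiftPoint_mem_orthDomain le_rfl hq.2.1 hq.2.2)) (continuous_shiftPoint N).continuousAt).neg
  refine h.congr ?_
  filter_upwards [(isOpen_sumDomain N).mem_nhds hq] with y hy
  exact (Sin_eq hy.2.1 hy.2.2).symm

theorem continuousAt_Rin {N : ℕ} (hN : 1 ≤ N) {q : ℂ × ℂ × ℂ × ℂ × ℂ} (hq : q ∈ sumDomain N) :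
    ContinuousAt (fun q : ℂ × ℂ × ℂ × ℂ × ℂ => Rin N q.1 q.2.1 q.2.2.1 q.2.2.2.1 q.2.2.2.2) q := by
  have h0 : ContinuousAt (fun q => orthTransform N (N - 1) (shiftPoint N q)) q :=
    ContinuousAt.comp (continuousAt_orthTransform
      (shiftPoint_mem_orthDomain (Nat.sub_le _ _) hq.2.1 hq.2.2))
      (continuous_shiftPoint N).continuousAt
  have h : ContinuousAt (fun q : ℂ × ℂ × ℂ × ℂ × ℂ => 1 -
      orthTransform N (N - 1) (shiftPoint N q) / hNsub1 N q.1 q.2.1 q.2.2.1 q.2.2.2.1) q :=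
    continuousAt_const.sub (h0.div (continuousAt_hNsub1 hq) (hNsub1_ne_zero hN hq.1 hq.2.1))
  refine h.congr ?_
  filter_upwards [(isOpen_sumDomain N).mem_nhds hq] with y hy
  exact (Rin_eq hN hy.2.1 hy.2.2).symm

/-! ### Comparison with the closed forms -/

theorem reg3F2_swap (a b c f : ℂ) {e : ℂ} (he : ∀ k : ℕ, e ≠ -(k : ℂ)) :
    reg3F2 (a, b, c, e, f) = reg3F2 (b, a, c, e, f) := by
  have h := entire_eq_of_eq_halfPlane (f := fun t => reg3F2 (a, b, c, e, f + t))
    (g := fun t => reg3F2 (b, a, c, e, f + t)) (differentiable_reg3F2.comp (by fun_prop))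
    (differentiable_reg3F2.comp (by fun_prop)) (‖f‖ + ‖e + f - a - b - c‖) ?_
  · simpa using congrFun h 0
  intro t ht
  have h1 := (abs_le.mp (Complex.abs_re_le_norm f)).1
  have h2 := (abs_le.mp (Complex.abs_re_le_norm (e + f - a - b - c))).1
  have n1 := norm_nonneg f
  have n2 := norm_nonneg (e + f - a - b - c)
  have hf : 0 < (f + t).re := by rw [Complex.add_re]; linarith
  have hs : 0 < (e + (f + t) - a - b - c).re := by
    simp only [Complex.add_re, Complex.sub_re] at *; linarith
  have hs' : e + (f + t) - b - a - c = e + (f + t) - a - b - c := by ring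
  have hr : regSeries a b c e (f + t) = regSeries b a c e (f + t) :=
    tsum_congr fun k => by rw [regTerm, regTerm, mul_comm (poch a k)]
  rw [reg3F2_eq he (ne_neg_nat_of_re_pos hf) hs, reg3F2_eq he (ne_neg_nat_of_re_pos hf)
    (by rw [hs']; exact hs), hs', hr]

theorem sin_pi_add_natCast (z : ℂ) (N : ℕ) :
    Complex.sin (Real.pi * (z + N)) = (-1) ^ N * Complex.sin (Real.pi * z) := by
  have := Complex.sin_antiperiodic.add_nat_mul_eq (x := Real.pi * z) N
  rw [← this]
  congr 1
  ring

theorem hNsub1_swap (N : ℕ) (z z' w w' : ℂ) : hNsub1 N z' z w w' = hNsub1 N z z' w w' := by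
  unfold hNsub1
  rw [add_comm z' z]
  congr 1
  ring

theorem neg_one_pow_mul_self (N : ℕ) : ((-1 : ℂ) ^ N) * (-1) ^ N = 1 := by
  rw [← mul_pow]; simp

section blocks

variable {N : ℕ} {z z' w w' x : ℂ}

theorem SinBlock_eq (hf : ∀ k : ℕ, z + w' + 1 ≠ -(k : ℂ))
    (hs : ∀ k : ℕ, x + w + ((N : ℂ) + 1) / 2 ≠ -(k : ℂ)) :
    SinBlock N z z' w w' x =
      (-1) ^ N * ((N.factorial : ℂ) * Complex.Gamma (z + z' + w + w')) / Real.pi *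
        (Complex.Gamma (x + ((N : ℂ) - 1) / 2 + 1) * Complex.Gamma (N - (x + ((N : ℂ) - 1) / 2))) *
        closedBlock N (z' + N) (z + N) (w + 1 - N) (w' + 1 - N) (x + ((N : ℂ) - 1) / 2) := by
  have hf' : ∀ k : ℕ, (N : ℂ) + 1 + z + w' ≠ -(k : ℂ) := fun k hk =>
    hf (k + N) (by push_cast; linear_combination hk)
  have g1 := Gamma_mul_rG hf'
  have g2 := Gamma_mul_rG hs
  have g3 := neg_one_pow_mul_self N
  rw [closedBlock, SinBlock, F32, sin_pi_add_natCast, ← Complex.Gamma_nat_eq_factorial]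
  simp only [div_eq_mul_inv, mul_inv]
  simp only [← rG.eq_1]
  rw [show (x + ((N : ℂ) - 1) * 2⁻¹ + 1) = x + ((N : ℂ) + 1) * 2⁻¹ by ring,
    show (N : ℂ) - (x + ((N : ℂ) - 1) * 2⁻¹) = -x + ((N : ℂ) + 1) * 2⁻¹ by ring,
    show z' + N + (w + 1 - N) - 1 = z' + w by ring,
    show z' + N + (w' + 1 - N) - 1 = z' + w' by ring,
    show z' + N - (x + ((N : ℂ) - 1) * 2⁻¹) = -x + z' + ((N : ℂ) + 1) * 2⁻¹ by ring,
    show 2 - (z' + N) - (w + 1 - N) = -z' - w + 1 by ring,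
    show z + N + (w' + 1 - N) - 1 = z + w' by ring,
    show z + N - (x + ((N : ℂ) - 1) * 2⁻¹) = -x + z + ((N : ℂ) + 1) * 2⁻¹ by ring,
    show 1 + (z + N) - (z' + N) = z - z' + 1 by ring,
    show z + N + (w' + 1 - N) + N = N + 1 + z + w' by ring,
    show z' + N - (z + N) = z' - z by ring,
    show z - z' + 1 + (N + 1 + z + w') - (-z' - w + 1) - (z + w') -
      (-x + z + ((N : ℂ) + 1) * 2⁻¹) = x + w + ((N : ℂ) + 1) * 2⁻¹ by ring]
  rw [div_eq_mul_inv] at g2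
  generalize Complex.Gamma (x + w + ((N : ℂ) + 1) * 2⁻¹) = A1 at *
  generalize rG (x + w + ((N : ℂ) + 1) * 2⁻¹) = B1 at *
  generalize Complex.Gamma ((N : ℂ) + 1 + z + w') = A2 at *
  generalize rG ((N : ℂ) + 1 + z + w') = B2 at *
  generalize reg3F2 _ = F
  generalize Complex.sin _ = s
  linear_combination (s * (Real.pi : ℂ)⁻¹ * (Complex.Gamma (z' - z) *
    Complex.Gamma (z + z' + w + w') * (rG (z' + w) * rG (z' + w'))) *
    (Complex.Gamma (x + ((N : ℂ) + 1) * 2⁻¹) * Complex.Gamma (-x + ((N : ℂ) + 1) * 2⁻¹) *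
      Complex.Gamma (N + 1) * rG (-x + z' + ((N : ℂ) + 1) * 2⁻¹)) *
    Complex.Gamma (z - z' + 1) * F) * (A2 * B2 * g2 + g1 - g3)

theorem RinBlock_eq (hN : 1 ≤ N) (hD : (z, z', w, w') ∈ D0) (hS : 0 < (z + z' + w + w').re)
    (hzz : NonInt (z - z')) (hs : ∀ k : ℕ, x + w + ((N : ℂ) + 1) / 2 ≠ -(k : ℂ)) :
    RinBlock N z z' w w' x * hNsub1 N z z' w w' =
      (-1) ^ N * (((N - 1).factorial : ℂ) * Complex.Gamma (z + z' + w + w' + 2)) / Real.pi *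
        (Complex.Gamma (x + ((N : ℂ) - 1) / 2 + 1) * Complex.Gamma (N - (x + ((N : ℂ) - 1) / 2))) *
        closedBlock (N - 1) (z' + N) (z + N) (w + 1 - (N - 1 : ℕ)) (w' + 1 - (N - 1 : ℕ))
          (x + ((N : ℂ) - 1) / 2) := by
  have h := hD.2
  simp only [forall_and] at h
  obtain ⟨h1, h2, -, -⟩ := h
  have hf' : ∀ k : ℕ, (N : ℂ) + 1 + z + w' ≠ -(k : ℂ) := fun k hk =>
    h2 (k + N) (by push_cast; linear_combination hk)
  have hE : ∀ k : ℕ, z - z' + 1 ≠ -(k : ℂ) := fun k hk =>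
    hzz (-k - 1) (by push_cast; linear_combination hk)
  have hN0 : (0 : ℝ) ≤ N := Nat.cast_nonneg N
  have g1 := Gamma_mul_rG hf'
  have g2 := Gamma_mul_rG hs
  have g3 := neg_one_pow_mul_self N
  have g4 := Gamma_mul_rG (ne_neg_nat_of_re_pos (a := z + z' + w + w' + 1) (by
    rw [Complex.add_re, Complex.one_re]; linarith))
  have g5 := Gamma_mul_rG (ne_neg_nat_of_re_pos (a := z + z' + w + w' + N + 1) (by
    rw [Complex.add_re, Complex.one_re, Complex.add_re, Complex.natCast_re]; linarith))
  have g6 := Gamma_mul_rG (ne_neg_nat_of_ne_neg_succ h1)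
  have g7 := Gamma_mul_rG (ne_neg_nat_of_ne_neg_succ h2)
  have hfac : ((N - 1).factorial : ℂ) = Complex.Gamma N := by
    rw [← Complex.Gamma_nat_eq_factorial, Nat.cast_sub hN]; simp
  rw [closedBlock, RinBlock, F32, hNsub1, sin_pi_add_natCast, hfac, reg3F2_swap _ _ _ _ hE,
    Nat.cast_sub hN, Nat.cast_one]
  simp only [div_eq_mul_inv, mul_inv]
  simp only [← rG.eq_1]
  rw [show (x + ((N : ℂ) - 1) * 2⁻¹ + 1) = x + ((N : ℂ) + 1) * 2⁻¹ by ring,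
    show (N : ℂ) - (x + ((N : ℂ) - 1) * 2⁻¹) = -x + ((N : ℂ) + 1) * 2⁻¹ by ring,
    show z' + N + (w + 1 - (N - 1)) - 1 = z' + w + 1 by ring,
    show z' + N + (w' + 1 - (N - 1)) - 1 = z' + w' + 1 by ring,
    show z' + N - (x + ((N : ℂ) - 1) * 2⁻¹) = -x + z' + ((N : ℂ) + 1) * 2⁻¹ by ring,
    show 2 - (z' + N) - (w + 1 - (N - 1)) = -z' - w by ring,
    show z + N + (w' + 1 - (N - 1)) - 1 = z + w' + 1 by ring,
    show z + N - (x + ((N : ℂ) - 1) * 2⁻¹) = -x + z + ((N : ℂ) + 1) * 2⁻¹ by ring,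
    show 1 + (z + N) - (z' + N) = z - z' + 1 by ring,
    show z + N + (w' + 1 - (N - 1)) + (N - 1) = N + 1 + z + w' by ring,
    show z' + N - (z + N) = z' - z by ring,
    show z - z' + 1 + (N + 1 + z + w') - (z + w' + 1) - (-z' - w) -
      (-x + z + ((N : ℂ) + 1) * 2⁻¹) = x + w + ((N : ℂ) + 1) * 2⁻¹ by ring,
    show (N : ℂ) + 1 + (z + z' + w + w') = z + z' + w + w' + N + 1 by ring]
  rw [div_eq_mul_inv] at g2
  have key : ∀ (A1 B1 A2 B2 A4 B4 A5 B5 A6 B6 A7 B7 e s p G1 X1 X2 r1 E F GN S2 r8 r9 : ℂ),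
      A2 * B2 = 1 → A1 * B1 = 1 → e * e = 1 → A4 * B4 = 1 → A5 * B5 = 1 → A6 * B6 = 1 →
      A7 * B7 = 1 → s * p * (G1 * A6 * A7 * B4) * (X1 * X2 * A5 * (r1 * B1 * B2)) *
        (E * A2 * A1 * F) * (GN * A4 * S2 * (B5 * B6 * B7 * r8 * r9)) =
        e * (GN * S2) * p * (X1 * X2) * (e * s * (G1 * E) * (r8 * r9 * r1) * F) := by
    intro A1 B1 A2 B2 A4 B4 A5 B5 A6 B6 A7 B7 e s p G1 X1 X2 r1 E F GN S2 r8 r9 h2 h1 he h4 h5 h6 h7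
    calc _ = (s * p * G1 * X1 * X2 * r1 * E * F * GN * S2 * r8 * r9) * ((A2 * B2) * (A1 * B1) *
          (A4 * B4) * (A5 * B5) * (A6 * B6) * (A7 * B7)) := by ring
      _ = (s * p * G1 * X1 * X2 * r1 * E * F * GN * S2 * r8 * r9) * (e * e) := by
          rw [h2, h1, h4, h5, h6, h7, he]; ring
      _ = _ := by ring
  convert key _ _ _ _ _ _ _ _ _ _ _ _ ((-1) ^ N) (Complex.sin (Real.pi * z)) (Real.pi : ℂ)⁻¹
    (Complex.Gamma (z' - z)) (Complex.Gamma (x + ((N : ℂ) + 1) * 2⁻¹))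
    (Complex.Gamma (-x + ((N : ℂ) + 1) * 2⁻¹)) (rG (-x + z' + ((N : ℂ) + 1) * 2⁻¹))
    (Complex.Gamma (z - z' + 1)) (reg3F2 (-z' - w, z + w' + 1, -x + z + ((N : ℂ) + 1) * 2⁻¹,
      z - z' + 1, N + 1 + z + w')) (Complex.Gamma N) (Complex.Gamma (z + z' + w + w' + 2))
    (rG (z' + w + 1)) (rG (z' + w' + 1)) g1 g2 g3 g4 g5 g6 g7 using 1

theorem D0_swap (hD : (z, z', w, w') ∈ D0) : (z', z, w, w') ∈ D0 := by
  refine ⟨?_, fun k => ⟨(hD.2 k).2.2.1, (hD.2 k).2.2.2, (hD.2 k).1, (hD.2 k).2.1⟩⟩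
  have := hD.1
  simp only at this ⊢
  rwa [add_comm z' z]

theorem shiftPoint_eq (n : ℕ) : shiftPoint N (z, z', w, w', x) =
    (z + N, z' + N, w + 1 - n + n, w' + 1 - n + n, x + ((N : ℂ) - 1) / 2) := by
  rw [sub_add_cancel, sub_add_cancel, shiftPoint]

theorem Sin_eq_SinClosed (hD : (z, z', w, w') ∈ D0) (hS : 0 < (z + z' + w + w').re)
    (hx : x ∉ latticeOut N) (hq : (z, z', w, w', x) ∈ generic N) :
    Sin N z z' w w' x = SinClosed N z z' w w' x := by
  obtain ⟨hzz, hs⟩ := hq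
  simp only at hzz hs
  have hA : NonInt (z + N - (z' + N)) := by rwa [add_sub_add_right_eq_sub]
  have hσ : z + N + (z' + N) + (w + 1 - N) + (w' + 1 - N) - 2 = z + z' + w + w' := by ring
  have h := hD.2
  simp only [forall_and] at h
  rw [Sin_eq hS hx, shiftPoint_eq N, orthTransform_eq_reg (Nat.le_succ N) (by rwa [hσ])
    (by rwa [hσ, sub_self]) hA ((mem_regularSet_iff N x).mpr hx), transformValueReg,
    Polynomial.coeff_eq_zero_of_natDegree_lt (by rw [natDegree_innerPoly]; exact N.lt_succ_self),
    SinClosed, SinBlock_eq (ne_neg_nat_of_ne_neg_succ h.2.1) hs,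
    SinBlock_eq (ne_neg_nat_of_ne_neg_succ h.2.2.2) hs, hσ, add_comm z' z]
  ring

theorem Rin_eq_RinClosed (hN : 1 ≤ N) (hD : (z, z', w, w') ∈ D0) (hS : 0 < (z + z' + w + w').re)
    (hx : x ∉ latticeOut N) (hq : (z, z', w, w', x) ∈ generic N) :
    Rin N z z' w w' x = RinClosed N z z' w w' x := by
  obtain ⟨hzz, hs⟩ := hq
  simp only at hzz hs
  have hzz' : NonInt (z' - z) := by have := NonInt.neg hzz; rwa [neg_sub] at this
  have hA : NonInt (z + N - (z' + N)) := by rwa [add_sub_add_right_eq_sub]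
  have hcast : ((N - 1 : ℕ) : ℂ) = N - 1 := by rw [Nat.cast_sub hN, Nat.cast_one]
  have hcast' : ((N - 1 : ℕ) : ℝ) = N - 1 := by rw [Nat.cast_sub hN, Nat.cast_one]
  have hσ : z + N + (z' + N) + (w + 1 - (N - 1 : ℕ)) + (w' + 1 - (N - 1 : ℕ)) - 2 =
      z + z' + w + w' + 2 := by rw [hcast]; ring
  have hσ3 : z + N + (z' + N) + (w + 1 - (N - 1 : ℕ)) + (w' + 1 - (N - 1 : ℕ)) - 3 =
      z + z' + w + w' + 1 := by rw [hcast]; ring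
  have hS' : z' + z + w + w' = z + z' + w + w' := by rw [add_comm z' z]
  have hσre : (z + z' + w + w' + 2).re = (z + z' + w + w').re + 2 := by simp
  have hσpos : ∀ k : ℕ, z + z' + w + w' + 2 ≠ -(k : ℂ) := ne_neg_nat_of_re_pos (by linarith)
  have hh := hNsub1_ne_zero hN hD hS
  have B1 := RinBlock_eq hN hD hS hzz hs
  have B2 := RinBlock_eq hN (D0_swap hD) (by rwa [hS']) hzz' hs
  rw [hNsub1_swap, hS'] at B2
  have hres : ((N - 1).factorial : ℂ) * (poch (z + z' + w + w' + 2) (N - 1))⁻¹ *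
      (Complex.Gamma (z + z' + w + w' + 1) * (rG (z + w + 1) * rG (z + w' + 1) *
        rG (z' + w + 1) * rG (z' + w' + 1))) = hNsub1 N z z' w w' := by
    have hfac : ((N - 1).factorial : ℂ) = Complex.Gamma N := by
      rw [← Complex.Gamma_nat_eq_factorial, Nat.cast_sub hN]; simp
    have hG := Gamma_add_nat hσpos (N - 1)
    rw [hcast, show z + z' + w + w' + 2 + ((N : ℂ) - 1) = z + z' + w + w' + N + 1 by ring] at hG
    have h2 := Complex.Gamma_ne_zero hσpos
    have hp := poch_ne_zero hσpos (N - 1)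
    simp only [hNsub1, hG, hfac, rG]
    field_simp
  have hcoeff : (innerPoly N).coeff (N - 1 + 1) = 1 := by
    rw [Nat.sub_add_cancel hN, coeff_innerPoly]
  have T := orthTransform_eq_reg (N := N) (n := N - 1) (by omega) (by rw [hσ]; linarith)
    (by rw [hσ, hcast']; linarith) hA ((mem_regularSet_iff N x).mpr hx)
  rw [transformValueReg, hcoeff, hσ, hσ3, one_mul, hcast,
    show z + N + (w + 1 - ((N : ℂ) - 1)) - 1 = z + w + 1 by ring,
    show z + N + (w' + 1 - ((N : ℂ) - 1)) - 1 = z + w' + 1 by ring,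
    show z' + N + (w + 1 - ((N : ℂ) - 1)) - 1 = z' + w + 1 by ring,
    show z' + N + (w' + 1 - ((N : ℂ) - 1)) - 1 = z' + w' + 1 by ring, hres] at T
  rw [hcast] at B1 B2
  rw [Rin_eq hN hS hx, shiftPoint_eq (N - 1), hcast, T, RinClosed]
  refine mul_right_cancel₀ hh ?_
  rw [sub_mul, one_mul, div_mul_cancel₀ _ hh]
  linear_combination B1 + B2

end blocks

end ZW

theorem proposition8p1 (N : ℕ) (hN : 1 ≤ N) (z z' w w' : ℂ)
    (hD : (z, z', w, w') ∈ ZW.D0) (hS : 0 < (z + z' + w + w').re)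
    (x : ℂ) (hx : x ∉ ZW.latticeOut N) :
    -- the series defining `R_in` and `S_in` converge absolutely
    (Summable (fun y : ZW.latticeOut N => ZW.RinTerm N z z' w w' x y) ∧
      Summable (fun y : ZW.latticeOut N => ZW.SinTerm N z z' w w' x y)) ∧
    -- the closed forms, where every factor in them is defined
    ((z, z', w, w', x) ∈ ZW.generic N →
      ZW.Rin N z z' w w' x = ZW.RinClosed N z z' w w' x ∧
      ZW.Sin N z z' w w' x = ZW.SinClosed N z z' w w' x) ∧
    -- at all other points the singularities of the closed forms are removable, and the formulas
    -- hold in the limit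
    Tendsto (fun q : ℂ × ℂ × ℂ × ℂ × ℂ =>
        ZW.RinClosed N q.1 q.2.1 q.2.2.1 q.2.2.2.1 q.2.2.2.2)
      (𝓝[ZW.generic N] (z, z', w, w', x)) (𝓝 (ZW.Rin N z z' w w' x)) ∧
    Tendsto (fun q : ℂ × ℂ × ℂ × ℂ × ℂ =>
        ZW.SinClosed N q.1 q.2.1 q.2.2.1 q.2.2.2.1 q.2.2.2.2)
      (𝓝[ZW.generic N] (z, z', w, w', x)) (𝓝 (ZW.Sin N z z' w w' x)) := by
  have hq : (z, z', w, w', x) ∈ ZW.sumDomain N := ⟨hD, hS, hx⟩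
  have hnhds : ZW.sumDomain N ∈ 𝓝[ZW.generic N] (z, z', w, w', x) :=
    nhdsWithin_le_nhds ((ZW.isOpen_sumDomain N).mem_nhds hq)
  refine ⟨⟨(ZW.hasSum_RinTerm hN hS hx).summable, (ZW.hasSum_SinTerm hS hx).summable⟩,
    fun hg => ⟨ZW.Rin_eq_RinClosed hN hD hS hx hg, ZW.Sin_eq_SinClosed hD hS hx hg⟩, ?_, ?_⟩
  · refine ((ZW.continuousAt_Rin hN hq).tendsto.mono_left nhdsWithin_le_nhds).congr' ?_
    filter_upwards [hnhds, self_mem_nhdsWithin] with q h1 h2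
    exact ZW.Rin_eq_RinClosed hN h1.1 h1.2.1 h1.2.2 h2
  · refine ((ZW.continuousAt_Sin hq).tendsto.mono_left nhdsWithin_le_nhds).congr' ?_
    filter_upwards [hnhds, self_mem_nhdsWithin] with q h1 h2
    exact ZW.Sin_eq_SinClosed h1.1 h1.2.1 h1.2.2 h2
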